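/- **q-numbers and parameters.** For $q\in\mathbb C^\times$ let $[n]_q=\frac{q^n-q^{-n}}{q-q^{-1}}=\sum_{k=0}^{n-1}q^{n-1-2k}$. Let $N\ge 1$ be an integer, $r\in\mathbb R\setminus\{0\}$, and let either $q\in\mathbb R\setminus\{0\}$, or $q=e^{i\pi\varphi}$ with $|\varphi|<\frac1{2N}$. Assume $[3]_q\neq0$, $[2]_{q^2}\ne0$ and $[2]_{q^{N+1}}\neq 0$. (For real $q$ these hold automatically.) Put, with principal square roots, $$C_N=\frac{[N]_q[N+2]_q}{[2]_q^2},\qquad \Lambda_N=\frac{r\,[2]_{q^{N+1}}}{[2]_q\sqrt{C_N}} .$$ **Invariant tensors.** Spin $\frac12$ indices are $\pm$, spin $1$ indices are $1,0,-1$; repeated indices are summed. Let $\varepsilon^{+-}=q^{1/2}$, $\varepsilon^{-+}=-q^{-1/2}$, $\varepsilon_{\alpha\beta}=-\varepsilon^{\alpha\beta}$; $\sigma_1^{++}=\sigma_{-1}^{--}=1$, $\sigma_0^{+-}=q^{-1/2}/\sqrt{[2]_q}$, $\sigma_0^{-+}=q^{1/2}/\sqrt{[2]_q}$, $\sigma^i_{\alpha\beta}=\sigma_i^{\alpha\beta}$;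 $g^{1,-1}=-q$, $g^{0,0}=1$, $g^{-1,1}=-q^{-1}$, $g_{ij}=g^{ij}$; and $\varepsilon_1^{1,0}=q$, $\varepsilon_1^{0,1}=-q^{-1}$, $\varepsilon_0^{1,-1}=1$, $\varepsilon_0^{0,0}=q-q^{-1}$, $\varepsilon_0^{-1,1}=-1$, $\varepsilon_{-1}^{0,-1}=q$, $\varepsilon_{-1}^{-1,0}=-q^{-1}$, $\varepsilon^k_{ij}=\varepsilon_k^{ij}$; all other components vanish. Let $(P^-)^{kl}_{ij}=\frac1{[2]_{q^2}}\varepsilon^{kl}_n\varepsilon^n_{ij}$, $(P^0)^{kl}_{ij}=\frac1{[3]_q}g^{kl}g_{ij}$, $P^+=1-P^--P^0$, and $\hat R=q^2P^+-q^{-2}P^-+q^{-4}P^0$. **The q-deformed fuzzy sphere.** On the Fock space with basis $|m,n\rangle=(A^{+}_{+})^m(A^{+}_{-})^n|0\rangle$ $(m,n\ge0)$, let the $q$-oscillators act by $$A^+_{+}|m,n\rangle=|m+1,n\rangle,\quad A^+_{-}|m,n\rangle=q^{-m}|m,n+1\rangle,$$ $$A_+|m,n\rangle=q^{-m-1}[m]_q|m-1,n\rangle,\quad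 A_-|m,n\rangle=q^{-m-n-3}[n]_q|m,n-1\rangle .$$ They satisfy $\varepsilon_{\gamma\delta}A^+_\delta A^+_\gamma=0$, $\varepsilon^{\alpha\beta}A_\alpha A_\beta=0$ and $A^+_\alpha A_\beta=-\delta_{\alpha\beta}+q\hat R^{\alpha\gamma}_{\beta\delta}A_\gamma A^+_\delta$, where here $\hat R^{\alpha\gamma}_{\beta\delta}=q\,\sigma_i^{\alpha\gamma}\sigma^i_{\beta\delta}+\frac{q^{-1}}{[2]_q}\varepsilon^{\alpha\gamma}\varepsilon_{\beta\delta}$ is the spin $\frac12$ R-matrix. Let $F_N$ be the span of the $|m,n\rangle$ with $m+n=N$, let $\hat Z_i=A^+_{\alpha'}\varepsilon_{\alpha\alpha'}\sigma_i^{\alpha\beta}A_\beta$ and $$x_i=\frac{r\,q^{N+2}}{\sqrt{[2]_q}\sqrt{C_N}}\;\hat Z_i\big|_{F_N},$$ so that $\varepsilon_k^{ij}x_ix_j=\Lambda_Nx_k$ and $g^{ij}x_ix_j=r^2$. Then $\mathcal S^2_{q,N}\subset \mathrm{End}(F_N)$ is the unital algebra generated by the $x_i$. **Spin.** $U_q(su(2))$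 acts on $F_N$ by $H|m,n\rangle=(n-m)|m,n\rangle$, $X^+|m,n\rangle=-q\,q^{(n-m+1)/2}[m]_q|m-1,n+1\rangle$, $X^-|m,n\rangle=-q^{-1}q^{(m-n+1)/2}[n]_q|m+1,n-1\rangle$, and on $\mathrm{End}(F_N)$ by the quantum adjoint action $u\triangleright f=u_{(1)}f\,S(u_{(2)})$, where $\Delta X^\pm=X^\pm\otimes q^{H/2}+q^{-H/2}\otimes X^\pm$, $\Delta H=H\otimes 1+1\otimes H$, $S(X^\pm)=-q^{\pm1}X^\pm$, $S(H)=-H$. A spin $K$ representation in $\mathcal S^2_{q,N}$ $(K=0,1,2,\dots)$ is an irreducible $U_q(su(2))$-submodule of dimension $2K+1$, and a spin $K$ component $\psi_K$ is an element of one. **Differential calculus.** $\Omega^*_{q,N}$ is the algebra generated by $\mathcal S^2_{q,N}$ and $\xi_1,\xi_0,\xi_{-1}$ with relations $$x_i\xi_j=\hat R^{kl}_{ij}\,\xi_kx_l,\qquad \xi_i\xi_j=-q^2\hat R^{kl}_{ij}\,\xi_k\xi_l ,$$ and $\Theta=g^{ij}x_i\xi_j$. A Hodge star is a linear map $\ast_H:\Omega^*_{q,N}\to\Omega^*_{q,N}$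 that is left and right $\mathcal S^2_{q,N}$-linear, with $\ast_H\xi_i=-\frac{q^{-2}\Lambda_N}{[2]_{q^2}}\varepsilon_i^{jk}\xi_j\xi_k$, $\ast_H1=\Theta^3$ and $\ast_H\ast_H=\mathrm{id}$. The exterior derivative is $df=[\Theta,f]$ on functions, $d\alpha=\Theta\alpha+\alpha\Theta-\ast_H\alpha$ on one-forms, $d\alpha=[\Theta,\alpha]$ on two-forms, and $0$ on three-forms. **Statement.** 1. Every $\alpha\in\Omega^*_{q,N}$ can be written uniquely as $\sum_{I}\xi_If_I$ with $f_I\in\mathcal S^2_{q,N}$, where $I$ runs over the subsets of $\{1,0,-1\}$ and $\xi_I$ is the product of the $\xi_i$, $i\in I$, in the order $1,0,-1$. (So the forms of degree $0,1,2,3$ are free right modules of rank $1,3,3,1$.) 2. There is exactly one Hodge star $\ast_H$. 3. For every $K$ and every spin $K$ component $\psi_K\in\mathcal S^2_{q,N}$, $$\ast_Hd\ast_Hd\,\psi_K=\frac{2}{[2]_q\,C_N}\,[K]_q[K+1]_q\,\psi_K .$$ -/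

import Mathlib

open scoped BigOperators

set_option linter.unusedSimpArgs false

noncomputable section

namespace QSphere

/-! ### q-numbers and invariant tensors -/

/-- The q-number `[n]_q = q^(n-1) + q^(n-3) + ⋯ + q^(1-n)`, that is
`(q^n - q^(-n)) / (q - q⁻¹)`, with the limiting value where `q² = 1`. -/
def qNum (q : ℂ) (n : ℕ) : ℂ := ∑ k ∈ Finset.range n, q ^ ((n : ℤ) - 1 - 2 * (k : ℤ))

theorem qNum_mul (q : ℂ) (hq : q ≠ 0) (n : ℕ) :
    qNum q n * (q - q⁻¹) = q ^ (n : ℤ) - q ^ (-(n : ℤ)) := by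
  have key : ∀ k : ℕ, q ^ ((n : ℤ) - 1 - 2 * (k : ℤ)) * (q - q⁻¹)
      = q ^ ((n : ℤ) - 2 * (k : ℤ)) - q ^ ((n : ℤ) - 2 * ((k + 1 : ℕ) : ℤ)) := by
    intro k
    have h1 : q ^ ((n : ℤ) - 2 * (k : ℤ)) = q ^ ((n : ℤ) - 1 - 2 * (k : ℤ)) * q := by
      rw [← zpow_add_one₀ hq]; congr 1; ring
    have h2 : q ^ ((n : ℤ) - 2 * ((k + 1 : ℕ) : ℤ))
        = q ^ ((n : ℤ) - 1 - 2 * (k : ℤ)) * q⁻¹ := by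
      rw [← zpow_sub_one₀ hq]; congr 1; push_cast; ring
    rw [h1, h2]; ring
  rw [qNum, Finset.sum_mul, Finset.sum_congr rfl (fun k _ => key k),
    Finset.sum_range_sub' (fun k : ℕ => q ^ ((n : ℤ) - 2 * (k : ℤ)))]
  congr 2; ring

theorem qNum_rel (q : ℂ) (hq : q ≠ 0) (n : ℕ) :
    qNum q n * (q ^ 2 - 1) * q ^ n = q * ((q ^ n) ^ 2 - 1) ∧ q ^ n ≠ 0 := by
  have h := qNum_mul q hq n
  have hn : q ^ n ≠ 0 := pow_ne_zero n hq
  refine ⟨?_, hn⟩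
  rw [zpow_neg, zpow_natCast] at h
  field_simp at h
  linear_combination h

theorem qNum_succ (q : ℂ) (hq : q ≠ 0) (n : ℕ) :
    qNum q (n + 1) = q * qNum q n + (q ^ n)⁻¹ := by
  rw [qNum, Finset.sum_range_succ, qNum, Finset.mul_sum]
  congr 1
  · refine Finset.sum_congr rfl fun k _ => ?_
    rw [← zpow_one_add₀ hq]; congr 1; push_cast; ring
  · rw [← zpow_natCast, ← zpow_neg]; congr 1; push_cast; ring

theorem qNum_zero (q : ℂ) : qNum q 0 = 0 := by simp [qNum]

theorem qNum_two (q : ℂ) (hq : q ≠ 0) : qNum q 2 = q + q⁻¹ := by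
  rw [qNum_succ q hq, qNum_succ q hq, qNum_zero]; simp

/-- The principal square root. -/
def csqrt (z : ℂ) : ℂ := z ^ (1 / 2 : ℂ)

theorem csqrt_mul_self (z : ℂ) : csqrt z * csqrt z = z := by
  rw [← sq, csqrt, one_div]
  exact_mod_cast Complex.cpow_nat_inv_pow z two_ne_zero

theorem csqrt_ne_zero {z : ℂ} (hz : z ≠ 0) : csqrt z ≠ 0 := fun h => hz (by
  rw [← csqrt_mul_self z, h, zero_mul])

/-- `C_N = [N]_q [N+2]_q / [2]_q²`. -/
def casimirC (q : ℂ) (N : ℕ) : ℂ := qNum q N * qNum q (N + 2) / qNum q 2 ^ 2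

/-- `Λ_N = r [2]_{q^(N+1)} / √([N]_q [N+2]_q)`, where the root is taken as
`√([N]_q [N+2]_q) = [2]_q √C_N`. -/
def Lam (q : ℂ) (r : ℝ) (N : ℕ) : ℂ :=
  r * qNum (q ^ (N + 1)) 2 / (qNum q 2 * csqrt (casimirC q N))

/-- `ε^{αβ}` for spin 1/2; the index `0` stands for `+` and `1` for `-`. -/
def eps2 (q : ℂ) : Matrix (Fin 2) (Fin 2) ℂ := !![0, csqrt q; -(csqrt q)⁻¹, 0]

/-- `ε_{αβ} = -ε^{αβ}`. -/
def eps2Low (q : ℂ) : Matrix (Fin 2) (Fin 2) ℂ := -eps2 q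

theorem eps2Low_apply (q : ℂ) : eps2Low q 0 0 = 0 ∧ eps2Low q 0 1 = -csqrt q ∧
    eps2Low q 1 0 = (csqrt q)⁻¹ ∧ eps2Low q 1 1 = 0 := by
  simp [eps2Low, eps2]

theorem eps2_apply (q : ℂ) : eps2 q 0 0 = 0 ∧ eps2 q 0 1 = csqrt q ∧
    eps2 q 1 0 = -(csqrt q)⁻¹ ∧ eps2 q 1 1 = 0 := by
  simp [eps2]

/-- The Clebsch-Gordan coefficients `σ_i^{αβ} = σ^i_{αβ}`. Spin 1 indices `0, 1, 2 : Fin 3` stand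
for the weights `1, 0, -1`. -/
def sigma (q : ℂ) : Fin 3 → Matrix (Fin 2) (Fin 2) ℂ :=
  ![!![1, 0; 0, 0],
    !![0, (csqrt q)⁻¹ / csqrt (qNum q 2); csqrt q / csqrt (qNum q 2), 0],
    !![0, 0; 0, 1]]

/-- `R̂^{αγ}_{βδ} = q P⁺ - q⁻¹ P⁻` for spin 1/2, with `P⁻ = -ε^{αγ} ε_{βδ} / [2]_q` and
`P⁺ = σ_i^{αγ} σ^i_{βδ}`. -/
def Rhat2 (q : ℂ) (α γ β δ : Fin 2) : ℂ :=
  q * ∑ i, sigma q i α γ * sigma q i β δ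
    - q⁻¹ * (-(1 / qNum q 2) * eps2 q α γ * eps2Low q β δ)

theorem Rhat2_apply (q : ℂ) (hq : q ≠ 0) (h2 : qNum q 2 ≠ 0) (α γ β δ : Fin 2) :
    Rhat2 q α γ β δ = !![
      !![q, 0; 0, 0], !![0, 0; 1, 0];
      !![0, 1; 0, 0], !![q - q⁻¹, 0; 0, q]] α β γ δ := by
  have hs : csqrt q ≠ 0 := csqrt_ne_zero hq
  have hss : csqrt q * csqrt q = q := csqrt_mul_self q
  have hc : csqrt (qNum q 2) ≠ 0 := csqrt_ne_zero h2
  have hcc : csqrt (qNum q 2) * csqrt (qNum q 2) = q + q⁻¹ := by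
    rw [csqrt_mul_self, qNum_two q hq]
  have hd : q + q⁻¹ ≠ 0 := by rwa [← qNum_two q hq]
  have hd' : q ^ 2 + 1 ≠ 0 := fun h => hd (by field_simp; rw [h, mul_zero])
  rw [Rhat2]
  have hcc' : csqrt (q + q⁻¹) ^ 2 = q + q⁻¹ := by rw [sq, csqrt_mul_self]
  have hss' : csqrt q ^ 2 = q := by rw [sq, hss]
  fin_cases α <;> fin_cases γ <;> fin_cases β <;> fin_cases δ <;>
    simp [sigma, eps2, eps2Low, Fin.sum_univ_three, qNum_two q hq]
  all_goals
    rw [qNum_two q hq] at hc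
    simp only [div_mul_div_comm, csqrt_mul_self (q + q⁻¹)]
    clear hcc hcc' hc h2
    generalize csqrt q = s at *
    subst hss'
    have hX : s ^ 4 + 1 ≠ 0 := fun h => hd' (by rw [← h]; ring)
    have hY : s ^ 2 + (s ^ 2)⁻¹ = (s ^ 4 + 1) / s ^ 2 := by field_simp
    rw [hY]
    field_simp
    try ring

/-- The invariant tensor `g^{ij} = g_{ij}` for spin 1. -/
def g (q : ℂ) : Matrix (Fin 3) (Fin 3) ℂ := !![0, 0, -q; 0, 1, 0; -q⁻¹, 0, 0]

/-- The structure constants: `eps q k i j` is `ε^{ij}_k = ε_{ij}^k`. -/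
def eps (q : ℂ) : Fin 3 → Matrix (Fin 3) (Fin 3) ℂ :=
  ![!![0, q, 0; -q⁻¹, 0, 0; 0, 0, 0],
    !![0, 0, 1; 0, q - q⁻¹, 0; -1, 0, 0],
    !![0, 0, 0; 0, 0, q; 0, -q⁻¹, 0]]

/-- `(P⁻)^{kl}_{ij} = ∑ n, ε^{kl}_n ε^n_{ij} / [2]_{q²}`. -/
def Pminus (q : ℂ) (k l i j : Fin 3) : ℂ :=
  1 / qNum (q ^ 2) 2 * ∑ n, eps q n k l * eps q n i j

/-- `(P⁰)^{kl}_{ij} = g^{kl} g_{ij} / [3]_q`. -/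
def Pzero (q : ℂ) (k l i j : Fin 3) : ℂ := 1 / qNum q 3 * g q k l * g q i j

/-- `P⁺ = 1 - P⁻ - P⁰`. -/
def Pplus (q : ℂ) (k l i j : Fin 3) : ℂ :=
  (if k = i ∧ l = j then 1 else 0) - Pminus q k l i j - Pzero q k l i j

/-- The spin 1 R-matrix `R̂^{kl}_{ij} = q² P⁺ - q⁻² P⁻ + q⁻⁴ P⁰`. -/
def Rhat (q : ℂ) (k l i j : Fin 3) : ℂ :=
  q ^ 2 * Pplus q k l i j - (q ^ 2)⁻¹ * Pminus q k l i j + (q ^ 4)⁻¹ * Pzero q k l i j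

/-! ### q-oscillators and their Fock space -/

/-- The Fock space. The basis vector with index `(m, n)` is
`(A⁺^{+})^m (A⁺^{-})^n |0⟩`. -/
abbrev Fock : Type := ℕ × ℕ →₀ ℂ

/-- The creation operators `A⁺^α`. -/
def creation (q : ℂ) : Fin 2 → Module.End ℂ Fock :=
  ![Finsupp.linearCombination ℂ (fun p : ℕ × ℕ => Finsupp.single (p.1 + 1, p.2) (1 : ℂ)),
    Finsupp.linearCombination ℂ
      (fun p : ℕ × ℕ => Finsupp.single (p.1, p.2 + 1) (q ^ (-(p.1 : ℤ))))]

/-- The annihilation operators `A_α`. -/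
def annihilation (q : ℂ) : Fin 2 → Module.End ℂ Fock :=
  ![Finsupp.linearCombination ℂ
      (fun p : ℕ × ℕ => Finsupp.single (p.1 - 1, p.2) (q ^ (-(p.1 : ℤ) - 1) * qNum q p.1)),
    Finsupp.linearCombination ℂ
      (fun p : ℕ × ℕ => Finsupp.single (p.1, p.2 - 1)
        (q ^ (-(p.1 : ℤ) - (p.2 : ℤ) - 3) * qNum q p.2))]

/-- `Ẑ_i = A⁺^{α'} ε_{αα'} σ_i^{αβ} A_β`. -/
def Zhat (q : ℂ) (i : Fin 3) : Module.End ℂ Fock :=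
  ∑ α, ∑ α', ∑ β, (eps2Low q α α' * sigma q i α β) • (creation q α' * annihilation q β)

/-- The sector `F_N` with `N` quanta. -/
def sector (N : ℕ) : Submodule ℂ Fock := Finsupp.supported ℂ ℂ {p : ℕ × ℕ | p.1 + p.2 = N}

theorem sector_invariant {N : ℕ} (T : Module.End ℂ Fock)
    (hT : ∀ p : ℕ × ℕ, p.1 + p.2 = N → T (Finsupp.single p 1) ∈ sector N) :
    ∀ v ∈ sector N, T v ∈ sector N := by
  intro v hv
  rw [sector, Finsupp.supported_eq_span_single] at hv
  induction hv using Submodule.span_induction with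
  | mem x hx => obtain ⟨p, hp, rfl⟩ := hx; exact hT p hp
  | zero => simp
  | add x y _ _ hx hy => rw [map_add]; exact add_mem hx hy
  | smul a x _ hx => rw [map_smul]; exact Submodule.smul_mem _ _ hx

theorem single_mem_sector {N : ℕ} (p : ℕ × ℕ) (c : ℂ) (h : c ≠ 0 → p.1 + p.2 = N) :
    Finsupp.single p c ∈ sector N := by
  by_cases hc : c = 0
  · simp [hc]
  · exact Finsupp.single_mem_supported ℂ c (h hc)

theorem pos_of_qNum_ne {q : ℂ} {n : ℕ} (h : qNum q n ≠ 0) : 0 < n := by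
  rcases Nat.eq_zero_or_pos n with rfl | hn
  · exact absurd (qNum_zero q) h
  · exact hn

theorem Zhat_sector (q : ℂ) (N : ℕ) (i : Fin 3) :
    ∀ v ∈ sector N, Zhat q i v ∈ sector N := by
  apply sector_invariant
  intro p hp
  simp only [Zhat, LinearMap.sum_apply, LinearMap.smul_apply]
  refine sum_mem fun α _ => sum_mem fun α' _ => sum_mem fun β _ => Submodule.smul_mem _ _ ?_
  fin_cases α' <;> fin_cases β <;>
    simp only [Fin.zero_eta, Fin.mk_one, creation, annihilation, Module.End.mul_apply,
      Matrix.cons_val_zero, Matrix.cons_val_one, Finsupp.linearCombination_single,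
      Finsupp.smul_single, one_smul, smul_eq_mul] <;>
    refine single_mem_sector _ _ fun h => ?_
  all_goals
    simp only [mul_ne_zero_iff] at h
    have := pos_of_qNum_ne h.1.2
    simp only; omega

/-- The basis `(A⁺^{+})^b (A⁺^{-})^(N-b) |0⟩`, `0 ≤ b ≤ N`, of `F_N`. -/
def basisVec (N : ℕ) (b : Fin (N + 1)) : Fock := Finsupp.single ((b : ℕ), N - (b : ℕ)) 1

/-- Operators on `F_N`, as matrices in the basis `basisVec N`. -/
abbrev SectorMat (N : ℕ) : Type := Matrix (Fin (N + 1)) (Fin (N + 1)) ℂ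

/-- The matrix of the restriction to `F_N` of an operator that preserves `F_N`. -/
def sectorMatrix (N : ℕ) (T : Module.End ℂ Fock) : SectorMat N :=
  Matrix.of fun a b => T (basisVec N b) ((a : ℕ), N - (a : ℕ))

theorem sectorMatrix_spec (N : ℕ) (T : Module.End ℂ Fock) (hT : ∀ v ∈ sector N, T v ∈ sector N)
    (b : Fin (N + 1)) : T (basisVec N b) = ∑ a, sectorMatrix N T a b • basisVec N a := by
  have hb : T (basisVec N b) ∈ sector N :=
    hT _ (single_mem_sector _ _ fun _ => by have := b.2; simp only; omega)
  ext ⟨m, n⟩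
  rw [Finsupp.finsetSum_apply]
  simp only [Finsupp.smul_apply, basisVec, Finsupp.single_apply, Prod.mk.injEq, smul_eq_mul]
  by_cases h : m + n = N
  · rw [Finset.sum_eq_single (⟨m, by omega⟩ : Fin (N + 1))]
    · have : N - m = n := by omega
      simp [sectorMatrix, this, basisVec]
    · intro a _ ha
      rw [if_neg, mul_zero]
      rintro ⟨h1, -⟩
      exact ha (Fin.ext h1)
    · simp
  · rw [Finset.sum_eq_zero]
    · exact (Finsupp.mem_supported' ℂ _).1 hb (m, n) h
    · intro a _
      rw [if_neg, mul_zero]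
      rintro ⟨h1, h2⟩
      have := a.2
      omega

theorem sectorMatrix_mul (N : ℕ) (S T : Module.End ℂ Fock) (hT : ∀ v ∈ sector N, T v ∈ sector N) :
    sectorMatrix N (S * T) = sectorMatrix N S * sectorMatrix N T := by
  ext a b
  rw [Matrix.mul_apply]
  simp only [sectorMatrix, Matrix.of_apply, Module.End.mul_apply]
  conv_lhs => rw [sectorMatrix_spec N T hT b, map_sum, Finsupp.finsetSum_apply]
  refine Finset.sum_congr rfl fun c _ => ?_
  rw [map_smul, Finsupp.smul_apply, smul_eq_mul, mul_comm]
  rfl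

/-! Checks of the defining relations of the q-oscillators. -/

theorem creation_zero_single (q : ℂ) (m n : ℕ) (c : ℂ) :
    creation q 0 (Finsupp.single (m, n) c) = Finsupp.single (m + 1, n) c := by
  simp [creation]

theorem creation_one_single (q : ℂ) (m n : ℕ) (c : ℂ) :
    creation q 1 (Finsupp.single (m, n) c) =
      Finsupp.single (m, n + 1) (c * q ^ (-(m : ℤ))) := by
  simp [creation]

theorem annihilation_zero_single (q : ℂ) (m n : ℕ) (c : ℂ) :
    annihilation q 0 (Finsupp.single (m, n) c) =
      Finsupp.single (m - 1, n) (c * (q ^ (-(m : ℤ) - 1) * qNum q m)) := by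
  rw [annihilation]; simp [-Finsupp.single_mul, -mul_eq_mul_left_iff]

theorem annihilation_one_single (q : ℂ) (m n : ℕ) (c : ℂ) :
    annihilation q 1 (Finsupp.single (m, n) c) =
      Finsupp.single (m, n - 1) (c * (q ^ (-(m : ℤ) - (n : ℤ) - 3) * qNum q n)) := by
  rw [annihilation]; simp [-Finsupp.single_mul, -mul_eq_mul_left_iff]

/-- The annihilation operators kill the vacuum. -/
theorem annihilation_vacuum (q : ℂ) (α : Fin 2) :
    annihilation q α (Finsupp.single (0, 0) 1) = 0 := by
  fin_cases α <;> simp [annihilation, qNum_zero]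

/-- `ε_{γδ} A⁺^δ A⁺^γ = 0`. -/
theorem creation_antisymm (q : ℂ) (hq : q ≠ 0) :
    ∑ γ, ∑ δ, eps2Low q γ δ • (creation q δ * creation q γ) = 0 := by
  have hs : csqrt q ≠ 0 := csqrt_ne_zero hq
  have hss : csqrt q * csqrt q = q := csqrt_mul_self q
  obtain ⟨e1, e2, e3, e4⟩ := eps2Low_apply q
  obtain ⟨f1, f2, f3, f4⟩ := eps2_apply q
  refine Finsupp.lhom_ext' fun ⟨m, n⟩ => LinearMap.ext_ring ?_
  simp only [Fin.sum_univ_two, e1, e2, e3, e4, f1, f2, f3, f4, LinearMap.comp_apply,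
      LinearMap.add_apply, LinearMap.smul_apply, Module.End.mul_apply, Finsupp.lsingle_apply,
      creation_zero_single, creation_one_single, annihilation_zero_single,
      annihilation_one_single, Finsupp.smul_single, LinearMap.zero_apply, smul_eq_mul, zero_smul,
      qNum_zero, zero_mul, mul_zero, Finsupp.single_zero, zero_add, add_zero, one_mul,
      Nat.add_sub_cancel, map_zero, smul_zero]
  rw [← Finsupp.single_add, Finsupp.single_eq_zero]
  simp only [zpow_neg, zpow_natCast, pow_succ]
  field_simp
  linear_combination (-1) * hss

/-- `ε^{αβ} A_α A_β = 0`. -/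
theorem annihilation_antisymm (q : ℂ) (hq : q ≠ 0) :
    ∑ α, ∑ β, eps2 q α β • (annihilation q α * annihilation q β) = 0 := by
  have hs : csqrt q ≠ 0 := csqrt_ne_zero hq
  have hss : csqrt q * csqrt q = q := csqrt_mul_self q
  obtain ⟨e1, e2, e3, e4⟩ := eps2Low_apply q
  obtain ⟨f1, f2, f3, f4⟩ := eps2_apply q
  refine Finsupp.lhom_ext' fun ⟨m, n⟩ => LinearMap.ext_ring ?_
  rcases m with _ | m <;> rcases n with _ | n <;>
    simp only [Fin.sum_univ_two, e1, e2, e3, e4, f1, f2, f3, f4, LinearMap.comp_apply,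
      LinearMap.add_apply, LinearMap.smul_apply, Module.End.mul_apply, Finsupp.lsingle_apply,
      creation_zero_single, creation_one_single, annihilation_zero_single,
      annihilation_one_single, Finsupp.smul_single, LinearMap.zero_apply, smul_eq_mul, zero_smul,
      qNum_zero, zero_mul, mul_zero, Finsupp.single_zero, zero_add, add_zero, one_mul,
      Nat.add_sub_cancel, map_zero, smul_zero]
  rw [← Finsupp.single_add, Finsupp.single_eq_zero]
  have h1 : q ^ (-((m + 1 : ℕ) : ℤ) - ((n + 1 : ℕ) : ℤ) - 3) =
      q ^ (-(m : ℤ) - ((n + 1 : ℕ) : ℤ) - 3) * q⁻¹ := by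
    rw [← zpow_sub_one₀ hq]; congr 1; push_cast; ring
  rw [h1]
  field_simp
  linear_combination (q ^ (-(m : ℤ) - ((n + 1 : ℕ) : ℤ) - 3) * qNum q (n + 1) * q ^ (-((m + 1 : ℕ) : ℤ) - 1) * qNum q (m + 1)) * hss

/-- `A⁺^α A_β = -δ^α_β + q R̂^{αγ}_{βδ} A_γ A⁺^δ`; for `q = 1` this is `[A_β, A⁺^α] = δ^α_β`. -/
theorem creation_annihilation (q : ℂ) (hq : q ≠ 0) (h2 : qNum q 2 ≠ 0) (α β : Fin 2) :
    creation q α * annihilation q β = -(if α = β then 1 else 0) +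
      q • ∑ γ, ∑ δ, Rhat2 q α γ β δ • (annihilation q γ * creation q δ) := by
  have hs : csqrt q ≠ 0 := csqrt_ne_zero hq
  have hss : csqrt q * csqrt q = q := csqrt_mul_self q
  obtain ⟨e1, e2, e3, e4⟩ := eps2Low_apply q
  have hR := Rhat2_apply q hq h2
  refine Finsupp.lhom_ext' fun ⟨m, n⟩ => LinearMap.ext_ring ?_
  obtain ⟨hm, hu⟩ := qNum_rel q hq (m - 1)
  obtain ⟨hn, hv⟩ := qNum_rel q hq (n - 1)
  rcases m with _ | m <;> rcases n with _ | n <;> fin_cases α <;> fin_cases β <;>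
    simp [hR, Fin.sum_univ_two, creation_zero_single, creation_one_single,
      annihilation_zero_single, annihilation_one_single, qNum_zero, qNum_succ q hq,
      -Finsupp.single_mul, -Finsupp.single_add, -Finsupp.single_neg, zpow_add₀ hq, zpow_sub₀ hq]
  all_goals
    try simp only [Nat.add_sub_cancel] at hm hu hn hv
    try simp only [← Finsupp.single_neg, ← Finsupp.single_add]
    try rw [eq_comm, Finsupp.single_eq_zero]
    try congr 1
    try simp only [pow_succ]
    try generalize q ^ m = u at *
    try generalize q ^ n = v at *
    try generalize qNum q m = a at *
    try generalize qNum q n = b at *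
    field_simp
    try grind

theorem Zhat_zero_single (q : ℂ) (m n : ℕ) (c : ℂ) :
    Zhat q 0 (Finsupp.single (m, n) c) = Finsupp.single (m - 1, n + 1)
      (c * (-(csqrt q * q ^ (-(m : ℤ) - 1) * qNum q m * q ^ (-((m - 1 : ℕ) : ℤ))))) := by
  obtain ⟨e1, e2, e3, e4⟩ := eps2Low_apply q
  simp only [Zhat, Fin.sum_univ_two, e1, e2, e3, e4, sigma, LinearMap.add_apply,
    LinearMap.smul_apply, Module.End.mul_apply, Matrix.of_apply, Matrix.cons_val', Matrix.cons_val_zero,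
    Matrix.cons_val_one, Matrix.cons_val_fin_one, Matrix.cons_val, mul_zero, zero_mul, zero_smul,
    zero_add, add_zero, mul_one, creation_zero_single, creation_one_single,
    annihilation_zero_single, annihilation_one_single, Finsupp.smul_single, smul_eq_mul]
  congr 1
  ring

theorem Zhat_two_single (q : ℂ) (m n : ℕ) (c : ℂ) :
    Zhat q 2 (Finsupp.single (m, n) c) = Finsupp.single (m + 1, n - 1)
      (c * ((csqrt q)⁻¹ * q ^ (-(m : ℤ) - (n : ℤ) - 3) * qNum q n)) := by
  obtain ⟨e1, e2, e3, e4⟩ := eps2Low_apply q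
  simp only [Zhat, Fin.sum_univ_two, e1, e2, e3, e4, sigma, LinearMap.add_apply,
    LinearMap.smul_apply, Module.End.mul_apply, Matrix.of_apply, Matrix.cons_val', Matrix.cons_val_zero,
    Matrix.cons_val_one, Matrix.cons_val_fin_one, Matrix.cons_val, mul_zero, zero_mul, zero_smul,
    zero_add, add_zero, mul_one, creation_zero_single, creation_one_single,
    annihilation_zero_single, annihilation_one_single, Finsupp.smul_single, smul_eq_mul]
  congr 1
  ring

theorem Zhat_one_single (q : ℂ) (hq : q ≠ 0) (m n : ℕ) (c : ℂ) :
    Zhat q 1 (Finsupp.single (m, n) c) = Finsupp.single (m, n)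
      (c * ((q ^ (-(m : ℤ) - 1) * qNum q m - q ^ (-2 * (m : ℤ) - (n : ℤ) - 3) * qNum q n)
        / csqrt (qNum q 2))) := by
  obtain ⟨e1, e2, e3, e4⟩ := eps2Low_apply q
  have hs : csqrt q ≠ 0 := csqrt_ne_zero hq
  simp only [Zhat, Fin.sum_univ_two, e1, e2, e3, e4, sigma, LinearMap.add_apply,
    LinearMap.smul_apply, Module.End.mul_apply, Matrix.of_apply, Matrix.cons_val', Matrix.cons_val_zero,
    Matrix.cons_val_one, Matrix.cons_val_fin_one, Matrix.cons_val, mul_zero, zero_mul, zero_smul,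
    zero_add, add_zero, mul_one, creation_zero_single, creation_one_single,
    annihilation_zero_single, annihilation_one_single, Finsupp.smul_single, smul_eq_mul]
  have hz : q ^ (-2 * (m : ℤ) - (n : ℤ) - 3) =
      q ^ (-(m : ℤ) - (n : ℤ) - 3) * q ^ (-(m : ℤ)) := by
    rw [← zpow_add₀ hq]; congr 1; ring
  rw [hz]
  rcases m with _ | m <;> rcases n with _ | n <;>
    simp only [qNum_zero, mul_zero, zero_mul, Finsupp.single_zero, add_zero, zero_add,
      Nat.add_sub_cancel, ← Finsupp.single_add, Nat.zero_sub, sub_zero, zero_div, zero_sub] <;>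
    congr 1 <;> field_simp
  all_goals try ring

theorem Zhat_eps (q : ℂ) (hq : q ≠ 0) (h2 : qNum q 2 ≠ 0) (k : Fin 3) (m n : ℕ) :
    (∑ i, ∑ j, eps q k i j • (Zhat q i * Zhat q j)) (Finsupp.single (m, n) 1) =
      (qNum (q ^ (m + n + 1)) 2 * (q ^ (m + n + 2))⁻¹ / csqrt (qNum q 2)) •
        Zhat q k (Finsupp.single (m, n) 1) := by
  obtain ⟨hm, hu⟩ := qNum_rel q hq (m - 1)
  obtain ⟨hn, hv⟩ := qNum_rel q hq (n - 1)
  have hc : csqrt (qNum q 2) ≠ 0 := csqrt_ne_zero h2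
  have hcc := csqrt_mul_self (qNum q 2)
  have hs : csqrt q ≠ 0 := csqrt_ne_zero hq
  have hss : csqrt q * csqrt q = q := csqrt_mul_self q
  have hd : qNum q 2 = q + q⁻¹ := qNum_two q hq
  rw [qNum_two _ (pow_ne_zero _ hq)]
  have h1 : qNum q 1 = 1 := by simpa [qNum_zero] using qNum_succ q hq 0
  have hz : ∀ k : ℕ, q ^ (-(2 * (k : ℤ))) = ((q ^ k) ^ 2)⁻¹ := fun k => by
    rw [zpow_neg, ← pow_mul, mul_comm]; norm_cast
  have Z1 := Zhat_one_single q hq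
  generalize csqrt (qNum q 2) = c at *
  rw [hd] at hcc
  rcases m with _ | m <;> rcases n with _ | n <;> fin_cases k <;>
    simp [eps, Fin.sum_univ_three, Zhat_zero_single, Z1, Zhat_two_single,
      qNum_zero, h1, qNum_succ q hq, zpow_add₀ hq, zpow_sub₀ hq, hz, mul_add, -Finsupp.single_mul,
      -Finsupp.single_add, -Finsupp.single_neg, -Finsupp.single_sub]
  all_goals
    try simp only [Nat.add_sub_cancel] at hm hu hn hv
    try simp only [← Finsupp.single_neg, ← Finsupp.single_add, ← Finsupp.single_sub]
    try congr 1
    try simp only [pow_succ, pow_add, zpow_mul]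
    generalize csqrt q = s at *
    try generalize q ^ m = u at *
    try generalize q ^ n = v at *
    try generalize qNum q m = a at *
    try generalize qNum q n = b at *
    field_simp
    field_simp at hcc
    try grind

theorem Zhat_g (q : ℂ) (hq : q ≠ 0) (h2 : qNum q 2 ≠ 0) (m n : ℕ) :
    (∑ i, ∑ j, g q i j • (Zhat q i * Zhat q j)) (Finsupp.single (m, n) 1) =
      Finsupp.single (m, n)
        (qNum q (m + n) * qNum q (m + n + 2) / qNum q 2 * ((q ^ (m + n + 2))⁻¹) ^ 2) := by
  obtain ⟨hm, hu⟩ := qNum_rel q hq (m - 1)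
  obtain ⟨hn, hv⟩ := qNum_rel q hq (n - 1)
  have hc : csqrt (qNum q 2) ≠ 0 := csqrt_ne_zero h2
  have hcc := csqrt_mul_self (qNum q 2)
  have hs : csqrt q ≠ 0 := csqrt_ne_zero hq
  have hss : csqrt q * csqrt q = q := csqrt_mul_self q
  have hd : qNum q 2 = q + q⁻¹ := qNum_two q hq
  have h1 : qNum q 1 = 1 := by simpa [qNum_zero] using qNum_succ q hq 0
  have hz : ∀ k : ℕ, q ^ (-(2 * (k : ℤ))) = ((q ^ k) ^ 2)⁻¹ := fun k => by
    rw [zpow_neg, ← pow_mul, mul_comm]; norm_cast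
  have hadd : ∀ k l : ℕ, qNum q (k + l) = q ^ l * qNum q k + (q ^ k)⁻¹ * qNum q l := by
    intro k l
    induction l with
    | zero => simp [qNum_zero]
    | succ l ih =>
      rw [← add_assoc, qNum_succ q hq, ih, qNum_succ q hq, pow_succ, pow_add]
      have := pow_ne_zero k hq
      have := pow_ne_zero l hq
      field_simp
      try ring
  have Z1 := Zhat_one_single q hq
  generalize csqrt (qNum q 2) = c at *
  rw [hd] at hcc
  rw [qNum_succ q hq (m + n + 1), qNum_succ q hq (m + n), hadd m n, hd, ← hcc]
  clear hadd
  rcases m with _ | m <;> rcases n with _ | n <;>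
    simp [g, Fin.sum_univ_three, Zhat_zero_single, Z1, Zhat_two_single,
      qNum_zero, h1, qNum_succ q hq, zpow_add₀ hq, zpow_sub₀ hq, hz, mul_add, -Finsupp.single_mul,
      -Finsupp.single_add, -Finsupp.single_neg, -Finsupp.single_sub]
  all_goals
    try simp only [Nat.add_sub_cancel] at hm hu hn hv
    try simp only [← Finsupp.single_neg, ← Finsupp.single_add, ← Finsupp.single_sub]
    try congr 1
    try simp only [pow_succ, pow_add, zpow_mul]
    generalize csqrt q = s at *
    try generalize q ^ m = u at *
    try generalize q ^ n = v at *
    try generalize qNum q m = a at *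
    try generalize qNum q n = b at *
    field_simp
    field_simp at hcc
    try grind

/-! ### The q-deformed fuzzy sphere -/

/-- The coordinates `x_i = r q^(N+2) / √([2]_q C_N) Ẑ_i`, acting on `F_N`. -/
def coord (q : ℂ) (r : ℝ) (N : ℕ) (i : Fin 3) : SectorMat N :=
  (r * q ^ (N + 2) / (csqrt (qNum q 2) * csqrt (casimirC q N))) • sectorMatrix N (Zhat q i)

theorem coord_quad (q : ℂ) (r : ℝ) (N : ℕ) (t : Matrix (Fin 3) (Fin 3) ℂ) :
    ∑ i, ∑ j, t i j • (coord q r N i * coord q r N j) =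
      (r * q ^ (N + 2) / (csqrt (qNum q 2) * csqrt (casimirC q N))) ^ 2 •
        sectorMatrix N (∑ i, ∑ j, t i j • (Zhat q i * Zhat q j)) := by
  have h : sectorMatrix N (∑ i, ∑ j, t i j • (Zhat q i * Zhat q j)) =
      ∑ i, ∑ j, t i j • (sectorMatrix N (Zhat q i) * sectorMatrix N (Zhat q j)) := by
    simp only [← sectorMatrix_mul N _ _ (Zhat_sector q N _)]
    ext a b
    simp [sectorMatrix, Matrix.sum_apply, Finsupp.finsetSum_apply]
  rw [h, Finset.smul_sum]
  refine Finset.sum_congr rfl fun i _ => ?_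
  rw [Finset.smul_sum]
  refine Finset.sum_congr rfl fun j _ => ?_
  rw [coord, coord, smul_mul_smul_comm, smul_comm, sq]

/-- `ε_k^{ij} x_i x_j = Λ_N x_k`. -/
theorem coord_eps (q : ℂ) (r : ℝ) (N : ℕ) (hq : q ≠ 0) (h2 : qNum q 2 ≠ 0)
    (hC : casimirC q N ≠ 0) (k : Fin 3) :
    ∑ i, ∑ j, eps q k i j • (coord q r N i * coord q r N j) = Lam q r N • coord q r N k := by
  have hc : csqrt (qNum q 2) ≠ 0 := csqrt_ne_zero h2
  have hk : csqrt (casimirC q N) ≠ 0 := csqrt_ne_zero hC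
  have hcc := csqrt_mul_self (qNum q 2)
  have hkk := csqrt_mul_self (casimirC q N)
  rw [coord_quad, coord, smul_smul]
  ext a b
  have hb : (b : ℕ) + (N - (b : ℕ)) = N := by have := b.2; omega
  have h := Zhat_eps q hq h2 k b (N - b)
  rw [hb] at h
  simp only [Matrix.smul_apply, sectorMatrix, Matrix.of_apply, basisVec, h, Finsupp.smul_apply,
    smul_eq_mul, Lam]
  rw [← mul_assoc]
  congr 1
  generalize csqrt (qNum q 2) = c at *
  rw [← hcc]
  field_simp

/-- `g^{ij} x_i x_j = r²`. -/
theorem coord_g (q : ℂ) (r : ℝ) (N : ℕ) (hq : q ≠ 0) (h2 : qNum q 2 ≠ 0)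
    (hC : casimirC q N ≠ 0) :
    ∑ i, ∑ j, g q i j • (coord q r N i * coord q r N j) = ((r : ℂ) ^ 2) • 1 := by
  have hc : csqrt (qNum q 2) ≠ 0 := csqrt_ne_zero h2
  have hk : csqrt (casimirC q N) ≠ 0 := csqrt_ne_zero hC
  have hcc := csqrt_mul_self (qNum q 2)
  have hkk := csqrt_mul_self (casimirC q N)
  rw [coord_quad]
  ext a b
  have hb : (b : ℕ) + (N - (b : ℕ)) = N := by have := b.2; omega
  have h := Zhat_g q hq h2 b (N - b)
  rw [hb] at h
  have hprod : qNum q N * qNum q (N + 2) = casimirC q N * qNum q 2 ^ 2 := by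
    rw [casimirC]; field_simp
  simp only [Matrix.smul_apply, sectorMatrix, Matrix.of_apply, basisVec, h, smul_eq_mul,
    Matrix.one_apply, Finsupp.single_apply, Prod.mk.injEq, hprod]
  by_cases hab : a = b
  · subst hab
    simp only [and_self, if_true]
    generalize csqrt (qNum q 2) = c at *
    generalize csqrt (casimirC q N) = k at *
    rw [← hkk, ← hcc]
    field_simp
  · rw [if_neg hab, if_neg, mul_zero, mul_zero]
    rintro ⟨h1, -⟩
    exact hab (Fin.ext h1.symm)

/-- `S²_{q,N}`: the algebra generated by the `x_i` acting on `F_N`. -/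
def Sphere (q : ℂ) (r : ℝ) (N : ℕ) : Subalgebra ℂ (SectorMat N) :=
  Algebra.adjoin ℂ (Set.range (coord q r N))

/-- `x_i` as an element of `S²_{q,N}`. -/
def sphereCoord (q : ℂ) (r : ℝ) (N : ℕ) (i : Fin 3) : Sphere q r N :=
  ⟨coord q r N i, Algebra.subset_adjoin ⟨i, rfl⟩⟩

/-! ### The action of `U_q(su(2))` -/

/-- `q^(aH/2)` on Fock space, where `H A⁺^± = ∓ A⁺^±`. -/
def fockQH (q : ℂ) (a : ℤ) : Module.End ℂ Fock :=
  Finsupp.linearCombination ℂ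
    (fun p : ℕ × ℕ => Finsupp.single p (csqrt q ^ (a * ((p.2 : ℤ) - (p.1 : ℤ)))))

/-- `H` on Fock space. -/
def fockH : Module.End ℂ Fock :=
  Finsupp.linearCombination ℂ (fun p : ℕ × ℕ => Finsupp.single p ((p.2 : ℂ) - (p.1 : ℂ)))

/-- `X⁺` on Fock space. -/
def fockXp (q : ℂ) : Module.End ℂ Fock :=
  Finsupp.linearCombination ℂ (fun p : ℕ × ℕ => Finsupp.single (p.1 - 1, p.2 + 1)
    (-(q * csqrt q ^ ((p.2 : ℤ) - (p.1 : ℤ) + 1)) * qNum q p.1))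

/-- `X⁻` on Fock space. -/
def fockXm (q : ℂ) : Module.End ℂ Fock :=
  Finsupp.linearCombination ℂ (fun p : ℕ × ℕ => Finsupp.single (p.1 + 1, p.2 - 1)
    (-(q⁻¹ * csqrt q ^ ((p.1 : ℤ) - (p.2 : ℤ) + 1)) * qNum q p.2))

theorem fockXp_single (q : ℂ) (m n : ℕ) (c : ℂ) :
    fockXp q (Finsupp.single (m, n) c) = Finsupp.single (m - 1, n + 1)
      (c * (-(q * csqrt q ^ ((n : ℤ) - (m : ℤ) + 1)) * qNum q m)) := by
  simp [fockXp, -Finsupp.single_mul]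

theorem fockXm_single (q : ℂ) (m n : ℕ) (c : ℂ) :
    fockXm q (Finsupp.single (m, n) c) = Finsupp.single (m + 1, n - 1)
      (c * (-(q⁻¹ * csqrt q ^ ((m : ℤ) - (n : ℤ) + 1)) * qNum q n)) := by
  simp [fockXm, -Finsupp.single_mul]

theorem fockQH_single (q : ℂ) (a : ℤ) (m n : ℕ) (c : ℂ) :
    fockQH q a (Finsupp.single (m, n) c) = Finsupp.single (m, n)
      (c * csqrt q ^ (a * ((n : ℤ) - (m : ℤ)))) := by
  simp [fockQH]

/-! The action on Fock space is the one determined by `X^± |0⟩ = 0`, the coproduct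
`Δ X^± = X^± ⊗ q^(H/2) + q^(-H/2) ⊗ X^±`, and the transformation of
`(ε_{+-} A⁺^-, ε_{-+} A⁺^+)` as the spin 1/2 doublet. -/

theorem fockXp_vacuum (q : ℂ) : fockXp q (Finsupp.single (0, 0) 1) = 0 := by
  simp [fockXp, qNum_zero]

theorem fockXm_vacuum (q : ℂ) : fockXm q (Finsupp.single (0, 0) 1) = 0 := by
  simp [fockXm, qNum_zero]

theorem fockXp_creation_zero (q : ℂ) (hq : q ≠ 0) :
    fockXp q * (eps2Low q 1 0 • creation q 0) =
      (eps2Low q 0 1 • creation q 1) * fockQH q 1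
        + csqrt q • ((eps2Low q 1 0 • creation q 0) * fockXp q) := by
  have hs : csqrt q ≠ 0 := csqrt_ne_zero hq
  have hss : csqrt q * csqrt q = q := csqrt_mul_self q
  obtain ⟨e1, e2, e3, e4⟩ := eps2Low_apply q
  refine Finsupp.lhom_ext' fun ⟨m, n⟩ => LinearMap.ext_ring ?_
  obtain ⟨hm, hu⟩ := qNum_rel q hq (m - 1)
  obtain ⟨hn, hv⟩ := qNum_rel q hq (n - 1)
  rcases m with _ | m <;> rcases n with _ | n <;>
    simp [e2, e3, creation_zero_single, creation_one_single, fockXp_single, fockXm_single,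
      fockQH_single, qNum_zero, qNum_succ q hq, -Finsupp.single_mul, -Finsupp.single_add,
      -Finsupp.single_neg, zpow_add₀ hs, zpow_sub₀ hs, zpow_add₀ hq]
  all_goals
    try simp only [Nat.add_sub_cancel] at hm hu hn hv
    try simp only [← Finsupp.single_neg, ← Finsupp.single_add]
    try congr 1
    try simp only [pow_succ]
    generalize csqrt q = s at *
    subst hss
    try simp only [mul_pow] at *
    have hu' := left_ne_zero_of_mul hu
    have hv' := left_ne_zero_of_mul hv
    try generalize s ^ m = u at *
    try generalize s ^ n = v at *
    try generalize qNum _ m = a at *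
    try generalize qNum _ n = b at *
    field_simp
    try grind

theorem fockXp_creation_one (q : ℂ) (hq : q ≠ 0) :
    fockXp q * (eps2Low q 0 1 • creation q 1) =
      (csqrt q)⁻¹ • ((eps2Low q 0 1 • creation q 1) * fockXp q) := by
  have hs : csqrt q ≠ 0 := csqrt_ne_zero hq
  have hss : csqrt q * csqrt q = q := csqrt_mul_self q
  obtain ⟨e1, e2, e3, e4⟩ := eps2Low_apply q
  refine Finsupp.lhom_ext' fun ⟨m, n⟩ => LinearMap.ext_ring ?_
  obtain ⟨hm, hu⟩ := qNum_rel q hq (m - 1)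
  obtain ⟨hn, hv⟩ := qNum_rel q hq (n - 1)
  rcases m with _ | m <;> rcases n with _ | n <;>
    simp [e2, e3, creation_zero_single, creation_one_single, fockXp_single, fockXm_single,
      fockQH_single, qNum_zero, qNum_succ q hq, -Finsupp.single_mul, -Finsupp.single_add,
      -Finsupp.single_neg, zpow_add₀ hs, zpow_sub₀ hs, zpow_add₀ hq]
  all_goals
    try simp only [Nat.add_sub_cancel] at hm hu hn hv
    try simp only [← Finsupp.single_neg, ← Finsupp.single_add]
    try congr 1
    try simp only [pow_succ]
    generalize csqrt q = s at *
    subst hss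
    try simp only [mul_pow] at *
    have hu' := left_ne_zero_of_mul hu
    have hv' := left_ne_zero_of_mul hv
    try generalize s ^ m = u at *
    try generalize s ^ n = v at *
    try generalize qNum _ m = a at *
    try generalize qNum _ n = b at *
    field_simp
    try grind

theorem fockXm_creation_zero (q : ℂ) (hq : q ≠ 0) :
    fockXm q * (eps2Low q 1 0 • creation q 0) =
      csqrt q • ((eps2Low q 1 0 • creation q 0) * fockXm q) := by
  have hs : csqrt q ≠ 0 := csqrt_ne_zero hq
  have hss : csqrt q * csqrt q = q := csqrt_mul_self q
  obtain ⟨e1, e2, e3, e4⟩ := eps2Low_apply q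
  refine Finsupp.lhom_ext' fun ⟨m, n⟩ => LinearMap.ext_ring ?_
  obtain ⟨hm, hu⟩ := qNum_rel q hq (m - 1)
  obtain ⟨hn, hv⟩ := qNum_rel q hq (n - 1)
  rcases m with _ | m <;> rcases n with _ | n <;>
    simp [e2, e3, creation_zero_single, creation_one_single, fockXp_single, fockXm_single,
      fockQH_single, qNum_zero, qNum_succ q hq, -Finsupp.single_mul, -Finsupp.single_add,
      -Finsupp.single_neg, zpow_add₀ hs, zpow_sub₀ hs, zpow_add₀ hq]
  all_goals
    try simp only [Nat.add_sub_cancel] at hm hu hn hv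
    try simp only [← Finsupp.single_neg, ← Finsupp.single_add]
    try congr 1
    try simp only [pow_succ]
    generalize csqrt q = s at *
    subst hss
    try simp only [mul_pow] at *
    have hu' := left_ne_zero_of_mul hu
    have hv' := left_ne_zero_of_mul hv
    try generalize s ^ m = u at *
    try generalize s ^ n = v at *
    try generalize qNum _ m = a at *
    try generalize qNum _ n = b at *
    field_simp
    try grind

theorem fockXm_creation_one (q : ℂ) (hq : q ≠ 0) :
    fockXm q * (eps2Low q 0 1 • creation q 1) =
      (eps2Low q 1 0 • creation q 0) * fockQH q 1
        + (csqrt q)⁻¹ • ((eps2Low q 0 1 • creation q 1) * fockXm q) := by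
  have hs : csqrt q ≠ 0 := csqrt_ne_zero hq
  have hss : csqrt q * csqrt q = q := csqrt_mul_self q
  obtain ⟨e1, e2, e3, e4⟩ := eps2Low_apply q
  refine Finsupp.lhom_ext' fun ⟨m, n⟩ => LinearMap.ext_ring ?_
  obtain ⟨hm, hu⟩ := qNum_rel q hq (m - 1)
  obtain ⟨hn, hv⟩ := qNum_rel q hq (n - 1)
  rcases m with _ | m <;> rcases n with _ | n <;>
    simp [e2, e3, creation_zero_single, creation_one_single, fockXp_single, fockXm_single,
      fockQH_single, qNum_zero, qNum_succ q hq, -Finsupp.single_mul, -Finsupp.single_add,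
      -Finsupp.single_neg, zpow_add₀ hs, zpow_sub₀ hs, zpow_add₀ hq]
  all_goals
    try simp only [Nat.add_sub_cancel] at hm hu hn hv
    try simp only [← Finsupp.single_neg, ← Finsupp.single_add]
    try congr 1
    try simp only [pow_succ]
    generalize csqrt q = s at *
    subst hss
    try simp only [mul_pow] at *
    have hu' := left_ne_zero_of_mul hu
    have hv' := left_ne_zero_of_mul hv
    try generalize s ^ m = u at *
    try generalize s ^ n = v at *
    try generalize qNum _ m = a at *
    try generalize qNum _ n = b at *
    field_simp
    try grind

theorem fockQH_sector (q : ℂ) (a : ℤ) (N : ℕ) : ∀ v ∈ sector N, fockQH q a v ∈ sector N :=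
  sector_invariant _ fun p hp => by
    rw [show p = (p.1, p.2) from rfl, fockQH_single]
    exact single_mem_sector _ _ fun _ => hp

theorem fockH_sector (N : ℕ) : ∀ v ∈ sector N, fockH v ∈ sector N :=
  sector_invariant _ fun p hp => by
    simp only [fockH, Finsupp.linearCombination_single, one_smul]
    exact single_mem_sector _ _ fun _ => hp

theorem fockXp_sector (q : ℂ) (N : ℕ) : ∀ v ∈ sector N, fockXp q v ∈ sector N :=
  sector_invariant _ fun p hp => by
    rw [show p = (p.1, p.2) from rfl, fockXp_single]
    refine single_mem_sector _ _ fun h => ?_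
    have := pos_of_qNum_ne (mul_ne_zero_iff.1 (mul_ne_zero_iff.1 h).2).2
    simp only; omega

theorem fockXm_sector (q : ℂ) (N : ℕ) : ∀ v ∈ sector N, fockXm q v ∈ sector N :=
  sector_invariant _ fun p hp => by
    rw [show p = (p.1, p.2) from rfl, fockXm_single]
    refine single_mem_sector _ _ fun h => ?_
    have := pos_of_qNum_ne (mul_ne_zero_iff.1 (mul_ne_zero_iff.1 h).2).2
    simp only; omega

/-- `q^(aH/2)` on `F_N`. -/
def repQH (q : ℂ) (N : ℕ) (a : ℤ) : SectorMat N :=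
  sectorMatrix N (fockQH q a)

/-- `H` on `F_N`. -/
def repH (N : ℕ) : SectorMat N := sectorMatrix N fockH

/-- `X⁺` on `F_N`. -/
def repXp (q : ℂ) (N : ℕ) : SectorMat N := sectorMatrix N (fockXp q)

/-- `X⁻` on `F_N`. -/
def repXm (q : ℂ) (N : ℕ) : SectorMat N := sectorMatrix N (fockXm q)

/-- The quantum adjoint action `H ▷ f = u₍₁₎ f S(u₍₂₎)` of `u = H`, with `S(H) = -H`. -/
def adH (N : ℕ) (f : SectorMat N) : SectorMat N :=
  repH N * f - f * repH N

/-- The quantum adjoint action of `X⁺`, with `Δ X⁺ = X⁺ ⊗ q^(H/2) + q^(-H/2) ⊗ X⁺`,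
`S(q^(H/2)) = q^(-H/2)` and `S(X⁺) = -q X⁺`. -/
def adXp (q : ℂ) (N : ℕ) (f : SectorMat N) : SectorMat N :=
  repXp q N * f * repQH q N (-1) + repQH q N (-1) * f * (-q • repXp q N)

/-- The quantum adjoint action of `X⁻`, with `Δ X⁻ = X⁻ ⊗ q^(H/2) + q^(-H/2) ⊗ X⁻`,
`S(q^(H/2)) = q^(-H/2)` and `S(X⁻) = -q⁻¹ X⁻`. -/
def adXm (q : ℂ) (N : ℕ) (f : SectorMat N) : SectorMat N :=
  repXm q N * f * repQH q N (-1) + repQH q N (-1) * f * (-q⁻¹ • repXm q N)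

/-- `W` is stable under the quantum adjoint action. -/
def IsInvariant (q : ℂ) (N : ℕ) (W : Submodule ℂ (SectorMat N)) : Prop :=
  ∀ f ∈ W, adH N f ∈ W ∧ adXp q N f ∈ W ∧ adXm q N f ∈ W

/-- `W ⊆ S²_{q,N}` is a spin `K` representation, that is, an irreducible `U_q(su(2))`-submodule
of dimension `2K + 1`. -/
structure IsSpinRep (q : ℂ) (r : ℝ) (N K : ℕ)
    (W : Submodule ℂ (SectorMat N)) : Prop where
  le_sphere : W ≤ Subalgebra.toSubmodule (Sphere q r N)
  invariant : IsInvariant q N W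
  irreducible : ∀ W' ≤ W, IsInvariant q N W' → W' = ⊥ ∨ W' = W
  finrank_eq : Module.finrank ℂ W = 2 * K + 1

/-! ### The differential calculus -/

/-- The defining relations of the algebra of forms, on the free algebra generated by the elements
of `S²_{q,N}` and the one-forms `ξ_i`. -/
inductive FormRel (q : ℂ) (r : ℝ) (N : ℕ) :
    FreeAlgebra ℂ (Sphere q r N ⊕ Fin 3) → FreeAlgebra ℂ (Sphere q r N ⊕ Fin 3) → Prop
  | add (f h : Sphere q r N) :
      FormRel q r N (FreeAlgebra.ι ℂ (Sum.inl (f + h)))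
        (FreeAlgebra.ι ℂ (Sum.inl f) + FreeAlgebra.ι ℂ (Sum.inl h))
  | mul (f h : Sphere q r N) :
      FormRel q r N (FreeAlgebra.ι ℂ (Sum.inl (f * h)))
        (FreeAlgebra.ι ℂ (Sum.inl f) * FreeAlgebra.ι ℂ (Sum.inl h))
  | scalar (c : ℂ) :
      FormRel q r N (FreeAlgebra.ι ℂ (Sum.inl (algebraMap ℂ (Sphere q r N) c)))
        (algebraMap ℂ _ c)
  /-- `x_i ξ_j = R̂^{kl}_{ij} ξ_k x_l` -/
  | braid (i j : Fin 3) :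
      FormRel q r N
        (FreeAlgebra.ι ℂ (Sum.inl (sphereCoord q r N i)) * FreeAlgebra.ι ℂ (Sum.inr j))
        (∑ k, ∑ l, Rhat q k l i j •
          (FreeAlgebra.ι ℂ (Sum.inr k) * FreeAlgebra.ι ℂ (Sum.inl (sphereCoord q r N l))))
  /-- `ξ_i ξ_j = -q² R̂^{kl}_{ij} ξ_k ξ_l` -/
  | wedge (i j : Fin 3) :
      FormRel q r N
        (FreeAlgebra.ι ℂ (Sum.inr i) * FreeAlgebra.ι ℂ (Sum.inr j))
        (-q ^ 2 • ∑ k, ∑ l, Rhat q k l i j •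
          (FreeAlgebra.ι ℂ (Sum.inr k) * FreeAlgebra.ι ℂ (Sum.inr l)))

/-- The algebra of forms `Ω*_{q,N}`. -/
abbrev Forms (q : ℂ) (r : ℝ) (N : ℕ) : Type := RingQuot (FormRel q r N)

variable (q : ℂ) (r : ℝ) (N : ℕ)

/-- Functions as forms of degree `0`. -/
def fn : Sphere q r N →ₐ[ℂ] Forms q r N :=
  AlgHom.ofLinearMap
    { toFun := fun f => RingQuot.mkAlgHom ℂ (FormRel q r N) (FreeAlgebra.ι ℂ (Sum.inl f))
      map_add' := fun f h => by
        rw [RingQuot.mkAlgHom_rel ℂ (FormRel.add f h), map_add]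
      map_smul' := fun c f => by
        rw [Algebra.smul_def, RingQuot.mkAlgHom_rel ℂ (FormRel.mul _ f), map_mul,
          RingQuot.mkAlgHom_rel ℂ (FormRel.scalar c), AlgHom.commutes, RingHom.id_apply,
          Algebra.smul_def] }
    (by
      have := RingQuot.mkAlgHom_rel ℂ (FormRel.scalar (q := q) (r := r) (N := N) 1)
      simpa using this)
    (fun f h => by
      have := RingQuot.mkAlgHom_rel ℂ (FormRel.mul f h)
      simpa using this)

/-- The one-forms `ξ_i`. -/
def xi (i : Fin 3) : Forms q r N :=
  RingQuot.mkAlgHom ℂ (FormRel q r N) (FreeAlgebra.ι ℂ (Sum.inr i))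

/-- `Θ = g^{ij} x_i ξ_j`. -/
def Theta : Forms q r N :=
  ∑ i, ∑ j, g q i j • (fn q r N (sphereCoord q r N i) * xi q r N j)

/-- The ordered monomial in the `ξ_i` with `i ∈ I`. -/
def xiMonomial (I : Finset (Fin 3)) : Forms q r N := (I.sort.map (xi q r N)).prod

/-- The two-form `-(q⁻² Λ_N / [2]_{q²}) ε_i^{jk} ξ_j ξ_k`. -/
def starXi (i : Fin 3) : Forms q r N :=
  -((q ^ 2)⁻¹ * Lam q r N / qNum (q ^ 2) 2) •
    ∑ j, ∑ k, eps q i j k • (xi q r N j * xi q r N k)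

/-- The defining properties of the Hodge star `∗_H`: a left and right `S²_{q,N}`-module map with
`∗_H ξ_i = -(q⁻² Λ_N / [2]_{q²}) ε_i^{jk} ξ_j ξ_k`, `∗_H 1 = Θ³` and `∗_H² = id`. -/
structure IsHodgeStar (star : Forms q r N →ₗ[ℂ] Forms q r N) : Prop where
  left_linear : ∀ f α, star (fn q r N f * α) = fn q r N f * star α
  right_linear : ∀ f α, star (α * fn q r N f) = star α * fn q r N f
  star_xi : ∀ i, star (xi q r N i) = starXi q r N i
  star_one : star 1 = Theta q r N ^ 3
  star_star : ∀ α, star (star α) = α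

/-- The exterior derivative on forms of degree `n`: `[Θ, α]` for `n = 0, 2`,
`[Θ, α]₊ - ∗_H α` for `n = 1`, and zero in top degree. -/
def extD (star : Forms q r N →ₗ[ℂ] Forms q r N) : ℕ → Forms q r N → Forms q r N
  | 0, α => Theta q r N * α - α * Theta q r N
  | 1, α => Theta q r N * α + α * Theta q r N - star α
  | 2, α => Theta q r N * α - α * Theta q r N
  | _, _ => 0

/-- The Laplacian `∗_H d ∗_H d` on functions. -/
def laplacian (star : Forms q r N →ₗ[ℂ] Forms q r N) (ψ : Sphere q r N) : Forms q r N :=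
  star (extD q r N star 2 (star (extD q r N star 0 (fn q r N ψ))))

end QSphere

end

/-!
The proof rests on the element `d = Λ - (q - q⁻¹) x_0`, a multiple of `q^H` on `F_N` and hence
invertible in the algebra `S²_{q,N}` (`exists_isSphere`). Everything that concerns the calculus only
uses the relations of the `x_i` and the invertibility of `d`, collected in `IsSphere`.

**The forms are free.** The generators and `d⁻¹` form a lower triangular matrix `L` over `S²_{q,N}`
with `L x_i L⁻¹ = R̂^{kl}_{ij} x_l` (`braidHom_x`). The commutation relation of `x_i` and `ξ_j` thus
extends to `f ξ_j = ∑ k, ξ_k (L f L⁻¹)_{kj}` for all functions `f`. Since `R̂` is compatible with `ε`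
and `g`, this makes `S ⊕ S³ ⊕ S³ ⊕ S` with `S = S²_{q,N}` a module over the algebra of forms, on
which `ξ_i` acts through `ε` and `g` (`leftFn_leftXi`, `leftXi_wedge`). Acting on `1` recovers the
coordinates of a form with respect to `1`, `ξ_i`, `ω_i`, `vol`, where `ξ_i ξ_j = ∑ n, ε_n^{ij} ω_n`
and `ξ_i ω_n = g_{in} vol`; that these elements generate follows by moving functions to the right.

**The Hodge star.** Each `∗ξ_i` is the same nonzero multiple of `ω_i`, and `Θ³` is a nonzero multiple
of `vol`. So a Hodge star is determined on a basis, and exchanging `1` with `Θ³` and `ξ_i` with `∗ξ_i`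
in coordinates defines one.

**The Laplacian.** Since `Θ² = ∗Θ` (`Theta_mul_Theta`), one finds `∗d∗d ψ = 2 (ψ - r⁻² T ψ)` with
`T ψ = x_m (L ψ L⁻¹)_{mk} g^{kl} x_l` (`laplacian_eq`). Multiplying out, `T` is a sum of three terms
`a d⁻¹ ψ d⁻¹ b` (`sandwich_eq`). On the other hand `X^±` act on `End(F_N)` by commutators with `x_1`
and `x_{-1}`, up to powers of `q^H` (`adXp_eq`, `adXm_eq`). On elements of weight `w` a comparison
gives `r² - T = r² / ([2] C_N) (X⁻ X⁺ + [w] [w + 1])`, a multiple of the Casimir operator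
(`sub_sandwich_of_weight`). Finally, a spin `K` representation is spanned by the vectors
`(X⁻)^i ▷ f` for a highest weight vector `f`; as `[n] ≠ 0` for `1 ≤ n ≤ 2 N`, its dimension forces
`f` to have weight `K` (`exists_ladder`), and the Casimir operator is `[K] [K + 1]`.
-/

noncomputable section

namespace QSphere

/-! ### Identities of the invariant tensors -/

theorem qNum_three (q : ℂ) (hq : q ≠ 0) : qNum q 3 = q ^ 2 + 1 + (q ^ 2)⁻¹ := by
  rw [qNum_succ q hq, qNum_two q hq]
  field_simp

/-- `R̂` without the denominators `[2]_{q²}` and `[3]_q` of the projectors. -/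
theorem Rhat_eq {q : ℂ} (hq : q ≠ 0) (h3 : qNum q 3 ≠ 0) (h4 : qNum (q ^ 2) 2 ≠ 0)
    (k l i j : Fin 3) :
    Rhat q k l i j = q ^ 2 * (if k = i ∧ l = j then 1 else 0) - ∑ n, eps q n k l * eps q n i j
      - (1 - (q ^ 2)⁻¹) * (g q k l * g q i j) := by
  have e4 : qNum (q ^ 2) 2 = q ^ 2 + (q ^ 2)⁻¹ := qNum_two _ (pow_ne_zero 2 hq)
  have e3 : q ^ 2 - (q ^ 4)⁻¹ = (1 - (q ^ 2)⁻¹) * qNum q 3 := by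
    rw [qNum_three q hq]; field_simp; ring
  rw [Rhat, Pplus, Pminus, Pzero]
  generalize ∑ n, eps q n k l * eps q n i j = E
  have h1 : (1 - (q ^ 2)⁻¹) = (q ^ 2 - (q ^ 4)⁻¹) * (1 / qNum q 3) := by
    rw [e3]; field_simp
  have h2 : (q ^ 2 + (q ^ 2)⁻¹) * (1 / qNum (q ^ 2) 2) = 1 := by
    rw [← e4]; field_simp
  rw [h1]
  linear_combination -E * h2

/-- The matrices of left multiplication by `x_i` on the `ξ_j`: the relation
`x_i ξ_j = R̂^{kl}_{ij} ξ_k x_l` reads `x_i ξ_j = ∑ l, ∑ k, (braid i l)_{kj} ξ_k x_l`. -/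
def braid (q : ℂ) (i l : Fin 3) : Matrix (Fin 3) (Fin 3) ℂ :=
  Matrix.of fun k j => Rhat q k l i j

theorem braid_eq {q : ℂ} (hq : q ≠ 0) (h3 : qNum q 3 ≠ 0) (h4 : qNum (q ^ 2) 2 ≠ 0) :
    braid q 0 0 = !![q ^ 2, 0, 0; 0, 1, 0; 0, 0, (q ^ 2)⁻¹] ∧ braid q 0 1 = 0 ∧ braid q 0 2 = 0 ∧
    braid q 1 0 = !![0, 0, 0; q ^ 2 - (q ^ 2)⁻¹, 0, 0; 0, (q - q⁻¹) * (1 + (q ^ 2)⁻¹), 0] ∧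
    braid q 1 1 = 1 ∧ braid q 1 2 = 0 ∧
    braid q 2 0 = !![0, 0, 0; 0, 0, 0; q ^ 2 - 1 - (q ^ 2)⁻¹ + (q ^ 4)⁻¹, 0, 0] ∧
    braid q 2 1 = !![0, 0, 0; (q - q⁻¹) * (1 + (q ^ 2)⁻¹), 0, 0; 0, q ^ 2 - (q ^ 2)⁻¹, 0] ∧
    braid q 2 2 = !![(q ^ 2)⁻¹, 0, 0; 0, 1, 0; 0, 0, q ^ 2] := by
  refine ⟨?_, ?_, ?_, ?_, ?_, ?_, ?_, ?_, ?_⟩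
  all_goals
    refine Matrix.ext fun k j => ?_
    rw [braid, Matrix.of_apply, Rhat_eq hq h3 h4]
    fin_cases k <;> fin_cases j <;> simp [eps, g, Fin.sum_univ_three]
  all_goals
    field_simp
    try ring

/-- The `R`-matrix is compatible with the invariant tensor `ε`. -/
theorem braid_eps {q : ℂ} (hq : q ≠ 0) (h3 : qNum q 3 ≠ 0) (h4 : qNum (q ^ 2) 2 ≠ 0)
    (i s p : Fin 3) :
    ∑ n, braid q i s p n • eps q n =
      ∑ l, (braid q i l).transpose * eps q p * braid q l s := by
  obtain ⟨b1, b2, b3, b4, b5, b6, b7, b8, b9⟩ := braid_eq hq h3 h4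
  clear h3 h4
  fin_cases i <;> fin_cases s <;> fin_cases p <;>
    simp [eps, Fin.sum_univ_three, b1, b2, b3, b4, b5, b6, b7, b8, b9]
  all_goals
    refine Matrix.ext fun k j => ?_
    fin_cases k <;> fin_cases j <;> simp [Matrix.mul_apply, Fin.sum_univ_three]
  all_goals
    field_simp
    try ring

/-- The `R`-matrix is compatible with the invariant tensor `g`. -/
theorem braid_g {q : ℂ} (hq : q ≠ 0) (h3 : qNum q 3 ≠ 0) (h4 : qNum (q ^ 2) 2 ≠ 0)
    (i s : Fin 3) :
    ∑ l, (braid q i l).transpose * g q * braid q l s = if s = i then g q else 0 := by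
  obtain ⟨b1, b2, b3, b4, b5, b6, b7, b8, b9⟩ := braid_eq hq h3 h4
  clear h3 h4
  fin_cases i <;> fin_cases s <;>
    simp [g, Fin.sum_univ_three, b1, b2, b3, b4, b5, b6, b7, b8, b9]
  all_goals
    refine Matrix.ext fun k j => ?_
    fin_cases k <;> fin_cases j <;> simp [Matrix.mul_apply, Fin.sum_univ_three]
  all_goals
    field_simp
    try ring

/-- The quadratic relation of the `ξ_i` holds for `ξ_i ξ_j = ∑ n, ε_n^{ij} ω_n`. -/
theorem eps_wedge {q : ℂ} (hq : q ≠ 0) (h3 : qNum q 3 ≠ 0) (h4 : qNum (q ^ 2) 2 ≠ 0)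
    (i j n : Fin 3) :
    eps q n i j = -q ^ 2 * ∑ k, ∑ l, Rhat q k l i j * eps q n k l := by
  have hR : ∀ k l i j, Rhat q k l i j = braid q i l k j := fun _ _ _ _ => rfl
  obtain ⟨b1, b2, b3, b4, b5, b6, b7, b8, b9⟩ := braid_eq hq h3 h4
  clear h3 h4
  simp only [hR]
  fin_cases i <;> fin_cases j <;> fin_cases n <;>
    simp [eps, Fin.sum_univ_three, b1, b2, b3, b4, b5, b6, b7, b8, b9]
  all_goals
    field_simp
    try ring

/-- The quadratic relation of the `ξ_i` holds for their action on the spin 1 part of the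
two-forms. -/
theorem g_eps_wedge {q : ℂ} (hq : q ≠ 0) (h3 : qNum q 3 ≠ 0) (h4 : qNum (q ^ 2) 2 ≠ 0)
    (i j m : Fin 3) :
    ∑ n, g q i n * eps q n j m =
      -q ^ 2 * ∑ k, ∑ l, Rhat q k l i j * ∑ n, g q k n * eps q n l m := by
  have hR : ∀ k l i j, Rhat q k l i j = braid q i l k j := fun _ _ _ _ => rfl
  obtain ⟨b1, b2, b3, b4, b5, b6, b7, b8, b9⟩ := braid_eq hq h3 h4
  clear h3 h4
  simp only [hR]
  fin_cases i <;> fin_cases j <;> fin_cases m <;>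
    simp [eps, g, Fin.sum_univ_three, b1, b2, b3, b4, b5, b6, b7, b8, b9]
  all_goals
    field_simp
    try ring

/-- `g` spans the eigenspace of `R̂` with eigenvalue `q⁻⁴`. -/
theorem g_Rhat {q : ℂ} (hq : q ≠ 0) (h3 : qNum q 3 ≠ 0) (h4 : qNum (q ^ 2) 2 ≠ 0)
    (k l : Fin 3) :
    ∑ i, ∑ j, g q i j * Rhat q k l i j = (q ^ 4)⁻¹ * g q k l := by
  have hR : ∀ k l i j, Rhat q k l i j = braid q i l k j := fun _ _ _ _ => rfl
  obtain ⟨b1, b2, b3, b4, b5, b6, b7, b8, b9⟩ := braid_eq hq h3 h4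
  clear h3 h4
  simp only [hR]
  fin_cases k <;> fin_cases l <;>
    simp [g, Fin.sum_univ_three, b1, b2, b3, b4, b5, b6, b7, b8, b9]
  all_goals
    field_simp
    try ring

theorem g_mul_g {q : ℂ} (hq : q ≠ 0) (i m : Fin 3) :
    ∑ j, g q i j * g q j m = if m = i then 1 else 0 := by
  fin_cases i <;> fin_cases m <;> simp [g, Fin.sum_univ_three, hq]

/-- The invariant tensors with three spin 1 indices obtained by raising the index of `ε` on the
left and on the right agree. -/
theorem g_eps_cyclic {q : ℂ} (hq : q ≠ 0) (i j m : Fin 3) :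
    ∑ n, g q i n * eps q n j m = ∑ n, eps q n i j * g q n m := by
  fin_cases i <;> fin_cases j <;> fin_cases m <;> simp [g, eps, Fin.sum_univ_three, hq]

/-- The tensor identity behind `Θ² = ∗_H Θ`. -/
theorem g_eps_g_Rhat {q : ℂ} (hq : q ≠ 0) (h3 : qNum q 3 ≠ 0) (h4 : qNum (q ^ 2) 2 ≠ 0)
    (p s l : Fin 3) :
    ∑ i, ∑ j, ∑ k, ∑ n, g q i j * eps q n j k * g q k l * Rhat q p s i n =
      -(q ^ 2)⁻¹ * ∑ c, g q p c * eps q c s l := by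
  have hR : ∀ k l i j, Rhat q k l i j = braid q i l k j := fun _ _ _ _ => rfl
  obtain ⟨b1, b2, b3, b4, b5, b6, b7, b8, b9⟩ := braid_eq hq h3 h4
  clear h3 h4
  simp only [hR]
  fin_cases p <;> fin_cases s <;> fin_cases l <;>
    simp [g, eps, Fin.sum_univ_three, b1, b2, b3, b4, b5, b6, b7, b8, b9]
  all_goals
    field_simp
    try ring

section

/-! ### The commutation matrix of functions and one-forms -/

/-- Elements `x_i` of an algebra with `ε_k^{ij} x_i x_j = Λ x_k` and `g^{ij} x_i x_j = ρ`, for which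
`d = Λ - (q - q⁻¹) x_0` is invertible with inverse `d'`. (The index `1 : Fin 3` has weight `0`.)
On `F_N` the element `d` is a multiple of `q^H`. -/
structure IsSphere {A : Type*} [Ring A] [Algebra ℂ A] (q Λ ρ : ℂ) (x : Fin 3 → A) (d d' : A) :
    Prop where
  q_ne_zero : q ≠ 0
  eps_mul : ∀ k, ∑ i, ∑ j, eps q k i j • (x i * x j) = Λ • x k
  g_mul : ∑ i, ∑ j, g q i j • (x i * x j) = ρ • (1 : A)
  d_eq : d = Λ • (1 : A) - (q - q⁻¹) • x 1
  mul_inv : d * d' = 1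
  inv_mul : d' * d = 1

namespace IsSphere

variable {A : Type*} [Ring A] [Algebra ℂ A] {q Λ ρ : ℂ} {x : Fin 3 → A} {d d' : A}

theorem eps_zero (h : IsSphere q Λ ρ x d d') :
    q • (x 0 * x 1) - q⁻¹ • (x 1 * x 0) = Λ • x 0 := by
  have := h.eps_mul 0
  simp [eps, Fin.sum_univ_three] at this
  rw [← this]; abel

theorem eps_one (h : IsSphere q Λ ρ x d d') :
    x 0 * x 2 - x 2 * x 0 + (q - q⁻¹) • (x 1 * x 1) = Λ • x 1 := by
  have := h.eps_mul 1
  simp [eps, Fin.sum_univ_three] at this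
  rw [← this]; abel

theorem eps_two (h : IsSphere q Λ ρ x d d') :
    q • (x 1 * x 2) - q⁻¹ • (x 2 * x 1) = Λ • x 2 := by
  have := h.eps_mul 2
  simp [eps, Fin.sum_univ_three] at this
  rw [← this]; abel

theorem g_eq (h : IsSphere q Λ ρ x d d') :
    -(q • (x 0 * x 2)) + x 1 * x 1 - q⁻¹ • (x 2 * x 0) = ρ • (1 : A) := by
  have := h.g_mul
  simp [g, Fin.sum_univ_three] at this
  rw [← this]; abel

/-! The relations below rewrite products of the generators in the order `x 0`, `x 1`, `d`, `x 2`. -/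

theorem one_mul_zero (h : IsSphere q Λ ρ x d d') : x 1 * x 0 = x 0 * x 1 - q • (x 0 * d) := by
  have hq := h.q_ne_zero
  have := h.eps_zero
  rw [h.d_eq]
  simp only [mul_sub, mul_smul_comm, mul_one]
  linear_combination (norm := skip) (-q) • this
  match_scalars <;> field_simp <;> ring

theorem d_mul_zero (h : IsSphere q Λ ρ x d d') : d * x 0 = q ^ 2 • (x 0 * d) := by
  have hq := h.q_ne_zero
  have := h.eps_zero
  rw [h.d_eq]
  simp only [mul_sub, sub_mul, mul_smul_comm, smul_mul_assoc, mul_one, one_mul]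
  linear_combination (norm := skip) (q ^ 2 - 1) • this
  match_scalars <;> field_simp <;> ring

theorem two_mul_zero (h : IsSphere q Λ ρ x d d') : x 2 * x 0 = x 0 * x 2 - x 1 * d := by
  have := h.eps_one
  rw [h.d_eq]
  simp only [mul_sub, mul_smul_comm, mul_one]
  linear_combination (norm := module) (-1 : ℂ) • this

theorem d_mul_one (h : IsSphere q Λ ρ x d d') : d * x 1 = x 1 * d := by
  rw [h.d_eq]
  simp only [mul_sub, sub_mul, mul_smul_comm, smul_mul_assoc, mul_one, one_mul]

theorem two_mul_d (h : IsSphere q Λ ρ x d d') : x 2 * d = q ^ 2 • (d * x 2) := by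
  have hq := h.q_ne_zero
  have := h.eps_two
  rw [h.d_eq]
  simp only [mul_sub, sub_mul, mul_smul_comm, smul_mul_assoc, mul_one, one_mul]
  linear_combination (norm := skip) (q ^ 2 - 1) • this
  match_scalars <;> field_simp <;> ring

theorem inv_mul_zero (h : IsSphere q Λ ρ x d d') : d' * x 0 = (q ^ 2)⁻¹ • (x 0 * d') := by
  have hq := h.q_ne_zero
  have h1 : x 0 * d = (q ^ 2)⁻¹ • (d * x 0) := by
    rw [h.d_mul_zero, smul_smul, inv_mul_cancel₀ (pow_ne_zero 2 hq), one_smul]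
  calc d' * x 0 = d' * (x 0 * d) * d' := by rw [mul_assoc, mul_assoc, h.mul_inv, mul_one]
    _ = (q ^ 2)⁻¹ • (x 0 * d') := by
      rw [h1, mul_smul_comm, ← mul_assoc, h.inv_mul, one_mul, smul_mul_assoc]

theorem inv_mul_one (h : IsSphere q Λ ρ x d d') : d' * x 1 = x 1 * d' := by
  calc d' * x 1 = d' * (x 1 * d) * d' := by rw [mul_assoc, mul_assoc, h.mul_inv, mul_one]
    _ = x 1 * d' := by rw [← h.d_mul_one, ← mul_assoc, h.inv_mul, one_mul]

theorem two_mul_inv (h : IsSphere q Λ ρ x d d') : x 2 * d' = (q ^ 2)⁻¹ • (d' * x 2) := by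
  have hq := h.q_ne_zero
  have h1 : d * x 2 = (q ^ 2)⁻¹ • (x 2 * d) := by
    rw [h.two_mul_d, smul_smul, inv_mul_cancel₀ (pow_ne_zero 2 hq), one_smul]
  calc x 2 * d' = d' * (d * x 2) * d' := by rw [← mul_assoc, h.inv_mul, one_mul]
    _ = (q ^ 2)⁻¹ • (d' * x 2) := by
      rw [h1, mul_smul_comm, smul_mul_assoc, mul_assoc, mul_assoc, h.mul_inv, mul_one]

theorem inv_mul_mul (h : IsSphere q Λ ρ x d d') (z : A) : d' * (d * z) = z := by
  rw [← mul_assoc, h.inv_mul, one_mul]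

theorem inv_mul_zero_mul (h : IsSphere q Λ ρ x d d') (z : A) :
    d' * (x 0 * z) = (q ^ 2)⁻¹ • (x 0 * (d' * z)) := by
  rw [← mul_assoc, h.inv_mul_zero, smul_mul_assoc, mul_assoc]

theorem d_mul_zero_mul (h : IsSphere q Λ ρ x d d') (z : A) :
    d * (x 0 * z) = q ^ 2 • (x 0 * (d * z)) := by
  rw [← mul_assoc, h.d_mul_zero, smul_mul_assoc, mul_assoc]

theorem one_mul_zero_mul (h : IsSphere q Λ ρ x d d') (z : A) :
    x 1 * (x 0 * z) = x 0 * (x 1 * z) - q • (x 0 * (d * z)) := by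
  rw [← mul_assoc, h.one_mul_zero, sub_mul, smul_mul_assoc, mul_assoc, mul_assoc]

theorem two_mul_zero_mul (h : IsSphere q Λ ρ x d d') (z : A) :
    x 2 * (x 0 * z) = x 0 * (x 2 * z) - x 1 * (d * z) := by
  rw [← mul_assoc, h.two_mul_zero, sub_mul, mul_assoc, mul_assoc]

variable (q x d d') in
/-- The commutation matrix `L`, the image of the `L`-operator of `U_q(su(2))` in the spin 1
representation on the first factor, with `f ξ_j = ∑ k, ξ_k (L f L⁻¹)_{kj}`. -/
def lMat : Matrix (Fin 3) (Fin 3) A :=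
  !![d, 0, 0;
    (q - (q ^ 3)⁻¹) • x 0, 1, 0;
    ((q - q⁻¹) * ((q ^ 2)⁻¹ - (q ^ 6)⁻¹)) • (x 0 * (x 0 * d')),
      ((q - q⁻¹) * (q⁻¹ + (q ^ 3)⁻¹)) • (x 0 * d'), d']

variable (q x d d') in
/-- The inverse of `lMat`. -/
def lInv : Matrix (Fin 3) (Fin 3) A :=
  !![d', 0, 0;
    -(q - (q ^ 3)⁻¹) • (x 0 * d'), 1, 0;
    ((q - q⁻¹) * (1 - (q ^ 4)⁻¹)) • (x 0 * (x 0 * d')),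
      -((q - q⁻¹) * (q + q⁻¹)) • x 0, d]

theorem lMat_mul_lInv (h : IsSphere q Λ ρ x d d') : lMat q x d d' * lInv q x d d' = 1 := by
  have hq := h.q_ne_zero
  refine Matrix.ext fun k j => ?_
  fin_cases k <;> fin_cases j <;>
    simp [lMat, lInv, Matrix.mul_apply, Fin.sum_univ_three, h.mul_inv, h.inv_mul, mul_assoc,
      h.inv_mul_zero, h.inv_mul_zero_mul]
  all_goals
    match_scalars
    field_simp
    try ring

theorem lInv_mul_lMat (h : IsSphere q Λ ρ x d d') : lInv q x d d' * lMat q x d d' = 1 := by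
  have hq := h.q_ne_zero
  refine Matrix.ext fun k j => ?_
  fin_cases k <;> fin_cases j <;>
    simp [lMat, lInv, Matrix.mul_apply, Fin.sum_univ_three, h.mul_inv, h.inv_mul, mul_assoc,
      h.inv_mul_zero, h.inv_mul_zero_mul, h.d_mul_zero, h.d_mul_zero_mul]
  all_goals
    match_scalars
    field_simp
    try ring

/-- Conjugation `f ↦ L f L⁻¹` by the commutation matrix, where `f` is the diagonal matrix with
entries `f`. -/
def braidHom (h : IsSphere q Λ ρ x d d') : A →ₐ[ℂ] Matrix (Fin 3) (Fin 3) A :=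
  AlgHom.ofLinearMap
    { toFun := fun f => lMat q x d d' * Matrix.diagonal (fun _ => f) * lInv q x d d'
      map_add' := fun f f' => by
        rw [← add_mul, ← mul_add, Matrix.diagonal_add]
      map_smul' := fun c f => by
        rw [RingHom.id_apply, ← smul_mul_assoc, ← mul_smul_comm, ← Matrix.diagonal_smul]
        rfl }
    (by
      have := h.lMat_mul_lInv
      simpa using this)
    (fun f f' => by
      have := h.lInv_mul_lMat
      simp only [LinearMap.coe_mk, AddHom.coe_mk]
      rw [← Matrix.diagonal_mul_diagonal]
      simp only [mul_assoc]
      rw [← mul_assoc (lInv q x d d'), this, one_mul])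

theorem braidHom_apply (h : IsSphere q Λ ρ x d d') (f : A) :
    h.braidHom f = lMat q x d d' * Matrix.diagonal (fun _ => f) * lInv q x d d' := rfl

/-- The conjugate of `x_i` by `L` is given by the `R`-matrix. -/
theorem braidHom_x (h : IsSphere q Λ ρ x d d') (h3 : qNum q 3 ≠ 0) (h4 : qNum (q ^ 2) 2 ≠ 0)
    (i : Fin 3) :
    h.braidHom (x i) = Matrix.of fun k j => ∑ l, Rhat q k l i j • x l := by
  have hq := h.q_ne_zero
  suffices key : lMat q x d d' * Matrix.diagonal (fun _ => x i) =
      (Matrix.of fun k j => ∑ l, Rhat q k l i j • x l) * lMat q x d d' by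
    rw [braidHom_apply, key, mul_assoc, h.lMat_mul_lInv, mul_one]
  have hR : ∀ k l i j, Rhat q k l i j = braid q i l k j := fun _ _ _ _ => rfl
  obtain ⟨b1, b2, b3, b4, b5, b6, b7, b8, b9⟩ := braid_eq hq h3 h4
  clear h3 h4
  simp only [hR]
  refine Matrix.ext fun k j => ?_
  fin_cases i <;> fin_cases k <;> fin_cases j <;>
    simp [lMat, Matrix.mul_apply, Fin.sum_univ_three, b1, b2, b3, b4, b5, b6, b7, b8, b9,
      Matrix.diagonal_apply, h.mul_inv, h.inv_mul, mul_assoc, mul_sub, h.d_mul_one, h.inv_mul_one,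
      h.inv_mul_zero, h.d_mul_zero, h.two_mul_d, h.two_mul_inv, h.one_mul_zero,
      h.one_mul_zero_mul, h.two_mul_zero, h.two_mul_zero_mul, h.d_mul_zero_mul]
  all_goals
    match_scalars <;> field_simp <;> try ring

end IsSphere

end

section

namespace IsSphere

variable {A : Type*} [Ring A] [Algebra ℂ A] {q Λ ρ : ℂ} {x : Fin 3 → A} {d d' : A}

/-! ### The invariant operator `f ↦ x_m (L f L⁻¹)_{mk} g^{kl} x_l` -/

theorem zero_mul_two (h : IsSphere q Λ ρ x d d') :
    (q + q⁻¹) • (x 0 * x 2) = x 1 * x 1 + q⁻¹ • (x 1 * d) - ρ • (1 : A) := by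
  have h1 := h.two_mul_zero
  have h2 := h.g_eq
  rw [h1] at h2
  linear_combination (norm := module) -h2

theorem two_mul_zero' (h : IsSphere q Λ ρ x d d') :
    (q + q⁻¹) • (x 2 * x 0) = x 1 * x 1 - q • (x 1 * d) - ρ • (1 : A) := by
  rw [h.two_mul_zero, smul_sub, h.zero_mul_two]
  module

theorem one_mul_zero' (h : IsSphere q Λ ρ x d d') :
    x 1 * x 0 = q ^ 2 • (x 0 * x 1) - (q * Λ) • x 0 := by
  have hq := h.q_ne_zero
  rw [h.one_mul_zero, h.d_eq, mul_sub, mul_smul_comm, mul_smul_comm, mul_one]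
  match_scalars
  · field_simp
    ring
  · ring

theorem eq_of_mul_d (h : IsSphere q Λ ρ x d d') {a b : A} (hab : a * d = b * d) : a = b := by
  rw [← mul_one a, ← h.mul_inv, ← mul_assoc, hab, mul_assoc, h.mul_inv, mul_one]

/-! The row `x_m L_{ma}` and the column `(L⁻¹)_{ak} g^{kl} x_l` are computed for each `a`. -/

theorem left_zero (h : IsSphere q Λ ρ x d d') :
    ∑ m, x m * lMat q x d d' m 0 =
      ((q ^ 4)⁻¹ * (Λ ^ 2 - (q - q⁻¹) ^ 2 * ρ)) • (x 0 * d') := by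
  have hq := h.q_ne_zero
  have h1 : x 1 * (x 0 * x 1) = q ^ 2 • (x 0 * (x 1 * x 1)) - (q * Λ) • (x 0 * x 1) := by
    rw [← mul_assoc, h.one_mul_zero', sub_mul, smul_mul_assoc, smul_mul_assoc, mul_assoc]
  have h2 : ((q - q⁻¹) * ((q ^ 2)⁻¹ - (q ^ 6)⁻¹)) • (x 2 * (x 0 * x 0)) =
      ((q - q⁻¹) ^ 2 * (q ^ 4)⁻¹) • ((x 1 * x 1 - q • (x 1 * d) - ρ • (1 : A)) * x 0) := by
    rw [← h.two_mul_zero', smul_mul_assoc, smul_smul, mul_assoc (x 2)]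
    congr 1; field_simp; ring
  refine h.eq_of_mul_d ?_
  simp only [lMat, Fin.sum_univ_three, Matrix.of_apply, Matrix.cons_val', Matrix.cons_val_zero,
    Matrix.cons_val_one, Matrix.cons_val_fin_one, Matrix.cons_val, add_mul, mul_smul_comm,
    smul_mul_assoc, mul_assoc, h.inv_mul, mul_one, h2]
  rw [h.d_eq]
  simp only [mul_sub, sub_mul, mul_smul_comm, smul_mul_assoc, mul_one, one_mul, mul_assoc,
    h.one_mul_zero', h1]
  match_scalars <;> field_simp <;> ring

theorem left_one (h : IsSphere q Λ ρ x d d') :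
    ∑ m, x m * lMat q x d d' m 1 =
      (q ^ 2)⁻¹ • ((Λ • x 1 - ((q - q⁻¹) * ρ) • 1) * d') := by
  have hq := h.q_ne_zero
  have h2 : ((q - q⁻¹) * (q⁻¹ + (q ^ 3)⁻¹)) • (x 2 * x 0) =
      ((q - q⁻¹) * (q ^ 2)⁻¹) • (x 1 * x 1 - q • (x 1 * d) - ρ • (1 : A)) := by
    rw [← h.two_mul_zero', smul_smul]
    congr 1; field_simp
  refine h.eq_of_mul_d ?_
  simp only [lMat, Fin.sum_univ_three, Matrix.of_apply, Matrix.cons_val', Matrix.cons_val_zero,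
    Matrix.cons_val_one, Matrix.cons_val_fin_one, Matrix.cons_val, add_mul, mul_smul_comm,
    smul_mul_assoc, mul_assoc, h.inv_mul, mul_one, h2, mul_zero, zero_add]
  rw [h.d_eq]
  simp only [mul_sub, sub_mul, mul_smul_comm, smul_mul_assoc, mul_one, one_mul, mul_assoc]
  match_scalars <;> field_simp <;> ring

theorem left_two :
    ∑ m, x m * lMat q x d d' m 2 = x 2 * d' := by
  simp [lMat, Fin.sum_univ_three]

theorem right_zero :
    ∑ k, lInv q x d d' 0 k * ∑ l, g q k l • x l = -(q • (d' * x 2)) := by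
  simp [lInv, g, Fin.sum_univ_three]

theorem right_one (h : IsSphere q Λ ρ x d d') :
    ∑ k, lInv q x d d' 1 k * ∑ l, g q k l • x l =
      q ^ 2 • ((Λ • x 1 - ((q - q⁻¹) * ρ) • 1) * d') := by
  have hq := h.q_ne_zero
  have h1 : d' * x 2 * d = q ^ 2 • x 2 := by
    rw [mul_assoc, h.two_mul_d, mul_smul_comm, ← mul_assoc, h.inv_mul, one_mul]
  have h2 : ((q - (q ^ 3)⁻¹) * q * q ^ 2) • (x 0 * x 2) =
      ((q - q⁻¹) * q ^ 2) • (x 1 * x 1 + q⁻¹ • (x 1 * d) - ρ • (1 : A)) := by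
    rw [← h.zero_mul_two, smul_smul]
    congr 1; field_simp; ring
  have h3 : (∑ k, lInv q x d d' 1 k * ∑ l, g q k l • x l) * d =
      ((q - (q ^ 3)⁻¹) * q * q ^ 2) • (x 0 * x 2) + x 1 * d := by
    simp [lInv, g, Fin.sum_univ_three, add_mul, mul_assoc, sub_mul]
    rw [← mul_assoc d', h1]
    simp only [mul_smul_comm]
    module
  refine h.eq_of_mul_d ?_
  rw [h3, h2]
  simp only [smul_mul_assoc, mul_assoc, h.inv_mul, mul_one]
  rw [h.d_eq]
  simp only [mul_sub, sub_mul, mul_smul_comm, smul_mul_assoc, mul_one, one_mul, mul_assoc]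
  match_scalars <;> field_simp <;> ring

theorem right_two (h : IsSphere q Λ ρ x d d') :
    ∑ k, lInv q x d d' 2 k * ∑ l, g q k l • x l =
      -((q ^ 3 * (Λ ^ 2 - (q - q⁻¹) ^ 2 * ρ)) • (d' * x 0)) := by
  have hq := h.q_ne_zero
  have h1 : d' * x 2 * d = q ^ 2 • x 2 := by
    rw [mul_assoc, h.two_mul_d, mul_smul_comm, ← mul_assoc, h.inv_mul, one_mul]
  have h2 : ((q - q⁻¹) * (1 - (q ^ 4)⁻¹) * q * q ^ 2) • (x 0 * (x 0 * x 2)) =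
      ((q - q⁻¹) ^ 2 * q) • (x 0 * (x 1 * x 1 + q⁻¹ • (x 1 * d) - ρ • (1 : A))) := by
    rw [← h.zero_mul_two, mul_smul_comm, smul_smul]
    congr 1; field_simp; ring
  have h3 : (∑ k, lInv q x d d' 2 k * ∑ l, g q k l • x l) * d =
      -(((q - q⁻¹) * (1 - (q ^ 4)⁻¹) * q * q ^ 2) • (x 0 * (x 0 * x 2)))
        - ((q - q⁻¹) * (q + q⁻¹)) • (x 0 * (x 1 * d)) - q • (x 0 * (d * d)) := by
    simp [lInv, g, Fin.sum_univ_three, add_mul, mul_assoc, sub_mul]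
    rw [← mul_assoc d', h1, ← mul_assoc d, h.d_mul_zero]
    simp only [mul_smul_comm, smul_mul_assoc, mul_assoc]
    match_scalars <;> field_simp
    try ring
  refine h.eq_of_mul_d ?_
  rw [h3, h2, neg_mul, smul_mul_assoc, h.inv_mul_zero, smul_mul_assoc, mul_assoc, h.inv_mul]
  rw [h.d_eq]
  simp only [mul_sub, sub_mul, mul_add, mul_smul_comm, smul_mul_assoc, mul_one, one_mul, mul_assoc]
  match_scalars <;> field_simp <;> ring

/-- The operator `f ↦ x_m (L f L⁻¹)_{mk} g^{kl} x_l` as a sum of three terms `a d⁻¹ f d⁻¹ b`, up to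
scalars, with `a`, `b` of degree one in the generators. -/
theorem sandwich_eq (h : IsSphere q Λ ρ x d d') (f : A) :
    ∑ m, ∑ k, x m * h.braidHom f m k * ∑ l, g q k l • x l =
      -(((q ^ 3)⁻¹ * (Λ ^ 2 - (q - q⁻¹) ^ 2 * ρ)) • (x 0 * d' * f * (d' * x 2)))
      + (Λ • x 1 - ((q - q⁻¹) * ρ) • 1) * d' * f * ((Λ • x 1 - ((q - q⁻¹) * ρ) • 1) * d')
      - (q ^ 3 * (Λ ^ 2 - (q - q⁻¹) ^ 2 * ρ)) • (x 2 * d' * f * (d' * x 0)) := by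
  have hq := h.q_ne_zero
  have key : ∑ m, ∑ k, x m * h.braidHom f m k * ∑ l, g q k l • x l =
      ∑ a, (∑ m, x m * lMat q x d d' m a) * f *
        ∑ k, lInv q x d d' a k * ∑ l, g q k l • x l := by
    have hb : ∀ m k, h.braidHom f m k = ∑ a, lMat q x d d' m a * f * lInv q x d d' a k := by
      intro m k
      rw [braidHom_apply, Matrix.mul_apply]
      simp only [Matrix.mul_diagonal]
    generalize hy : (fun k => ∑ l, g q k l • x l) = y
    have hy' : ∀ k, ∑ l, g q k l • x l = y k := fun k => by rw [← hy]
    simp only [hb, hy', Fin.sum_univ_three, mul_add, add_mul, mul_assoc]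
    abel
  rw [key, Fin.sum_univ_three, h.left_zero, h.left_one, left_two, right_zero, h.right_one,
    h.right_two]
  simp only [smul_mul_assoc, mul_smul_comm, mul_neg, smul_neg]
  generalize (Λ • x 1 - ((q - q⁻¹) * ρ) • 1) * d' * f * ((Λ • x 1 - ((q - q⁻¹) * ρ) • 1) * d') = E
  match_scalars <;> field_simp

end IsSphere

end

section

/-! ### The regular representation of the algebra of forms -/

/-- Coordinates of a form with respect to the basis `1, ξ_i, ω_i, vol` of the right module of
forms, where `ξ_i ξ_j = ∑ n, ε_n^{ij} ω_n` and `ξ_i ω_n = g_{in} vol`. -/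
abbrev FormCoord (A : Type*) : Type _ := A × (Fin 3 → A) × (Fin 3 → A) × A

namespace IsSphere

variable {A : Type*} [Ring A] [Algebra ℂ A] {q Λ ρ : ℂ} {x : Fin 3 → A} {d d' : A}

/-- Left multiplication by functions in the coordinates `FormCoord`. -/
def leftFn (h : IsSphere q Λ ρ x d d') : A →ₐ[ℂ] Module.End ℂ (FormCoord A) :=
  AlgHom.ofLinearMap
    { toFun := fun f =>
        { toFun := fun α => (f * α.1, (h.braidHom f).mulVec α.2.1,
            (h.braidHom f).mulVec α.2.2.1, f * α.2.2.2)
          map_add' := fun α β => by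
            simp only [Prod.fst_add, Prod.snd_add, mul_add, Matrix.mulVec_add, Prod.mk_add_mk]
          map_smul' := fun c α => by
            simp only [Prod.smul_fst, Prod.smul_snd, mul_smul_comm, Matrix.mulVec_smul,
              Prod.smul_mk, RingHom.id_apply] }
      map_add' := fun f f' => LinearMap.ext fun α => by
        simp only [map_add, add_mul, Matrix.add_mulVec, LinearMap.coe_mk, AddHom.coe_mk,
          LinearMap.add_apply, Prod.mk_add_mk]
      map_smul' := fun c f => LinearMap.ext fun α => by
        simp only [map_smul, smul_mul_assoc, Matrix.smul_mulVec, LinearMap.coe_mk,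
          AddHom.coe_mk, LinearMap.smul_apply, Prod.smul_mk, RingHom.id_apply] }
    (LinearMap.ext fun α => by simp)
    (fun f f' => LinearMap.ext fun α => by
      simp [mul_assoc, Matrix.mulVec_mulVec])

theorem leftFn_apply (h : IsSphere q Λ ρ x d d') (f a b : A) (v w : Fin 3 → A) :
    h.leftFn f (a, v, w, b) =
      (f * a, (h.braidHom f).mulVec v, (h.braidHom f).mulVec w, f * b) := rfl

end IsSphere

/-- Left multiplication by `ξ_i` in the coordinates `FormCoord`. -/
def leftXi (q : ℂ) (A : Type*) [Ring A] [Algebra ℂ A] (i : Fin 3) :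
    Module.End ℂ (FormCoord A) where
  toFun α := (0, Pi.single i α.1, fun n => ∑ m, eps q n i m • α.2.1 m, ∑ n, g q i n • α.2.2.1 n)
  map_add' α β := by
    simp only [Prod.fst_add, Prod.snd_add, Pi.single_add, Pi.add_apply, smul_add,
      Finset.sum_add_distrib, Prod.mk_add_mk, add_zero]
    rfl
  map_smul' c α := by
    simp only [Prod.smul_fst, Prod.smul_snd, Pi.single_smul, Pi.smul_apply, smul_comm _ c,
      Finset.smul_sum, Prod.smul_mk, smul_zero, RingHom.id_apply]
    congr 3
    funext n
    simp only [Pi.smul_apply, Finset.smul_sum]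

theorem leftXi_apply (q : ℂ) (A : Type*) [Ring A] [Algebra ℂ A] (i : Fin 3) (a b : A)
    (v w : Fin 3 → A) :
    leftXi q A i (a, v, w, b) =
      (0, Pi.single i a, fun n => ∑ m, eps q n i m • v m, ∑ n, g q i n • w n) := rfl

theorem FormCoord.ext {A : Type*} {α β : FormCoord A} (h1 : α.1 = β.1)
    (h2 : ∀ k, α.2.1 k = β.2.1 k) (h3 : ∀ k, α.2.2.1 k = β.2.2.1 k) (h4 : α.2.2.2 = β.2.2.2) :
    α = β :=
  Prod.ext h1 (Prod.ext (funext h2) (Prod.ext (funext h3) h4))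

theorem FormCoord.sum_one {A ι : Type*} [AddCommMonoid A] (s : Finset ι) (F : ι → FormCoord A) :
    (∑ i ∈ s, F i).1 = ∑ i ∈ s, (F i).1 := Prod.fst_sum

theorem FormCoord.sum_two {A ι : Type*} [AddCommMonoid A] (s : Finset ι) (F : ι → FormCoord A)
    (k : Fin 3) : (∑ i ∈ s, F i).2.1 k = ∑ i ∈ s, (F i).2.1 k := by
  rw [Prod.snd_sum, Prod.fst_sum, Finset.sum_apply]

theorem FormCoord.sum_three {A ι : Type*} [AddCommMonoid A] (s : Finset ι) (F : ι → FormCoord A)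
    (k : Fin 3) : (∑ i ∈ s, F i).2.2.1 k = ∑ i ∈ s, (F i).2.2.1 k := by
  rw [Prod.snd_sum, Prod.snd_sum, Prod.fst_sum, Finset.sum_apply]

theorem FormCoord.sum_four {A ι : Type*} [AddCommMonoid A] (s : Finset ι) (F : ι → FormCoord A) :
    (∑ i ∈ s, F i).2.2.2 = ∑ i ∈ s, (F i).2.2.2 := by
  rw [Prod.snd_sum, Prod.snd_sum, Prod.snd_sum]

/-- The operators `leftXi` satisfy the quadratic relation of the `ξ_i`. -/
theorem leftXi_wedge {q : ℂ} (hq : q ≠ 0) (h3 : qNum q 3 ≠ 0) (h4 : qNum (q ^ 2) 2 ≠ 0)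
    (A : Type*) [Ring A] [Algebra ℂ A] (i j : Fin 3) :
    leftXi q A i * leftXi q A j =
      -q ^ 2 • ∑ k, ∑ l, Rhat q k l i j • (leftXi q A k * leftXi q A l) := by
  refine LinearMap.ext fun ⟨a, v, w, b⟩ => ?_
  simp only [LinearMap.smul_apply, LinearMap.sum_apply, Module.End.mul_apply, leftXi_apply]
  refine FormCoord.ext ?_ ?_ ?_ ?_
  · simp only [Prod.smul_fst, FormCoord.sum_one, smul_zero, Finset.sum_const_zero]
  · intro p
    simp only [Prod.smul_fst, Prod.smul_snd, Pi.smul_apply, FormCoord.sum_two, Pi.single_zero,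
      Pi.zero_apply, smul_zero, Finset.sum_const_zero]
  · intro n
    simp only [Prod.smul_fst, Prod.smul_snd, Pi.smul_apply, FormCoord.sum_three,
      Pi.single_apply, smul_ite, smul_zero, Finset.sum_ite_eq', Finset.mem_univ, if_true, smul_smul,
      ← Finset.sum_smul]
    rw [eps_wedge hq h3 h4 i j n]
  · simp only [Prod.smul_fst, Prod.smul_snd, FormCoord.sum_four, Finset.smul_sum, smul_smul]
    rw [Finset.sum_comm]
    have e : ∀ m, ∑ n, (g q i n * eps q n j m) • v m =
        ∑ k, ∑ l, ∑ n, (-q ^ 2 * (Rhat q k l i j * (g q k n * eps q n l m))) • v m := by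
      intro m
      simp only [← Finset.sum_smul, g_eps_wedge hq h3 h4 i j m, Finset.mul_sum]
    simp only [e]
    rw [Finset.sum_comm]
    refine Finset.sum_congr rfl fun k _ => ?_
    rw [Finset.sum_comm]
    refine Finset.sum_congr rfl fun l _ => ?_
    rw [Finset.sum_comm]
    simp only [mul_assoc]

theorem sum_comm_four {ι M : Type*} [Fintype ι] [AddCommMonoid M] (F : ι → ι → ι → ι → M) :
    ∑ k, ∑ l, ∑ a, ∑ m, F k l a m = ∑ m, ∑ k, ∑ l, ∑ a, F k l a m :=
  (Finset.sum_congr rfl fun _ _ =>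
    (Finset.sum_congr rfl fun _ _ => Finset.sum_comm).trans Finset.sum_comm).trans Finset.sum_comm

/-- Moving `x_i` past two factors which are contracted with a tensor `t`. -/
theorem sum_Rhat_mul {A : Type*} [Ring A] [Algebra ℂ A] (q : ℂ) (x v : Fin 3 → A) (i j : Fin 3)
    (t : Matrix (Fin 3) (Fin 3) ℂ) :
    ∑ k, ∑ l, Rhat q k l i j • ∑ a, t k a • ∑ m, (∑ s, Rhat q a s l m • x s) * v m =
      ∑ m, ∑ s, (∑ l, (braid q i l).transpose * t * braid q l s) j m • (x s * v m) := by
  simp only [Finset.sum_mul, Finset.smul_sum, smul_mul_assoc, smul_smul]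
  rw [sum_comm_four]
  refine Finset.sum_congr rfl fun m _ => ?_
  rw [sum_comm_four]
  refine Finset.sum_congr rfl fun s _ => ?_
  simp only [← Finset.sum_smul]
  congr 1
  simp only [Matrix.sum_apply, Matrix.mul_apply, Matrix.transpose_apply, braid, Matrix.of_apply,
    Finset.sum_mul]
  rw [Finset.sum_comm]
  refine Finset.sum_congr rfl fun l _ => ?_
  rw [Finset.sum_comm]
  refine Finset.sum_congr rfl fun a _ => Finset.sum_congr rfl fun k _ => ?_
  ring

/-- The operators `leftFn` and `leftXi` satisfy the commutation relation of `x_i` and `ξ_j`. -/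
theorem IsSphere.leftFn_leftXi {A : Type*} [Ring A] [Algebra ℂ A] {q Λ ρ : ℂ} {x : Fin 3 → A}
    {d d' : A} (h : IsSphere q Λ ρ x d d') (h3 : qNum q 3 ≠ 0) (h4 : qNum (q ^ 2) 2 ≠ 0)
    (i j : Fin 3) :
    h.leftFn (x i) * leftXi q A j =
      ∑ k, ∑ l, Rhat q k l i j • (leftXi q A k * h.leftFn (x l)) := by
  have hq := h.q_ne_zero
  refine LinearMap.ext fun ⟨a, v, w, b⟩ => ?_
  simp only [LinearMap.smul_apply, LinearMap.sum_apply, Module.End.mul_apply, leftXi_apply,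
    IsSphere.leftFn_apply, h.braidHom_x h3 h4]
  refine FormCoord.ext ?_ ?_ ?_ ?_
  · simp only [Prod.smul_fst, FormCoord.sum_one, smul_zero, mul_zero, Finset.sum_const_zero]
  · intro p
    simp only [Prod.smul_fst, Prod.smul_snd, Pi.smul_apply, FormCoord.sum_two, Matrix.mulVec_single,
      Matrix.col_apply, Matrix.of_apply, Pi.single_apply, smul_ite, smul_zero]
    rw [Finset.sum_comm]
    simp [Finset.sum_mul]
  · intro n
    simp only [Prod.smul_fst, Prod.smul_snd, Pi.smul_apply, FormCoord.sum_three, Matrix.mulVec,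
      dotProduct, Matrix.of_apply]
    rw [sum_Rhat_mul q x v i j (eps q n)]
    simp only [← braid_eps hq h3 h4]
    simp only [Matrix.sum_apply, Matrix.smul_apply, Finset.sum_mul, Finset.mul_sum,
      Finset.sum_smul, smul_mul_assoc, mul_smul_comm, smul_smul, Finset.smul_sum, smul_eq_mul]
    rw [Finset.sum_comm]
    refine Finset.sum_congr rfl fun m _ => ?_
    rw [Finset.sum_comm]
    refine Finset.sum_congr rfl fun s _ => Finset.sum_congr rfl fun p _ => ?_
    rw [mul_comm, braid, Matrix.of_apply]
  · simp only [Prod.smul_fst, Prod.smul_snd, FormCoord.sum_four, Matrix.mulVec,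
      dotProduct, Matrix.of_apply]
    rw [sum_Rhat_mul q x w i j (g q), Finset.mul_sum]
    refine Finset.sum_congr rfl fun n _ => ?_
    rw [Finset.sum_eq_single i]
    · rw [braid_g hq h3 h4, if_pos rfl, mul_smul_comm]
    · intro s _ hs
      rw [braid_g hq h3 h4, if_neg hs, Matrix.zero_apply, zero_smul]
    · simp

end

section

/-! ### Multiplication of the generators of forms -/

variable {q : ℂ} {r : ℝ} {N : ℕ}

theorem fn_mul_xi (i j : Fin 3) :
    fn q r N (sphereCoord q r N i) * xi q r N j =
      ∑ k, ∑ l, Rhat q k l i j • (xi q r N k * fn q r N (sphereCoord q r N l)) := by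
  have := RingQuot.mkAlgHom_rel ℂ (FormRel.braid (q := q) (r := r) (N := N) i j)
  simp only [map_mul, map_sum, map_smul] at this
  exact this

theorem xi_mul_xi_Rhat (i j : Fin 3) :
    xi q r N i * xi q r N j =
      -q ^ 2 • ∑ k, ∑ l, Rhat q k l i j • (xi q r N k * xi q r N l) := by
  have := RingQuot.mkAlgHom_rel ℂ (FormRel.wedge (q := q) (r := r) (N := N) i j)
  simp only [map_mul, map_sum, map_smul] at this
  exact this

/-- The relations of the `ξ_i` in reduced form. -/
theorem xi_relations (hq : q ≠ 0) (h2 : qNum q 2 ≠ 0) (h3 : qNum q 3 ≠ 0)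
    (h4 : qNum (q ^ 2) 2 ≠ 0) :
    xi q r N 0 * xi q r N 0 = 0 ∧ xi q r N 2 * xi q r N 2 = 0 ∧
    xi q r N 1 * xi q r N 0 = -(q ^ 2)⁻¹ • (xi q r N 0 * xi q r N 1) ∧
    xi q r N 2 * xi q r N 1 = -(q ^ 2)⁻¹ • (xi q r N 1 * xi q r N 2) ∧
    xi q r N 2 * xi q r N 0 = (-1 : ℂ) • (xi q r N 0 * xi q r N 2) ∧
    xi q r N 1 * xi q r N 1 = (q - q⁻¹) • (xi q r N 0 * xi q r N 2) := by
  have hR : ∀ k l i j, Rhat q k l i j = braid q i l k j := fun _ _ _ _ => rfl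
  obtain ⟨b1, b2, b3, b4, b5, b6, b7, b8, b9⟩ := braid_eq hq h3 h4
  have r00 := xi_mul_xi_Rhat (q := q) (r := r) (N := N) 0 0
  have r22 := xi_mul_xi_Rhat (q := q) (r := r) (N := N) 2 2
  have r01 := xi_mul_xi_Rhat (q := q) (r := r) (N := N) 0 1
  have r12 := xi_mul_xi_Rhat (q := q) (r := r) (N := N) 1 2
  have r02 := xi_mul_xi_Rhat (q := q) (r := r) (N := N) 0 2
  have r11 := xi_mul_xi_Rhat (q := q) (r := r) (N := N) 1 1
  have e4 : 1 + q ^ 4 ≠ 0 := fun h => h4 (by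
    rw [qNum_two _ (pow_ne_zero 2 hq)]; field_simp; linear_combination h)
  have e2 : 1 + q ^ 2 ≠ 0 := fun h => h2 (by
    rw [qNum_two _ hq]; field_simp; linear_combination h)
  simp [hR, Fin.sum_univ_three, b1, b2, b3, b4, b5, b6, b7, b8, b9] at r00 r22 r01 r12 r02 r11
  refine ⟨?_, ?_, ?_, ?_, ?_, ?_⟩
  · have : (1 + q ^ 4) • (xi q r N 0 * xi q r N 0) = 0 := by
      rw [add_smul, one_smul]
      nth_rewrite 1 [r00]
      module
    exact (smul_eq_zero.1 this).resolve_left e4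
  · have : (1 + q ^ 4) • (xi q r N 2 * xi q r N 2) = 0 := by
      rw [add_smul, one_smul]
      nth_rewrite 1 [r22]
      module
    exact (smul_eq_zero.1 this).resolve_left e4
  · rw [r01]; match_scalars; field_simp
  · rw [r12]; match_scalars; field_simp
  · rw [r02]; match_scalars; field_simp
  · have : (1 + q ^ 2) • (xi q r N 1 * xi q r N 1) =
        (1 + q ^ 2) • ((q - q⁻¹) • (xi q r N 0 * xi q r N 2)) := by
      rw [add_smul, one_smul, r02]
      nth_rewrite 1 [r11]
      match_scalars <;> field_simp <;> ring
    exact smul_right_injective _ e2 this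

theorem xi_relations_mul (hq : q ≠ 0) (h2 : qNum q 2 ≠ 0) (h3 : qNum q 3 ≠ 0)
    (h4 : qNum (q ^ 2) 2 ≠ 0) :
    (∀ z, xi q r N 0 * (xi q r N 0 * z) = 0) ∧
    (∀ z, xi q r N 1 * (xi q r N 0 * z) = -(q ^ 2)⁻¹ • (xi q r N 0 * (xi q r N 1 * z))) ∧
    (∀ z, xi q r N 2 * (xi q r N 0 * z) = (-1 : ℂ) • (xi q r N 0 * (xi q r N 2 * z))) ∧
    (∀ z, xi q r N 2 * (xi q r N 1 * z) = -(q ^ 2)⁻¹ • (xi q r N 1 * (xi q r N 2 * z))) ∧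
    (∀ z, xi q r N 1 * (xi q r N 1 * z) = (q - q⁻¹) • (xi q r N 0 * (xi q r N 2 * z))) := by
  obtain ⟨r00, -, r10, r21, r20, r11⟩ := xi_relations (r := r) (N := N) hq h2 h3 h4
  refine ⟨fun z => ?_, fun z => ?_, fun z => ?_, fun z => ?_, fun z => ?_⟩
  · rw [← mul_assoc, r00, zero_mul]
  · rw [← mul_assoc, r10, smul_mul_assoc, mul_assoc]
  · rw [← mul_assoc, r20, smul_mul_assoc, mul_assoc]
  · rw [← mul_assoc, r21, smul_mul_assoc, mul_assoc]
  · rw [← mul_assoc, r11, smul_mul_assoc, mul_assoc]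

variable (q r N) in
/-- The basis `ω_n` of the two-forms, normalized by `ξ_i ξ_j = ∑ n, ε_n^{ij} ω_n`. -/
def omega : Fin 3 → Forms q r N :=
  ![q⁻¹ • (xi q r N 0 * xi q r N 1), xi q r N 0 * xi q r N 2, q⁻¹ • (xi q r N 1 * xi q r N 2)]

variable (q r N) in
/-- The three-form with `ξ_i ω_n = g_{in} vol`. -/
def vol : Forms q r N := -(q ^ 2)⁻¹ • (xi q r N 0 * (xi q r N 1 * xi q r N 2))

theorem xi_mul_xi (hq : q ≠ 0) (h2 : qNum q 2 ≠ 0) (h3 : qNum q 3 ≠ 0) (h4 : qNum (q ^ 2) 2 ≠ 0)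
    (i j : Fin 3) : xi q r N i * xi q r N j = ∑ n, eps q n i j • omega q r N n := by
  obtain ⟨r00, r22, r10, r21, r20, r11⟩ := xi_relations (r := r) (N := N) hq h2 h3 h4
  fin_cases i <;> fin_cases j <;>
    simp [eps, Fin.sum_univ_three, omega, r00, r22, r10, r21, r20, r11, smul_smul, hq]
  all_goals
    match_scalars
    field_simp

theorem xi_mul_omega (hq : q ≠ 0) (h2 : qNum q 2 ≠ 0) (h3 : qNum q 3 ≠ 0)
    (h4 : qNum (q ^ 2) 2 ≠ 0) (i n : Fin 3) :
    xi q r N i * omega q r N n = g q i n • vol q r N := by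
  obtain ⟨r00, r22, r10, r21, r20, r11⟩ := xi_relations (r := r) (N := N) hq h2 h3 h4
  obtain ⟨a00, a10, a20, a21, a11⟩ := xi_relations_mul (r := r) (N := N) hq h2 h3 h4
  fin_cases i <;> fin_cases n <;>
    simp [g, omega, vol, r00, r22, r10, r21, r20, r11, a00, a10, a20, a21, a11, smul_smul, hq]
  all_goals
    match_scalars
    field_simp

theorem xi_mul_vol (hq : q ≠ 0) (h2 : qNum q 2 ≠ 0) (h3 : qNum q 3 ≠ 0) (h4 : qNum (q ^ 2) 2 ≠ 0)
    (i : Fin 3) : xi q r N i * vol q r N = 0 := by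
  obtain ⟨r00, r22, r10, r21, r20, r11⟩ := xi_relations (r := r) (N := N) hq h2 h3 h4
  obtain ⟨a00, a10, a20, a21, a11⟩ := xi_relations_mul (r := r) (N := N) hq h2 h3 h4
  fin_cases i <;>
    simp [vol, r00, r22, r10, r21, r20, r11, a00, a10, a20, a21, a11]

variable (q r N) in
/-- The form with given coordinates in the basis `1, ξ_i, ω_i, vol`. -/
def ofCoord : FormCoord (Sphere q r N) →ₗ[ℂ] Forms q r N where
  toFun α := fn q r N α.1 + ∑ k, xi q r N k * fn q r N (α.2.1 k) +
    ∑ k, omega q r N k * fn q r N (α.2.2.1 k) + vol q r N * fn q r N α.2.2.2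
  map_add' α β := by
    simp only [Prod.fst_add, Prod.snd_add, Pi.add_apply, map_add, mul_add, Finset.sum_add_distrib]
    abel
  map_smul' c α := by
    simp only [Prod.smul_fst, Prod.smul_snd, Pi.smul_apply, map_smul, mul_smul_comm,
      smul_add, Finset.smul_sum, RingHom.id_apply]

theorem ofCoord_apply (a b : Sphere q r N) (v w : Fin 3 → Sphere q r N) :
    ofCoord q r N (a, v, w, b) = fn q r N a + ∑ k, xi q r N k * fn q r N (v k) +
      ∑ k, omega q r N k * fn q r N (w k) + vol q r N * fn q r N b := rfl

theorem xi_mul_ofCoord (hq : q ≠ 0) (h2 : qNum q 2 ≠ 0) (h3 : qNum q 3 ≠ 0)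
    (h4 : qNum (q ^ 2) 2 ≠ 0) (i : Fin 3) (α : FormCoord (Sphere q r N)) :
    xi q r N i * ofCoord q r N α = ofCoord q r N (leftXi q _ i α) := by
  obtain ⟨a, v, w, b⟩ := α
  rw [leftXi_apply, ofCoord_apply, ofCoord_apply, mul_add, mul_add, mul_add,
    ← mul_assoc (xi q r N i) (vol q r N), xi_mul_vol hq h2 h3 h4, zero_mul, add_zero,
    map_zero, zero_add]
  congr 1
  · congr 1
    · rw [Finset.sum_eq_single i]
      · rw [Pi.single_eq_same]
      · intro k _ hk
        rw [Pi.single_eq_of_ne hk, map_zero, mul_zero]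
      · simp
    · simp only [Finset.mul_sum, map_sum, map_smul, ← mul_assoc, xi_mul_xi hq h2 h3 h4,
        Finset.sum_mul, smul_mul_assoc, mul_smul_comm]
      exact Finset.sum_comm
  · simp only [Finset.mul_sum, map_sum, map_smul, ← mul_assoc, xi_mul_omega hq h2 h3 h4,
      smul_mul_assoc, mul_smul_comm]

end

section

/-! ### Coordinates of forms -/

variable {q : ℂ} {r : ℝ} {N : ℕ}

theorem ofCoord_mul_fn (α : FormCoord (Sphere q r N)) (f : Sphere q r N) :
    ofCoord q r N α * fn q r N f =
      ofCoord q r N (α.1 * f, fun k => α.2.1 k * f, fun k => α.2.2.1 k * f, α.2.2.2 * f) := by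
  obtain ⟨a, v, w, b⟩ := α
  simp only [ofCoord_apply, add_mul, Finset.sum_mul, map_mul, mul_assoc]

theorem xi_mul_mem_range (hq : q ≠ 0) (h2 : qNum q 2 ≠ 0) (h3 : qNum q 3 ≠ 0)
    (h4 : qNum (q ^ 2) 2 ≠ 0) (i : Fin 3) {β : Forms q r N}
    (hβ : β ∈ LinearMap.range (ofCoord q r N)) :
    xi q r N i * β ∈ LinearMap.range (ofCoord q r N) := by
  obtain ⟨α, rfl⟩ := hβ
  exact ⟨_, (xi_mul_ofCoord hq h2 h3 h4 i α).symm⟩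

theorem fn_mem_range (f : Sphere q r N) : fn q r N f ∈ LinearMap.range (ofCoord q r N) :=
  ⟨(f, 0, 0, 0), by simp [ofCoord_apply]⟩

/-- Functions can be moved to the right of a product of `ξ`'s. -/
theorem fn_coord_mul_word_mem_range (hq : q ≠ 0) (h2 : qNum q 2 ≠ 0) (h3 : qNum q 3 ≠ 0)
    (h4 : qNum (q ^ 2) 2 ≠ 0) (w : List (Fin 3)) (f : Sphere q r N) (i : Fin 3) :
    fn q r N (sphereCoord q r N i) * ((w.map (xi q r N)).prod * fn q r N f) ∈
      LinearMap.range (ofCoord q r N) := by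
  induction w generalizing i with
  | nil => simpa only [List.map_nil, List.prod_nil, one_mul, ← map_mul] using fn_mem_range _
  | cons j w ih =>
    rw [List.map_cons, List.prod_cons, mul_assoc, ← mul_assoc, fn_mul_xi, Finset.sum_mul]
    refine sum_mem fun k _ => ?_
    rw [Finset.sum_mul]
    refine sum_mem fun l _ => ?_
    rw [smul_mul_assoc, mul_assoc]
    exact Submodule.smul_mem _ _ (xi_mul_mem_range hq h2 h3 h4 _ (ih l))

theorem fn_coord_mul_mem_range (hq : q ≠ 0) (h2 : qNum q 2 ≠ 0) (h3 : qNum q 3 ≠ 0)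
    (h4 : qNum (q ^ 2) 2 ≠ 0) (i : Fin 3) {β : Forms q r N}
    (hβ : β ∈ LinearMap.range (ofCoord q r N)) :
    fn q r N (sphereCoord q r N i) * β ∈ LinearMap.range (ofCoord q r N) := by
  have word := fn_coord_mul_word_mem_range (r := r) (N := N) hq h2 h3 h4
  obtain ⟨⟨a, v, w, b⟩, rfl⟩ := hβ
  rw [ofCoord_apply, mul_add, mul_add, mul_add, Finset.mul_sum, Finset.mul_sum]
  refine add_mem (add_mem (add_mem ?_ (sum_mem fun k _ => ?_)) (sum_mem fun k _ => ?_)) ?_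
  · simpa using word [] a i
  · simpa using word [k] (v k) i
  · fin_cases k
    · simpa [omega, smul_mul_assoc, mul_assoc] using
        Submodule.smul_mem _ q⁻¹ (word [0, 1] (w 0) i)
    · simpa [omega, mul_assoc] using word [0, 2] (w 1) i
    · simpa [omega, smul_mul_assoc, mul_assoc] using
        Submodule.smul_mem _ q⁻¹ (word [1, 2] (w 2) i)
  · rw [vol, smul_mul_assoc, mul_smul_comm]
    refine Submodule.smul_mem _ _ ?_
    simpa [mul_assoc] using word [0, 1, 2] b i

theorem fn_mul_mem_range (hq : q ≠ 0) (h2 : qNum q 2 ≠ 0) (h3 : qNum q 3 ≠ 0)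
    (h4 : qNum (q ^ 2) 2 ≠ 0) (f : Sphere q r N) {β : Forms q r N}
    (hβ : β ∈ LinearMap.range (ofCoord q r N)) :
    fn q r N f * β ∈ LinearMap.range (ofCoord q r N) := by
  obtain ⟨f, hf⟩ := f
  induction hf using Algebra.adjoin_induction generalizing β with
  | mem y hy =>
    obtain ⟨i, rfl⟩ := hy
    exact fn_coord_mul_mem_range hq h2 h3 h4 i hβ
  | algebraMap c =>
    have : fn q r N ⟨algebraMap ℂ _ c, Subalgebra.algebraMap_mem _ c⟩ = algebraMap ℂ _ c :=
      (fn q r N).commutes c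
    rw [this, ← Algebra.smul_def]
    exact Submodule.smul_mem _ _ hβ
  | add y z hy hz ihy ihz =>
    have : fn q r N ⟨y + z, add_mem hy hz⟩ = fn q r N ⟨y, hy⟩ + fn q r N ⟨z, hz⟩ :=
      map_add (fn q r N) ⟨y, hy⟩ ⟨z, hz⟩
    rw [this, add_mul]
    exact add_mem (ihy hβ) (ihz hβ)
  | mul y z hy hz ihy ihz =>
    have : fn q r N ⟨y * z, mul_mem hy hz⟩ = fn q r N ⟨y, hy⟩ * fn q r N ⟨z, hz⟩ :=
      map_mul (fn q r N) ⟨y, hy⟩ ⟨z, hz⟩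
    rw [this, mul_assoc]
    exact ihy (ihz hβ)

/-- The range of `ofCoord` contains `1` and is stable under left multiplication by generators. -/
theorem ofCoord_surjective (hq : q ≠ 0) (h2 : qNum q 2 ≠ 0) (h3 : qNum q 3 ≠ 0)
    (h4 : qNum (q ^ 2) 2 ≠ 0) : Function.Surjective (ofCoord q r N) := by
  intro α
  obtain ⟨a, rfl⟩ := RingQuot.mkAlgHom_surjective ℂ (FormRel q r N) α
  suffices H : ∀ β ∈ LinearMap.range (ofCoord q r N),
      RingQuot.mkAlgHom ℂ (FormRel q r N) a * β ∈ LinearMap.range (ofCoord q r N) by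
    have := H 1 (by simpa using fn_mem_range (q := q) (r := r) (N := N) 1)
    rwa [mul_one] at this
  induction a using FreeAlgebra.induction with
  | grade0 c =>
    intro β hβ
    rw [AlgHom.commutes, ← Algebra.smul_def]
    exact Submodule.smul_mem _ _ hβ
  | grade1 y =>
    intro β hβ
    rcases y with f | i
    · exact fn_mul_mem_range hq h2 h3 h4 f hβ
    · exact xi_mul_mem_range hq h2 h3 h4 i hβ
  | mul a b iha ihb =>
    intro β hβ
    rw [map_mul, mul_assoc]
    exact iha _ (ihb _ hβ)
  | add a b iha ihb =>
    intro β hβ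
    rw [map_add, add_mul]
    exact add_mem (iha _ hβ) (ihb _ hβ)

variable {d d' : Sphere q r N}

namespace IsSphere

/-- The left regular representation of the algebra of forms in the coordinates `FormCoord`. -/
def rep (h : IsSphere q (Lam q r N) ((r : ℂ) ^ 2) (sphereCoord q r N) d d') (h3 : qNum q 3 ≠ 0)
    (h4 : qNum (q ^ 2) 2 ≠ 0) : Forms q r N →ₐ[ℂ] Module.End ℂ (FormCoord (Sphere q r N)) :=
  RingQuot.liftAlgHom ℂ
    ⟨FreeAlgebra.lift ℂ (Sum.elim h.leftFn (leftXi q (Sphere q r N))), by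
      intro a b hab
      induction hab with
      | add f f' => simp
      | mul f f' => simp
      | scalar c => simp only [FreeAlgebra.lift_ι_apply, Sum.elim_inl, AlgHom.commutes]
      | braid i j =>
        simp only [map_mul, map_sum, map_smul, FreeAlgebra.lift_ι_apply, Sum.elim_inl,
          Sum.elim_inr]
        exact h.leftFn_leftXi h3 h4 i j
      | wedge i j =>
        simp only [map_mul, map_sum, map_smul, FreeAlgebra.lift_ι_apply, Sum.elim_inr]
        exact leftXi_wedge h.q_ne_zero h3 h4 _ i j⟩

variable (h : IsSphere q (Lam q r N) ((r : ℂ) ^ 2) (sphereCoord q r N) d d') (h3 : qNum q 3 ≠ 0)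
  (h4 : qNum (q ^ 2) 2 ≠ 0)

theorem rep_fn (f : Sphere q r N) : h.rep h3 h4 (fn q r N f) = h.leftFn f := by
  refine (RingQuot.liftAlgHom_mkAlgHom_apply ℂ _ _ _).trans ?_
  rw [FreeAlgebra.lift_ι_apply, Sum.elim_inl]

theorem rep_xi (i : Fin 3) : h.rep h3 h4 (xi q r N i) = leftXi q _ i := by
  refine (RingQuot.liftAlgHom_mkAlgHom_apply ℂ _ _ _).trans ?_
  rw [FreeAlgebra.lift_ι_apply, Sum.elim_inr]

theorem rep_omega (n : Fin 3) (a : Sphere q r N) :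
    h.rep h3 h4 (omega q r N n) (a, 0, 0, 0) = (0, 0, Pi.single n a, 0) := by
  have hq := h.q_ne_zero
  fin_cases n <;>
    simp [omega, rep_xi, leftXi_apply] <;>
    funext k <;> fin_cases k <;> simp [Fin.sum_univ_three, eps, hq]

theorem rep_vol (a : Sphere q r N) :
    h.rep h3 h4 (vol q r N) (a, 0, 0, 0) = (0, 0, 0, a) := by
  have hq := h.q_ne_zero
  simp only [vol, map_smul, map_mul, rep_xi, LinearMap.smul_apply, Module.End.mul_apply,
    leftXi_apply]
  refine FormCoord.ext ?_ (fun k => ?_) (fun k => ?_) ?_ <;>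
    simp [Fin.sum_univ_three, g, eps, hq, smul_smul]
  rw [← sq, inv_mul_cancel₀ (pow_ne_zero 2 hq), one_smul]

/-- The coordinates of a form, obtained by letting it act on `1`. -/
def toCoord : Forms q r N →ₗ[ℂ] FormCoord (Sphere q r N) :=
  (LinearMap.applyₗ (1, 0, 0, 0)) ∘ₗ (h.rep h3 h4).toLinearMap

theorem toCoord_apply (α : Forms q r N) : h.toCoord h3 h4 α = h.rep h3 h4 α (1, 0, 0, 0) := rfl

theorem toCoord_ofCoord (α : FormCoord (Sphere q r N)) :
    h.toCoord h3 h4 (ofCoord q r N α) = α := by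
  obtain ⟨a, v, w, b⟩ := α
  simp only [toCoord_apply, ofCoord_apply, map_add, map_sum, map_mul, rep_fn, rep_xi,
    LinearMap.add_apply, LinearMap.sum_apply, Module.End.mul_apply, leftFn_apply,
    Matrix.mulVec_zero, mul_zero, mul_one, rep_omega, rep_vol, leftXi_apply]
  refine FormCoord.ext ?_ (fun k => ?_) (fun k => ?_) ?_ <;>
    simp [FormCoord.sum_one, FormCoord.sum_two, FormCoord.sum_three, FormCoord.sum_four,
      Finset.sum_pi_single]

theorem ofCoord_bijective
    (h : IsSphere q (Lam q r N) ((r : ℂ) ^ 2) (sphereCoord q r N) d d') (h3 : qNum q 3 ≠ 0)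
    (h4 : qNum (q ^ 2) 2 ≠ 0) (h2 : qNum q 2 ≠ 0) : Function.Bijective (ofCoord q r N) :=
  ⟨Function.LeftInverse.injective (h.toCoord_ofCoord h3 h4),
    ofCoord_surjective h.q_ne_zero h2 h3 h4⟩

theorem ofCoord_toCoord (h2 : qNum q 2 ≠ 0) (α : Forms q r N) :
    ofCoord q r N (h.toCoord h3 h4 α) = α := by
  obtain ⟨c, rfl⟩ := ofCoord_surjective h.q_ne_zero h2 h3 h4 α
  rw [toCoord_ofCoord]

theorem toCoord_injective (h2 : qNum q 2 ≠ 0) : Function.Injective (h.toCoord h3 h4) :=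
  Function.LeftInverse.injective (h.ofCoord_toCoord h3 h4 h2)

end IsSphere

end

section

/-! ### The monomial basis -/

variable {q : ℂ} {r : ℝ} {N : ℕ} {d d' : Sphere q r N}

theorem sum_finset_fin_three {M : Type*} [AddCommMonoid M] (F : Finset (Fin 3) → M) :
    ∑ I, F I = F ∅ + (F {0} + F {1} + F {2}) + (F {0, 1} + F {0, 2} + F {1, 2}) + F {0, 1, 2} := by
  have : (Finset.univ : Finset (Finset (Fin 3))) =
      {∅, {0}, {1}, {2}, {0, 1}, {0, 2}, {1, 2}, {0, 1, 2}} := by decide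
  rw [this]
  iterate 7 rw [Finset.sum_insert (by decide)]
  rw [Finset.sum_singleton]
  abel

theorem xiMonomial_eq : xiMonomial q r N ∅ = 1 ∧ xiMonomial q r N {0} = xi q r N 0 ∧
    xiMonomial q r N {1} = xi q r N 1 ∧ xiMonomial q r N {2} = xi q r N 2 ∧
    xiMonomial q r N {0, 1} = xi q r N 0 * xi q r N 1 ∧
    xiMonomial q r N {0, 2} = xi q r N 0 * xi q r N 2 ∧
    xiMonomial q r N {1, 2} = xi q r N 1 * xi q r N 2 ∧
    xiMonomial q r N {0, 1, 2} = xi q r N 0 * (xi q r N 1 * xi q r N 2) := by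
  have s2 : ∀ a b : Fin 3, a < b → ({a, b} : Finset (Fin 3)).sort = [a, b] := fun a b hab => by
    rw [Finset.sort_insert (· ≤ ·) (by simpa using hab.le) (by simpa using hab.ne),
      Finset.sort_singleton]
  have s3 : ({0, 1, 2} : Finset (Fin 3)).sort = [0, 1, 2] := by
    rw [Finset.sort_insert (· ≤ ·) (by simp) (by simp), s2 1 2 (by decide)]
  refine ⟨?_, ?_, ?_, ?_, ?_, ?_, ?_, ?_⟩ <;> simp [xiMonomial, s2, s3]

theorem sum_xiMonomial (hq : q ≠ 0) (c : Finset (Fin 3) → Sphere q r N) :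
    ∑ I, xiMonomial q r N I * fn q r N (c I) =
      ofCoord q r N (c ∅, ![c {0}, c {1}, c {2}], ![q • c {0, 1}, c {0, 2}, q • c {1, 2}],
        -q ^ 2 • c {0, 1, 2}) := by
  obtain ⟨e0, e1, e2, e3, e4, e5, e6, e7⟩ := xiMonomial_eq (q := q) (r := r) (N := N)
  rw [sum_finset_fin_three, e0, e1, e2, e3, e4, e5, e6, e7, ofCoord_apply, Fin.sum_univ_three,
    Fin.sum_univ_three]
  simp only [omega, vol, Matrix.cons_val_zero, Matrix.cons_val_one, Matrix.cons_val, map_smul,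
    mul_smul_comm, smul_mul_assoc, smul_smul, one_mul]
  rw [mul_inv_cancel₀ hq, neg_mul_neg, mul_inv_cancel₀ (pow_ne_zero 2 hq)]
  simp only [one_smul]

/-- The monomials `ξ_I` form a basis of the right module of forms. -/
theorem existsUnique_sum_xiMonomial
    (h : IsSphere q (Lam q r N) ((r : ℂ) ^ 2) (sphereCoord q r N) d d') (h2 : qNum q 2 ≠ 0)
    (h3 : qNum q 3 ≠ 0) (h4 : qNum (q ^ 2) 2 ≠ 0) (α : Forms q r N) :
    ∃! c : Finset (Fin 3) → Sphere q r N, α = ∑ I, xiMonomial q r N I * fn q r N (c I) := by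
  have hq := h.q_ne_zero
  have hq2 : -q ^ 2 ≠ 0 := neg_ne_zero.2 (pow_ne_zero 2 hq)
  obtain ⟨⟨a, v, w, b⟩, rfl⟩ := ofCoord_surjective (r := r) (N := N) hq h2 h3 h4 α
  simp only [sum_xiMonomial hq]
  refine ⟨fun I => if I = ∅ then a else if I = {0} then v 0 else if I = {1} then v 1 else
    if I = {2} then v 2 else if I = {0, 1} then q⁻¹ • w 0 else if I = {0, 2} then w 1 else
    if I = {1, 2} then q⁻¹ • w 2 else (-q ^ 2)⁻¹ • b, ?_, ?_⟩
  · refine congrArg _ (FormCoord.ext ?_ (fun k => ?_) (fun k => ?_) ?_)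
    · simp
    · fin_cases k <;> simp +decide
    · fin_cases k <;> simp +decide [smul_smul, hq]
    · simp +decide only [if_false, smul_smul, mul_inv_cancel₀ hq2, one_smul]
  · intro c hc
    have hc' := (h.ofCoord_bijective h3 h4 h2).1 hc
    simp only [Prod.mk.injEq] at hc'
    obtain ⟨rfl, rfl, rfl, rfl⟩ := hc'
    funext I
    have hI : ∀ I : Finset (Fin 3), I = ∅ ∨ I = {0} ∨ I = {1} ∨ I = {2} ∨ I = {0, 1} ∨
      I = {0, 2} ∨ I = {1, 2} ∨ I = {0, 1, 2} := by decide
    simp only [Matrix.cons_val_zero, Matrix.cons_val_one, Matrix.cons_val, smul_smul,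
      inv_mul_cancel₀ hq, inv_mul_cancel₀ hq2, one_smul]
    rcases hI I with rfl | rfl | rfl | rfl | rfl | rfl | rfl | rfl
    all_goals simp +decide only [if_false, if_true]

end

section

/-! ### The one-form `Θ` and its square -/

variable {q : ℂ} {r : ℝ} {N : ℕ} {d d' : Sphere q r N}

namespace IsSphere

theorem fn_mul_ofCoord (h : IsSphere q (Lam q r N) ((r : ℂ) ^ 2) (sphereCoord q r N) d d')
    (h2 : qNum q 2 ≠ 0) (h3 : qNum q 3 ≠ 0) (h4 : qNum (q ^ 2) 2 ≠ 0) (f : Sphere q r N)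
    (α : FormCoord (Sphere q r N)) :
    fn q r N f * ofCoord q r N α = ofCoord q r N (h.leftFn f α) := by
  refine h.toCoord_injective h3 h4 h2 ?_
  rw [toCoord_ofCoord, toCoord_apply, map_mul, Module.End.mul_apply, ← toCoord_apply,
    toCoord_ofCoord, rep_fn]

theorem ofCoord_single_xi (f : Sphere q r N) (k : Fin 3) :
    ofCoord q r N (0, Pi.single k f, 0, 0) = xi q r N k * fn q r N f := by
  rw [ofCoord_apply, Finset.sum_eq_single k (fun j _ hj => by simp [Pi.single_eq_of_ne hj])
    (by simp)]
  simp

theorem ofCoord_single_omega (f : Sphere q r N) (k : Fin 3) :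
    ofCoord q r N (0, 0, Pi.single k f, 0) = omega q r N k * fn q r N f := by
  rw [ofCoord_apply]
  simp only [map_zero, mul_zero, Pi.zero_apply, Finset.sum_const_zero, add_zero, zero_add]
  rw [Finset.sum_eq_single k (fun j _ hj => by simp [Pi.single_eq_of_ne hj]) (by simp),
    Pi.single_eq_same]

theorem fn_mul_xi_eq (h : IsSphere q (Lam q r N) ((r : ℂ) ^ 2) (sphereCoord q r N) d d')
    (h2 : qNum q 2 ≠ 0) (h3 : qNum q 3 ≠ 0) (h4 : qNum (q ^ 2) 2 ≠ 0) (f : Sphere q r N)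
    (j : Fin 3) :
    fn q r N f * xi q r N j = ∑ k, xi q r N k * fn q r N (h.braidHom f k j) := by
  have := h.fn_mul_ofCoord h2 h3 h4 f (0, Pi.single j 1, 0, 0)
  rw [ofCoord_single_xi, map_one, mul_one] at this
  rw [this, leftFn_apply, ofCoord_apply]
  simp

theorem fn_mul_omega (h : IsSphere q (Lam q r N) ((r : ℂ) ^ 2) (sphereCoord q r N) d d')
    (h2 : qNum q 2 ≠ 0) (h3 : qNum q 3 ≠ 0) (h4 : qNum (q ^ 2) 2 ≠ 0) (f : Sphere q r N)
    (j : Fin 3) :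
    fn q r N f * omega q r N j = ∑ k, omega q r N k * fn q r N (h.braidHom f k j) := by
  have := h.fn_mul_ofCoord h2 h3 h4 f (0, 0, Pi.single j 1, 0)
  rw [ofCoord_single_omega, map_one, mul_one] at this
  rw [this, leftFn_apply, ofCoord_apply]
  simp

theorem fn_mul_vol (h : IsSphere q (Lam q r N) ((r : ℂ) ^ 2) (sphereCoord q r N) d d')
    (h2 : qNum q 2 ≠ 0) (h3 : qNum q 3 ≠ 0) (h4 : qNum (q ^ 2) 2 ≠ 0) (f : Sphere q r N) :
    fn q r N f * vol q r N = vol q r N * fn q r N f := by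
  have := h.fn_mul_ofCoord h2 h3 h4 f (0, 0, 0, 1)
  rw [leftFn_apply, ofCoord_apply, ofCoord_apply] at this
  simpa using this

end IsSphere

theorem omega_mul_xi (hq : q ≠ 0) (h2 : qNum q 2 ≠ 0) (h3 : qNum q 3 ≠ 0)
    (h4 : qNum (q ^ 2) 2 ≠ 0) (n i : Fin 3) :
    omega q r N n * xi q r N i = g q n i • vol q r N := by
  have key : ∀ a b, xi q r N a * xi q r N b * xi q r N i =
      (∑ n, eps q n a b * g q n i) • vol q r N := by
    intro a b
    rw [mul_assoc, xi_mul_xi hq h2 h3 h4, Finset.mul_sum, ← g_eps_cyclic hq, Finset.sum_smul]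
    refine Finset.sum_congr rfl fun n _ => ?_
    rw [mul_smul_comm, xi_mul_omega hq h2 h3 h4, smul_smul, mul_comm]
  fin_cases n <;> simp [omega, key, Fin.sum_univ_three, eps, smul_smul, hq]

theorem eps_eps (hq : q ≠ 0) (i n : Fin 3) :
    ∑ j, ∑ k, eps q i j k * eps q n j k = if n = i then qNum (q ^ 2) 2 else 0 := by
  rw [qNum_two _ (pow_ne_zero 2 hq)]
  fin_cases i <;> fin_cases n <;> simp [eps, Fin.sum_univ_three]
  all_goals
    field_simp
    try ring

theorem starXi_eq (hq : q ≠ 0) (h2 : qNum q 2 ≠ 0) (h3 : qNum q 3 ≠ 0) (h4 : qNum (q ^ 2) 2 ≠ 0)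
    (i : Fin 3) : starXi q r N i = (-(q ^ 2)⁻¹ * Lam q r N) • omega q r N i := by
  have : ∑ j, ∑ k, eps q i j k • (xi q r N j * xi q r N k) =
      qNum (q ^ 2) 2 • omega q r N i := by
    simp only [xi_mul_xi hq h2 h3 h4, Finset.smul_sum, smul_smul]
    have e : ∀ j, ∑ k, ∑ n, (eps q i j k * eps q n j k) • omega q r N n =
      ∑ n, ∑ k, (eps q i j k * eps q n j k) • omega q r N n := fun j => Finset.sum_comm
    simp only [e]
    rw [Finset.sum_comm]
    simp only [← Finset.sum_smul, eps_eps hq, ite_smul, zero_smul]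
    simp
  rw [starXi, this, smul_smul]
  congr 1
  field_simp

variable (q r N) in
/-- The coordinate with raised index, `y^k = g^{kl} x_l`. -/
def dualCoord (k : Fin 3) : Sphere q r N := ∑ l, g q k l • sphereCoord q r N l

/-- `Θ` with functions moved to the right. -/
theorem Theta_eq (hq : q ≠ 0) (h3 : qNum q 3 ≠ 0) (h4 : qNum (q ^ 2) 2 ≠ 0) :
    Theta q r N = (q ^ 4)⁻¹ • ∑ k, xi q r N k * fn q r N (dualCoord q r N k) := by
  simp only [Theta, fn_mul_xi, dualCoord, map_sum, map_smul, Finset.mul_sum, mul_smul_comm,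
    Finset.smul_sum, smul_smul, ← g_Rhat hq h3 h4, Finset.sum_smul]
  have e : ∀ i, ∑ j, ∑ k, ∑ l, (g q i j * Rhat q k l i j) •
      (xi q r N k * fn q r N (sphereCoord q r N l)) = ∑ k, ∑ l, ∑ j, (g q i j * Rhat q k l i j) •
      (xi q r N k * fn q r N (sphereCoord q r N l)) := fun i => by
    rw [Finset.sum_comm]
    exact Finset.sum_congr rfl fun k _ => Finset.sum_comm
  simp only [e]
  rw [Finset.sum_comm]
  exact Finset.sum_congr rfl fun k _ => Finset.sum_comm

theorem sum_comm_three {ι M : Type*} [Fintype ι] [AddCommMonoid M] (F : ι → ι → ι → M) :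
    ∑ s, ∑ l, ∑ c, F s l c = ∑ c, ∑ s, ∑ l, F s l c :=
  (Finset.sum_congr rfl fun _ _ => Finset.sum_comm).trans Finset.sum_comm

theorem sum_g_eps_g_Rhat (hq : q ≠ 0) (h3 : qNum q 3 ≠ 0) (h4 : qNum (q ^ 2) 2 ≠ 0)
    {M : Type*} [AddCommGroup M] [Module ℂ M] (F : Fin 3 → Fin 3 → Fin 3 → M) :
    ∑ i, ∑ j, ∑ k, ∑ n, ∑ p, ∑ s, ∑ l,
      (g q i j * (eps q n j k * g q k l * Rhat q p s i n)) • F p s l =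
      ∑ p, ∑ s, ∑ l, (-(q ^ 2)⁻¹ * ∑ c, g q p c * eps q c s l) • F p s l := by
  have e2 : ∀ u : Fin 3 × Fin 3 × Fin 3, ∑ t : Fin 3 × Fin 3 × Fin 3 × Fin 3, g q t.1 t.2.1 *
      (eps q t.2.2.2 t.2.1 t.2.2.1 * g q t.2.2.1 u.2.2 * Rhat q u.1 u.2.1 t.1 t.2.2.2) =
      -(q ^ 2)⁻¹ * ∑ c, g q u.1 c * eps q c u.2.1 u.2.2 := by
    intro u
    rw [← g_eps_g_Rhat hq h3 h4]
    simp only [Fintype.sum_prod_type, mul_assoc]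
  have := Finset.sum_comm (s := Finset.univ) (t := Finset.univ)
    (f := fun (t : Fin 3 × Fin 3 × Fin 3 × Fin 3) (u : Fin 3 × Fin 3 × Fin 3) => (g q t.1 t.2.1 *
      (eps q t.2.2.2 t.2.1 t.2.2.1 * g q t.2.2.1 u.2.2 * Rhat q u.1 u.2.1 t.1 t.2.2.2)) •
        F u.1 u.2.1 u.2.2)
  simp only [← Finset.sum_smul, e2] at this
  simpa only [Fintype.sum_prod_type] using this

namespace IsSphere

/-- The operator `f ↦ x_m (L f L⁻¹)_{mk} g^{kl} x_l`. -/
def sandwich (h : IsSphere q (Lam q r N) ((r : ℂ) ^ 2) (sphereCoord q r N) d d')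
    (f : Sphere q r N) : Sphere q r N :=
  ∑ m, ∑ k, sphereCoord q r N m * h.braidHom f m k * dualCoord q r N k

theorem sandwich_one (h : IsSphere q (Lam q r N) ((r : ℂ) ^ 2) (sphereCoord q r N) d d') :
    h.sandwich 1 = ((r : ℂ) ^ 2) • 1 := by
  rw [← h.g_mul, sandwich]
  refine Finset.sum_congr rfl fun m _ => ?_
  rw [map_one, Finset.sum_eq_single m (fun k _ hk => by simp [Matrix.one_apply_ne hk.symm])
    (by simp), Matrix.one_apply_eq, mul_one, dualCoord, Finset.mul_sum]
  simp only [mul_smul_comm]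

/-- If `X_j Y_m = g_{jm} vol` and `f Y_k = Y_m (L f L⁻¹)_{mk}`, then `g^{ij} x_i X_j f Y_k y^k` is
the volume form times `sandwich f`. -/
theorem contract_eq (h : IsSphere q (Lam q r N) ((r : ℂ) ^ 2) (sphereCoord q r N) d d')
    (h2 : qNum q 2 ≠ 0) (h3 : qNum q 3 ≠ 0) (h4 : qNum (q ^ 2) 2 ≠ 0)
    {X Y : Fin 3 → Forms q r N} (hXY : ∀ j m, X j * Y m = g q j m • vol q r N)
    (hY : ∀ f j, fn q r N f * Y j = ∑ k, Y k * fn q r N (h.braidHom f k j)) (f : Sphere q r N) :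
    (∑ i, ∑ j, g q i j • (fn q r N (sphereCoord q r N i) * X j)) * fn q r N f *
      (∑ k, Y k * fn q r N (dualCoord q r N k)) = vol q r N * fn q r N (h.sandwich f) := by
  have hq := h.q_ne_zero
  obtain ⟨W, hW⟩ : ∃ W : Fin 3 → Forms q r N, ∀ m,
      vol q r N * ∑ k, fn q r N (h.braidHom f m k * dualCoord q r N k) = W m := ⟨_, fun _ => rfl⟩
  have e1 : ∀ j, X j * (fn q r N f * ∑ k, Y k * fn q r N (dualCoord q r N k)) =
      ∑ m, g q j m • W m := by
    intro j
    simp only [← hW, Finset.mul_sum, ← mul_assoc, map_mul]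
    simp only [mul_assoc (X j), hY, Finset.mul_sum, Finset.sum_mul]
    simp only [← mul_assoc, hXY, smul_mul_assoc, Finset.smul_sum]
    exact Finset.sum_comm
  have e3 : ∀ i m, fn q r N (sphereCoord q r N i) * W m =
      vol q r N * fn q r N (∑ k, sphereCoord q r N i * h.braidHom f m k * dualCoord q r N k) := by
    intro i m
    rw [← hW, ← mul_assoc, h.fn_mul_vol h2 h3 h4, mul_assoc, ← map_sum, ← map_mul, Finset.mul_sum]
    simp only [mul_assoc]
  have e2 : ∀ i, (∑ j, g q i j • (fn q r N (sphereCoord q r N i) * X j)) *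
      (fn q r N f * ∑ k, Y k * fn q r N (dualCoord q r N k)) =
      vol q r N * fn q r N (∑ k, sphereCoord q r N i * h.braidHom f i k * dualCoord q r N k) := by
    intro i
    simp only [Finset.sum_mul, smul_mul_assoc, mul_assoc (fn q r N _), e1]
    simp only [Finset.mul_sum, mul_smul_comm, Finset.smul_sum, smul_smul]
    rw [Finset.sum_comm]
    simp only [← Finset.sum_smul, g_mul_g hq, ite_smul, one_smul, zero_smul]
    rw [Finset.sum_ite_eq' Finset.univ i, if_pos (Finset.mem_univ i), e3]
  rw [mul_assoc, Finset.sum_mul, sandwich, map_sum]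
  exact (Finset.sum_congr rfl fun i _ => e2 i).trans (Finset.mul_sum _ _ _).symm

theorem Theta_mul_fn_mul (h : IsSphere q (Lam q r N) ((r : ℂ) ^ 2) (sphereCoord q r N) d d')
    (h2 : qNum q 2 ≠ 0) (h3 : qNum q 3 ≠ 0) (h4 : qNum (q ^ 2) 2 ≠ 0) (f : Sphere q r N) :
    Theta q r N * fn q r N f * (∑ k, omega q r N k * fn q r N (dualCoord q r N k)) =
      vol q r N * fn q r N (h.sandwich f) :=
  h.contract_eq h2 h3 h4 (xi_mul_omega h.q_ne_zero h2 h3 h4) (h.fn_mul_omega h2 h3 h4) f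

theorem mul_fn_mul_Theta (h : IsSphere q (Lam q r N) ((r : ℂ) ^ 2) (sphereCoord q r N) d d')
    (h2 : qNum q 2 ≠ 0) (h3 : qNum q 3 ≠ 0) (h4 : qNum (q ^ 2) 2 ≠ 0) (f : Sphere q r N) :
    (∑ i, ∑ j, g q i j • (fn q r N (sphereCoord q r N i) * omega q r N j)) * fn q r N f *
      Theta q r N = (q ^ 4)⁻¹ • (vol q r N * fn q r N (h.sandwich f)) := by
  rw [Theta_eq h.q_ne_zero h3 h4, mul_smul_comm,
    h.contract_eq h2 h3 h4 (omega_mul_xi h.q_ne_zero h2 h3 h4) (h.fn_mul_xi_eq h2 h3 h4) f]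

theorem fn_mul_xi_mul (h : IsSphere q (Lam q r N) ((r : ℂ) ^ 2) (sphereCoord q r N) d d')
    (h2 : qNum q 2 ≠ 0) (h3 : qNum q 3 ≠ 0) (h4 : qNum (q ^ 2) 2 ≠ 0) (i j k : Fin 3) :
    fn q r N (sphereCoord q r N i) * xi q r N j *
      (xi q r N k * fn q r N (dualCoord q r N k)) =
      ∑ n, ∑ p, ∑ s, ∑ l, (eps q n j k * g q k l * Rhat q p s i n) •
        (omega q r N p * fn q r N (sphereCoord q r N s * sphereCoord q r N l)) := by
  have hq := h.q_ne_zero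
  rw [mul_assoc, ← mul_assoc (xi q r N j), xi_mul_xi hq h2 h3 h4, Finset.sum_mul,
    Finset.mul_sum]
  refine Finset.sum_congr rfl fun n _ => ?_
  rw [smul_mul_assoc, mul_smul_comm, ← mul_assoc, h.fn_mul_omega h2 h3 h4, Finset.sum_mul,
    Finset.smul_sum]
  refine Finset.sum_congr rfl fun p _ => ?_
  rw [mul_assoc, ← map_mul, h.braidHom_x h3 h4, Matrix.of_apply, dualCoord, Finset.sum_mul_sum]
  simp only [map_sum, map_smul, Finset.mul_sum, Finset.smul_sum, smul_mul_assoc,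
    mul_smul_comm, smul_smul]
  refine Finset.sum_congr rfl fun s _ => Finset.sum_congr rfl fun l _ => ?_
  congr 1
  ring

theorem sum_g_eps_mul (h : IsSphere q (Lam q r N) ((r : ℂ) ^ 2) (sphereCoord q r N) d d')
    (p : Fin 3) : ∑ s, ∑ l, (∑ c, g q p c * eps q c s l) •
      (sphereCoord q r N s * sphereCoord q r N l) = Lam q r N • dualCoord q r N p := by
  simp only [dualCoord, Finset.smul_sum, smul_comm (Lam q r N), ← h.eps_mul, Finset.sum_smul,
    smul_smul]
  rw [sum_comm_three]

/-- `Θ²` is the Hodge dual of `Θ`. -/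
theorem Theta_mul_Theta (h : IsSphere q (Lam q r N) ((r : ℂ) ^ 2) (sphereCoord q r N) d d')
    (h2 : qNum q 2 ≠ 0) (h3 : qNum q 3 ≠ 0) (h4 : qNum (q ^ 2) 2 ≠ 0) :
    Theta q r N * Theta q r N = (-(q ^ 2)⁻¹ * Lam q r N * (q ^ 4)⁻¹) •
      ∑ k, omega q r N k * fn q r N (dualCoord q r N k) := by
  have hq := h.q_ne_zero
  have e1 : Theta q r N * ∑ k, xi q r N k * fn q r N (dualCoord q r N k) =
      ∑ i, ∑ j, ∑ k, ∑ n, ∑ p, ∑ s, ∑ l,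
        (g q i j * (eps q n j k * g q k l * Rhat q p s i n)) •
          (omega q r N p * fn q r N (sphereCoord q r N s * sphereCoord q r N l)) := by
    rw [Theta, Finset.sum_mul]
    refine Finset.sum_congr rfl fun i _ => ?_
    rw [Finset.sum_mul]
    refine Finset.sum_congr rfl fun j _ => ?_
    rw [Finset.mul_sum]
    refine Finset.sum_congr rfl fun k _ => ?_
    rw [smul_mul_assoc, h.fn_mul_xi_mul h2 h3 h4]
    simp only [Finset.smul_sum, smul_smul]
  have e2 : ∀ p, ∑ s, ∑ l, (-(q ^ 2)⁻¹ * ∑ c, g q p c * eps q c s l) •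
      (omega q r N p * fn q r N (sphereCoord q r N s * sphereCoord q r N l)) =
      (-(q ^ 2)⁻¹ * Lam q r N) • (omega q r N p * fn q r N (dualCoord q r N p)) := by
    intro p
    rw [mul_smul, ← mul_smul_comm, ← map_smul, ← h.sum_g_eps_mul]
    simp only [map_sum, map_smul, Finset.mul_sum, mul_smul_comm, Finset.smul_sum, smul_smul]
  have e3 : Theta q r N * Theta q r N =
      (q ^ 4)⁻¹ • (Theta q r N * ∑ k, xi q r N k * fn q r N (dualCoord q r N k)) := by
    rw [← mul_smul_comm, ← Theta_eq hq h3 h4]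
  rw [e3, e1, sum_g_eps_g_Rhat hq h3 h4 fun p s l =>
    omega q r N p * fn q r N (sphereCoord q r N s * sphereCoord q r N l), mul_comm _ (q ^ 4)⁻¹,
    mul_smul, Finset.sum_congr rfl fun p _ => e2 p, ← Finset.smul_sum]

end IsSphere

end

section

/-! ### The Hodge star and the Laplacian -/

variable {q : ℂ} {r : ℝ} {N : ℕ} {d d' : Sphere q r N}

theorem commutator_commutator_sq {R : Type*} [Ring R] (t f : R) :
    t * (t * t * f - f * (t * t)) - (t * t * f - f * (t * t)) * t =
      t * (t * t) * f + f * (t * (t * t)) - (t * f * (t * t) + t * t * f * t) := by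
  noncomm_ring

namespace IsSphere

theorem Theta_pow_three (h : IsSphere q (Lam q r N) ((r : ℂ) ^ 2) (sphereCoord q r N) d d')
    (h2 : qNum q 2 ≠ 0) (h3 : qNum q 3 ≠ 0) (h4 : qNum (q ^ 2) 2 ≠ 0) :
    Theta q r N ^ 3 = (-(q ^ 2)⁻¹ * Lam q r N * (q ^ 4)⁻¹ * (r : ℂ) ^ 2) • vol q r N := by
  have := h.Theta_mul_fn_mul h2 h3 h4 1
  rw [map_one, mul_one, h.sandwich_one, map_smul, map_one, mul_smul_comm, mul_one] at this
  rw [pow_succ', sq, h.Theta_mul_Theta h2 h3 h4, mul_smul_comm, this, smul_smul]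

end IsSphere

/-- The Hodge star in coordinates exchanges `1` with a multiple of `vol` and `ξ_i` with a multiple
of `ω_i`, up to the scalars `μ` and `ν` given by `∗ξ_i = μ ω_i` and `∗1 = ν vol`. -/
def coordStar {A : Type*} [Ring A] [Algebra ℂ A] (μ ν : ℂ) : FormCoord A →ₗ[ℂ] FormCoord A where
  toFun α := (ν⁻¹ • α.2.2.2, μ⁻¹ • α.2.2.1, μ • α.2.1, ν • α.1)
  map_add' α β := by
    simp only [Prod.fst_add, Prod.snd_add, smul_add, Prod.mk_add_mk]
  map_smul' c α := by
    simp only [Prod.smul_fst, Prod.smul_snd, smul_comm _ c, Prod.smul_mk, RingHom.id_apply]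

theorem coordStar_apply {A : Type*} [Ring A] [Algebra ℂ A] (μ ν : ℂ) (a b : A)
    (v w : Fin 3 → A) :
    coordStar μ ν (a, v, w, b) = (ν⁻¹ • b, μ⁻¹ • w, μ • v, ν • a) := rfl

theorem coordStar_coordStar {A : Type*} [Ring A] [Algebra ℂ A] {μ ν : ℂ} (hμ : μ ≠ 0)
    (hν : ν ≠ 0) (α : FormCoord A) : coordStar μ ν (coordStar μ ν α) = α := by
  obtain ⟨a, v, w, b⟩ := α
  simp only [coordStar_apply, smul_smul, inv_mul_cancel₀ hμ, inv_mul_cancel₀ hν,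
    mul_inv_cancel₀ hμ, mul_inv_cancel₀ hν, one_smul]

theorem IsSphere.coordStar_leftFn {A : Type*} [Ring A] [Algebra ℂ A] {Λ ρ : ℂ} {x : Fin 3 → A}
    {d d' : A} (h : IsSphere q Λ ρ x d d') (μ ν : ℂ) (f : A) (α : FormCoord A) :
    coordStar μ ν (h.leftFn f α) = h.leftFn f (coordStar μ ν α) := by
  obtain ⟨a, v, w, b⟩ := α
  simp only [coordStar_apply, leftFn_apply, mul_smul_comm, Matrix.mulVec_smul]

namespace IsSphere

/-- There is a Hodge star. -/
theorem exists_isHodgeStar (h : IsSphere q (Lam q r N) ((r : ℂ) ^ 2) (sphereCoord q r N) d d')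
    (h2 : qNum q 2 ≠ 0) (h3 : qNum q 3 ≠ 0) (h4 : qNum (q ^ 2) 2 ≠ 0) (hr : r ≠ 0)
    (hΛ : Lam q r N ≠ 0) : ∃ star, IsHodgeStar q r N star := by
  have hq := h.q_ne_zero
  obtain ⟨μ, hμ⟩ : ∃ μ, μ = -(q ^ 2)⁻¹ * Lam q r N := ⟨_, rfl⟩
  obtain ⟨ν, hν⟩ : ∃ ν, ν = μ * (q ^ 4)⁻¹ * (r : ℂ) ^ 2 := ⟨_, rfl⟩
  have hr' : (r : ℂ) ≠ 0 := Complex.ofReal_ne_zero.2 hr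
  have hμ0 : μ ≠ 0 := by rw [hμ]; exact mul_ne_zero (neg_ne_zero.2 (by positivity)) hΛ
  have hν0 : ν ≠ 0 := by
    rw [hν]
    exact mul_ne_zero (mul_ne_zero hμ0 (by positivity)) (by positivity)
  have key : ∀ α, (ofCoord q r N ∘ₗ coordStar μ ν ∘ₗ h.toCoord h3 h4) (ofCoord q r N α) =
      ofCoord q r N (coordStar μ ν α) := fun α => by
    rw [LinearMap.comp_apply, LinearMap.comp_apply, toCoord_ofCoord]
  have surj := ofCoord_surjective (r := r) (N := N) hq h2 h3 h4
  refine ⟨ofCoord q r N ∘ₗ coordStar μ ν ∘ₗ h.toCoord h3 h4, fun f α => ?_, fun f α => ?_,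
    fun i => ?_, ?_, fun α => ?_⟩
  · obtain ⟨α, rfl⟩ := surj α
    rw [h.fn_mul_ofCoord h2 h3 h4, key, key, h.coordStar_leftFn, h.fn_mul_ofCoord h2 h3 h4]
  · obtain ⟨⟨a, v, w, b⟩, rfl⟩ := surj α
    rw [ofCoord_mul_fn, key, key, ofCoord_mul_fn]
    simp only [coordStar_apply, smul_mul_assoc, Pi.smul_apply]
    rfl
  · have := key (0, Pi.single i 1, 0, 0)
    rw [ofCoord_single_xi, map_one, mul_one] at this
    rw [this, coordStar_apply, starXi_eq hq h2 h3 h4, ← hμ, smul_zero, smul_zero, smul_zero,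
      ← Pi.single_smul, ofCoord_single_omega, map_smul, map_one, mul_smul_comm, mul_one]
  · have := key (1, 0, 0, 0)
    rw [ofCoord_apply, coordStar_apply, ofCoord_apply] at this
    rw [h.Theta_pow_three h2 h3 h4, ← hμ, ← hν]
    simpa using this
  · obtain ⟨α, rfl⟩ := surj α
    rw [key, key, coordStar_coordStar hμ0 hν0]

/-- A Hodge star is determined by its defining properties, since `1`, `ξ_i`, `∗ξ_i` and `Θ³`
generate the forms as a right module. -/
theorem isHodgeStar_unique (h : IsSphere q (Lam q r N) ((r : ℂ) ^ 2) (sphereCoord q r N) d d')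
    (h2 : qNum q 2 ≠ 0) (h3 : qNum q 3 ≠ 0) (h4 : qNum (q ^ 2) 2 ≠ 0) (hr : r ≠ 0)
    (hΛ : Lam q r N ≠ 0) {star star' : Forms q r N →ₗ[ℂ] Forms q r N}
    (hs : IsHodgeStar q r N star) (hs' : IsHodgeStar q r N star') : star' = star := by
  have hq := h.q_ne_zero
  have hr' : (r : ℂ) ≠ 0 := Complex.ofReal_ne_zero.2 hr
  have hμ0 : -(q ^ 2)⁻¹ * Lam q r N ≠ 0 := mul_ne_zero (neg_ne_zero.2 (by positivity)) hΛ
  have hν0 : -(q ^ 2)⁻¹ * Lam q r N * (q ^ 4)⁻¹ * (r : ℂ) ^ 2 ≠ 0 :=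
    mul_ne_zero (mul_ne_zero hμ0 (by positivity)) (by positivity)
  have one : star' 1 = star 1 := hs'.star_one.trans hs.star_one.symm
  have xi' : ∀ i, star' (xi q r N i) = star (xi q r N i) := fun i =>
    (hs'.star_xi i).trans (hs.star_xi i).symm
  have omega' : ∀ i, star' (omega q r N i) = star (omega q r N i) := fun i => by
    have e : omega q r N i = (-(q ^ 2)⁻¹ * Lam q r N)⁻¹ • starXi q r N i := by
      rw [starXi_eq hq h2 h3 h4, smul_smul, inv_mul_cancel₀ hμ0, one_smul]
    rw [e, map_smul, map_smul, ← hs.star_xi, hs.star_star, hs.star_xi, ← hs'.star_xi,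
      hs'.star_star]
  have vol' : star' (vol q r N) = star (vol q r N) := by
    have e : vol q r N =
        (-(q ^ 2)⁻¹ * Lam q r N * (q ^ 4)⁻¹ * (r : ℂ) ^ 2)⁻¹ • Theta q r N ^ 3 := by
      rw [h.Theta_pow_three h2 h3 h4, smul_smul, inv_mul_cancel₀ hν0, one_smul]
    rw [e, map_smul, map_smul, ← hs.star_one, hs.star_star, hs.star_one, ← hs'.star_one,
      hs'.star_star]
  refine LinearMap.ext fun α => ?_
  obtain ⟨⟨a, v, w, b⟩, rfl⟩ := ofCoord_surjective hq h2 h3 h4 α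
  rw [ofCoord_apply, ← one_mul (fn q r N a)]
  simp only [map_add, map_sum, hs.right_linear, hs'.right_linear, one, xi', omega', vol']

/-- On functions, the Laplacian is `ψ ↦ 2 (ψ - r⁻² sandwich ψ)`. -/
theorem laplacian_eq (h : IsSphere q (Lam q r N) ((r : ℂ) ^ 2) (sphereCoord q r N) d d')
    (h2 : qNum q 2 ≠ 0) (h3 : qNum q 3 ≠ 0) (h4 : qNum (q ^ 2) 2 ≠ 0) (hr : r ≠ 0)
    {star : Forms q r N →ₗ[ℂ] Forms q r N} (hs : IsHodgeStar q r N star) (ψ : Sphere q r N) :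
    laplacian q r N star ψ =
      fn q r N ((2 * ((r : ℂ) ^ 2)⁻¹) • (((r : ℂ) ^ 2) • ψ - h.sandwich ψ)) := by
  have hq := h.q_ne_zero
  have hr' : (r : ℂ) ^ 2 ≠ 0 := pow_ne_zero 2 (Complex.ofReal_ne_zero.2 hr)
  obtain ⟨μ, hμ⟩ : ∃ μ, μ = -(q ^ 2)⁻¹ * Lam q r N := ⟨_, rfl⟩
  have xi' : ∀ i, star (xi q r N i) = μ • omega q r N i := fun i => by
    rw [hs.star_xi, starXi_eq hq h2 h3 h4, hμ]
  have hT2 := h.Theta_mul_Theta h2 h3 h4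
  have hT3 := h.Theta_pow_three h2 h3 h4
  rw [← hμ] at hT2 hT3
  have star_Theta : star (Theta q r N) = Theta q r N * Theta q r N := by
    rw [hT2, Theta_eq hq h3 h4, map_smul, map_sum]
    simp only [hs.right_linear, xi', smul_mul_assoc]
    rw [← Finset.smul_sum, smul_smul, mul_comm μ]
  have star_Theta' : star (Theta q r N) =
      μ • ∑ i, ∑ j, g q i j • (fn q r N (sphereCoord q r N i) * omega q r N j) := by
    simp only [Theta, map_sum, map_smul, hs.left_linear, xi', mul_smul_comm, Finset.smul_sum,
      smul_comm μ]
  have T3 : Theta q r N ^ 3 = Theta q r N * (Theta q r N * Theta q r N) := by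
    rw [pow_succ', sq]
  have star_T3 : star (Theta q r N ^ 3) = 1 := by rw [← hs.star_one, hs.star_star]
  have vol_mul : (μ * (q ^ 4)⁻¹) • (vol q r N * fn q r N (h.sandwich ψ)) =
      ((r : ℂ) ^ 2)⁻¹ • (Theta q r N ^ 3 * fn q r N (h.sandwich ψ)) := by
    rw [hT3, smul_mul_assoc, smul_smul]
    congr 1
    rw [mul_comm _ ((r : ℂ) ^ 2), inv_mul_cancel_left₀ hr']
  have e1 : Theta q r N * fn q r N ψ * (Theta q r N * Theta q r N) =
      ((r : ℂ) ^ 2)⁻¹ • (Theta q r N ^ 3 * fn q r N (h.sandwich ψ)) := by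
    rw [hT2, mul_smul_comm, h.Theta_mul_fn_mul h2 h3 h4, vol_mul]
  have e2 : Theta q r N * Theta q r N * fn q r N ψ * Theta q r N =
      ((r : ℂ) ^ 2)⁻¹ • (Theta q r N ^ 3 * fn q r N (h.sandwich ψ)) := by
    rw [← star_Theta, star_Theta', smul_mul_assoc, smul_mul_assoc, h.mul_fn_mul_Theta h2 h3 h4,
      smul_smul, vol_mul]
  have e3 : extD q r N star 2 (star (extD q r N star 0 (fn q r N ψ))) =
      Theta q r N ^ 3 * fn q r N ψ + fn q r N ψ * Theta q r N ^ 3 -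
        (2 * ((r : ℂ) ^ 2)⁻¹) • (Theta q r N ^ 3 * fn q r N (h.sandwich ψ)) := by
    rw [two_mul, add_smul]
    nth_rewrite 1 [← e1]
    rw [← e2, T3, extD, extD, map_sub, hs.left_linear, hs.right_linear, star_Theta]
    exact commutator_commutator_sq _ _
  rw [laplacian, e3, map_sub, map_add, map_smul, hs.left_linear, hs.right_linear,
    hs.right_linear, star_T3, one_mul, one_mul, mul_one, map_smul, map_sub, map_smul, smul_sub,
    smul_smul, mul_assoc, inv_mul_cancel₀ hr', mul_one, two_smul]

end IsSphere

end

/-! ### Integer q-numbers -/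

/-- The q-number `[n]_q` of an integer, with `[-n]_q = -[n]_q`. -/
def qInt (q : ℂ) : ℤ → ℂ
  | Int.ofNat n => qNum q n
  | Int.negSucc n => -qNum q (n + 1)

theorem qInt_natCast (q : ℂ) (n : ℕ) : qInt q n = qNum q n := rfl

theorem qInt_zero (q : ℂ) : qInt q 0 = 0 := qNum_zero q

theorem qInt_one (q : ℂ) : qInt q 1 = 1 := by
  change qNum q 1 = 1
  simp [qNum]

theorem qInt_neg (q : ℂ) (w : ℤ) : qInt q (-w) = -qInt q w := by
  rcases w with n | n
  · rcases n with _ | n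
    · change qNum q 0 = -qNum q 0
      simp [qNum_zero]
    · rfl
  · exact (neg_neg _).symm

theorem qNum_succ' (q : ℂ) (hq : q ≠ 0) (n : ℕ) : qNum q (n + 1) = q⁻¹ * qNum q n + q ^ n := by
  have h := qNum_mul q hq n
  rw [zpow_neg, zpow_natCast] at h
  rw [qNum_succ q hq]
  linear_combination h

theorem qInt_add_one (q : ℂ) (hq : q ≠ 0) (w : ℤ) :
    qInt q (w + 1) = q * qInt q w + q ^ (-w) := by
  obtain ⟨n, rfl | rfl⟩ := w.eq_nat_or_neg
  · rw [zpow_neg, zpow_natCast]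
    exact qNum_succ q hq n
  · rcases n with _ | n
    · simp [qInt_zero, qInt_one]
    · have e : (-((n + 1 : ℕ) : ℤ) + 1) = -(n : ℤ) := by push_cast; ring
      rw [e, qInt_neg, qInt_neg, qInt_natCast, qInt_natCast, qNum_succ' q hq, neg_neg,
        zpow_natCast, pow_succ]
      field_simp
      ring

theorem qInt_add (q : ℂ) (hq : q ≠ 0) (a b : ℤ) :
    qInt q (a + b) = q ^ b * qInt q a + q ^ (-a) * qInt q b := by
  induction b using Int.induction_on with
  | zero => simp [qInt_zero]
  | succ n ih =>
    rw [← add_assoc, qInt_add_one q hq, ih, qInt_add_one q hq, zpow_add_one₀ hq, neg_add,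
      zpow_add₀ hq (-a)]
    ring
  | pred n ih =>
    have h1 := qInt_add_one q hq (a + (-(n : ℤ) - 1))
    have h2 := qInt_add_one q hq (-(n : ℤ) - 1)
    rw [show a + (-(n : ℤ) - 1) + 1 = a + -(n : ℤ) by ring, ih] at h1
    rw [show -(n : ℤ) - 1 + 1 = -(n : ℤ) by ring] at h2
    rw [h2, show -(a + (-(n : ℤ) - 1)) = -a + -(-(n : ℤ) - 1) by ring, zpow_add₀ hq (-a)] at h1
    rw [zpow_sub_one₀ hq]
    refine mul_left_cancel₀ hq ?_
    linear_combination (-1 : ℂ) * h1 - q ^ (-(n : ℤ)) * qInt q a * (mul_inv_cancel₀ hq)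

theorem qInt_mul (q : ℂ) (hq : q ≠ 0) (w : ℤ) :
    qInt q w * (q - q⁻¹) = q ^ w - q ^ (-w) := by
  obtain ⟨n, rfl | rfl⟩ := w.eq_nat_or_neg
  · exact qNum_mul q hq n
  · rw [qInt_neg, qInt_natCast, neg_mul, qNum_mul q hq, neg_neg]
    ring

/-- `[a + n][a + n + 1] - [a][a + 1] = [n][2 a + n + 1]`. -/
theorem qInt_mul_sub_mul (q : ℂ) (hq : q ≠ 0) (a n : ℤ) :
    qInt q (a + n) * qInt q (a + n + 1) - qInt q a * qInt q (a + 1) =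
      qInt q n * qInt q (2 * a + n + 1) := by
  have h1 := qInt_mul q hq a
  have h2 := qInt_mul q hq n
  rw [show 2 * a + n + 1 = a + (a + n) + 1 by ring, qInt_add_one q hq, qInt_add_one q hq,
    qInt_add_one q hq, qInt_add q hq a (a + n), qInt_add q hq a n]
  simp only [neg_add, zpow_add₀ hq, zpow_neg] at *
  have hu := zpow_ne_zero a hq
  have hv := zpow_ne_zero n hq
  generalize q ^ a = u at *
  generalize q ^ n = v at *
  generalize qInt q a = A at *
  generalize qInt q n = B at *
  field_simp at h1 h2 ⊢
  grind

section

namespace IsSphere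

/-! ### The invariant operator on weight vectors -/

variable {A : Type*} [Ring A] [Algebra ℂ A] {q Λ ρ : ℂ} {x : Fin 3 → A} {d d' : A}

theorem d_mul_zero_mul_inv (h : IsSphere q Λ ρ x d d') : d * x 0 * d' = q ^ 2 • x 0 := by
  rw [h.d_mul_zero, smul_mul_assoc, mul_assoc, h.mul_inv, mul_one]

theorem inv_mul_zero_mul_d (h : IsSphere q Λ ρ x d d') : d' * x 0 * d = (q ^ 2)⁻¹ • x 0 := by
  rw [h.inv_mul_zero, smul_mul_assoc, mul_assoc, h.inv_mul, mul_one]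

theorem inv_mul_two_mul_d (h : IsSphere q Λ ρ x d d') : d' * x 2 * d = q ^ 2 • x 2 := by
  rw [mul_assoc, h.two_mul_d, mul_smul_comm, ← mul_assoc, h.inv_mul, one_mul]

theorem d_mul_two_mul_inv (h : IsSphere q Λ ρ x d d') : d * x 2 * d' = (q ^ 2)⁻¹ • x 2 := by
  rw [mul_assoc, h.two_mul_inv, mul_smul_comm, ← mul_assoc, h.mul_inv, one_mul]

/-- If `f` satisfies `[x_0, f] = -β f d` (where `0` is the weight), then `d` and `f` commute up to
the factor `1 + (q - q⁻¹) β`. For `f` of weight `w` one has `β = q^w [w]`, and the factor is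
`q^{2w}`. -/
theorem d_mul_of_weight (h : IsSphere q Λ ρ x d d') {f : A} {β : ℂ}
    (hf : x 1 * f = f * x 1 - β • (f * d)) : d * f = (1 + (q - q⁻¹) * β) • (f * d) := by
  have e : d * f = Λ • f - (q - q⁻¹) • (x 1 * f) := by
    rw [h.d_eq, sub_mul, smul_mul_assoc, smul_mul_assoc, one_mul]
  have e' : f * d = Λ • f - (q - q⁻¹) • (f * x 1) := by
    rw [h.d_eq, mul_sub, mul_smul_comm, mul_smul_comm, mul_one]
  rw [e, hf, add_smul, one_smul, smul_sub, mul_smul]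
  nth_rewrite 2 [e']
  abel

/-- The part of the eigenvalue identity that involves only functions of `x_0`. -/
theorem diagonal_identity (h : IsSphere q Λ ρ x d d') {f : A} {β : ℂ}
    (hf : x 1 * f = f * x 1 - β • (f * d)) :
    (q + q⁻¹) • (ρ • (d * f * d) - (Λ • x 1 - ((q - q⁻¹) * ρ) • 1) * f *
        (Λ • x 1 - ((q - q⁻¹) * ρ) • 1)) =
      (Λ ^ 2 - (q - q⁻¹) ^ 2 * ρ) • (-(q⁻¹ • ((x 1 * x 1 - q • (x 1 * d) - ρ • (1 : A)) * f))
        - q • (f * (x 1 * x 1 + q⁻¹ • (x 1 * d) - ρ • (1 : A)))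
        + (q * β ^ 2 + β) • (f * d * d)) := by
  have hq := h.q_ne_zero
  have hd := h.d_mul_of_weight hf
  simp only [mul_sub, mul_add, sub_mul, mul_smul_comm, smul_mul_assoc, mul_one, one_mul,
    mul_assoc (x 1), hf, hd]
  simp only [← mul_assoc, hf, hd, mul_sub, mul_add, sub_mul, mul_smul_comm, smul_mul_assoc,
    mul_one, one_mul]
  simp only [h.d_eq, mul_sub, mul_add, sub_mul, mul_smul_comm, smul_mul_assoc, mul_one, one_mul,
    ← mul_assoc, hf]
  match_scalars <;> field_simp <;> ring

/-- The operator `ρ - x_m (L f L⁻¹)_{mk} g^{kl} x_l` in terms of commutators with `x_1` and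
`x_{-1}`. Multiplication by `d` from both sides clears the inverses. -/
theorem sub_sandwich (h : IsSphere q Λ ρ x d d') {f : A} {β : ℂ}
    (hf : x 1 * f = f * x 1 - β • (f * d)) :
    (q + q⁻¹) • (d * (ρ • f - ∑ m, ∑ k, x m * h.braidHom f m k * ∑ l, g q k l • x l) * d) =
      (Λ ^ 2 - (q - q⁻¹) ^ 2 * ρ) • (-((q + q⁻¹) • (q⁻¹ • (x 2 * (x 0 * f - f * x 0))
        - q • ((x 0 * f - f * x 0) * x 2))) + (q * β ^ 2 + β) • (f * d * d)) := by
  have hq := h.q_ne_zero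
  obtain ⟨e, he⟩ : ∃ e, e = Λ • x 1 - ((q - q⁻¹) * ρ) • (1 : A) := ⟨_, rfl⟩
  have hed : d * e * d' = e := by
    rw [he, mul_sub, sub_mul, mul_smul_comm, mul_smul_comm, smul_mul_assoc, smul_mul_assoc,
      mul_one, h.mul_inv, h.d_mul_one, mul_assoc, h.mul_inv, mul_one]
  have hed' : e * d' * d = e := by rw [mul_assoc, h.inv_mul, mul_one]
  have t1 : d * (x 0 * d' * f * (d' * x 2)) * d = q ^ 4 • (x 0 * f * x 2) := by
    calc _ = (d * x 0 * d') * f * (d' * x 2 * d) := by simp only [mul_assoc]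
      _ = _ := by
        rw [h.d_mul_zero_mul_inv, h.inv_mul_two_mul_d, smul_mul_assoc, smul_mul_smul_comm,
          ← pow_add]
  have t2 : d * (e * d' * f * (e * d')) * d = e * f * e := by
    calc _ = (d * e * d') * f * (e * d' * d) := by simp only [mul_assoc]
      _ = _ := by rw [hed, hed']
  have t3 : d * (x 2 * d' * f * (d' * x 0)) * d = (q ^ 4)⁻¹ • (x 2 * f * x 0) := by
    calc _ = (d * x 2 * d') * f * (d' * x 0 * d) := by simp only [mul_assoc]
      _ = _ := by
        rw [h.d_mul_two_mul_inv, h.inv_mul_zero_mul_d, smul_mul_assoc, smul_mul_smul_comm,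
          ← _root_.mul_inv, ← pow_add]
  have key := h.diagonal_identity hf
  rw [← h.zero_mul_two, ← h.two_mul_zero', ← he] at key
  rw [h.sandwich_eq, ← he]
  simp only [mul_sub, sub_mul, mul_add, add_mul, mul_smul_comm, smul_mul_assoc, mul_neg, neg_mul,
    t1, t2, t3] at key ⊢
  simp only [← mul_assoc] at key ⊢
  linear_combination (norm := skip) key
  match_scalars <;> field_simp <;> ring

end IsSphere

end

section

/-! ### Matrix elements of the generators -/

theorem sectorMatrix_apply (N : ℕ) (T : Module.End ℂ Fock) (a b : Fin (N + 1)) :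
    sectorMatrix N T a b = T (Finsupp.single ((b : ℕ), N - (b : ℕ)) 1) ((a : ℕ), N - (a : ℕ)) :=
  rfl

theorem single_sub_one_apply {N : ℕ} (a b : Fin (N + 1)) (v : ℂ) (hv : (b : ℕ) = 0 → v = 0) :
    (Finsupp.single ((b : ℕ) - 1, N - (b : ℕ) + 1) v : Fock) ((a : ℕ), N - (a : ℕ)) =
      if (b : ℤ) - a = 1 then v else 0 := by
  have ha := a.2
  have hb := b.2
  simp only [Finsupp.single_apply, Prod.mk.injEq]
  by_cases h : (b : ℤ) - a = 1
  · rw [if_pos h, if_pos (by omega)]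
  · rw [if_neg h]
    by_cases h0 : (b : ℕ) = 0
    · rw [hv h0, ite_self]
    · rw [if_neg (by omega)]

theorem single_add_one_apply {N : ℕ} (a b : Fin (N + 1)) (v : ℂ) (hv : N - (b : ℕ) = 0 → v = 0) :
    (Finsupp.single ((b : ℕ) + 1, N - (b : ℕ) - 1) v : Fock) ((a : ℕ), N - (a : ℕ)) =
      if (b : ℤ) - a = -1 then v else 0 := by
  have ha := a.2
  have hb := b.2
  simp only [Finsupp.single_apply, Prod.mk.injEq]
  by_cases h : (b : ℤ) - a = -1
  · rw [if_pos h, if_pos (by omega)]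
  · rw [if_neg h]
    by_cases h0 : N - (b : ℕ) = 0
    · rw [hv h0, ite_self]
    · rw [if_neg (by omega)]

theorem single_self_apply {N : ℕ} (a b : Fin (N + 1)) (v : ℂ) :
    (Finsupp.single ((b : ℕ), N - (b : ℕ)) v : Fock) ((a : ℕ), N - (a : ℕ)) =
      if a = b then v else 0 := by
  simp only [Finsupp.single_apply, Prod.mk.injEq]
  by_cases h : a = b
  · rw [if_pos h, if_pos (by rw [h]; exact ⟨rfl, rfl⟩)]
  · rw [if_neg h, if_neg (fun h' => h (Fin.ext h'.1.symm))]

theorem cast_sub_fin {N : ℕ} (b : Fin (N + 1)) : ((N - (b : ℕ) : ℕ) : ℤ) = N - (b : ℕ) := by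
  have := b.2
  omega

theorem repQH_eq (q : ℂ) (N : ℕ) (a : ℤ) :
    repQH q N a =
      Matrix.diagonal fun b : Fin (N + 1) => csqrt q ^ (a * ((N : ℤ) - 2 * (b : ℕ))) := by
  refine Matrix.ext fun i j => ?_
  rw [repQH, sectorMatrix_apply, fockQH_single, single_self_apply, Matrix.diagonal_apply,
    cast_sub_fin]
  by_cases h : i = j
  · rw [if_pos h, if_pos h, h, one_mul]
    congr 2
    ring
  · rw [if_neg h, if_neg h]

theorem repH_eq (N : ℕ) : repH N =
    Matrix.diagonal fun b : Fin (N + 1) => (((N : ℤ) - 2 * (b : ℕ) : ℤ) : ℂ) := by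
  refine Matrix.ext fun i j => ?_
  rw [repH, sectorMatrix_apply, fockH, Finsupp.linearCombination_single, one_smul,
    single_self_apply, Matrix.diagonal_apply]
  by_cases h : i = j
  · rw [if_pos h, if_pos h, h]
    have := cast_sub_fin j
    have e : ((N - (j : ℕ) : ℕ) : ℂ) = (N : ℂ) - (j : ℕ) := by
      exact_mod_cast congrArg (Int.cast (R := ℂ)) this
    rw [e]
    push_cast
    ring
  · rw [if_neg h, if_neg h]

variable (q : ℂ) (r : ℝ) (N : ℕ)

theorem repXp_apply (a b : Fin (N + 1)) : repXp q N a b = if (b : ℤ) - a = 1 then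
    -(q * csqrt q ^ ((N : ℤ) - 2 * (b : ℕ) + 1)) * qNum q b else 0 := by
  rw [repXp, sectorMatrix_apply, fockXp_single, single_sub_one_apply, one_mul, cast_sub_fin]
  · congr 5
    ring
  · intro h
    rw [h, qNum_zero, mul_zero, mul_zero]

theorem repXm_apply (a b : Fin (N + 1)) : repXm q N a b = if (b : ℤ) - a = -1 then
    -(q⁻¹ * csqrt q ^ (2 * (b : ℕ) - (N : ℤ) + 1)) * qNum q (N - b) else 0 := by
  rw [repXm, sectorMatrix_apply, fockXm_single, single_add_one_apply, one_mul, cast_sub_fin]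
  · congr 5
    ring
  · intro h
    rw [h, qNum_zero, mul_zero, mul_zero]

theorem coord_zero_apply (hq : q ≠ 0) (a b : Fin (N + 1)) : coord q r N 0 a b =
    if (b : ℤ) - a = 1 then -(r * q ^ (N + 2) / (csqrt (qNum q 2) * csqrt (casimirC q N)) *
      (csqrt q * q ^ (-2 * (b : ℤ)) * qNum q b)) else 0 := by
  rw [coord, Matrix.smul_apply, sectorMatrix_apply, Zhat_zero_single, single_sub_one_apply]
  · rw [smul_ite, smul_zero]
    refine if_ctx_congr Iff.rfl (fun h => ?_) (fun _ => rfl)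
    have e : (((b : ℕ) - 1 : ℕ) : ℤ) = b - 1 := by omega
    have e' : q ^ (-2 * (b : ℤ)) = q ^ (-(b : ℤ) - 1) * q ^ (-((b : ℤ) - 1)) := by
      rw [← zpow_add₀ hq]; congr 1; ring
    rw [e, e', smul_eq_mul]
    ring
  · intro h
    simp [h, qNum_zero]

theorem coord_two_apply (a b : Fin (N + 1)) : coord q r N 2 a b =
    if (b : ℤ) - a = -1 then r * q ^ (N + 2) / (csqrt (qNum q 2) * csqrt (casimirC q N)) *
      ((csqrt q)⁻¹ * q ^ (-(N : ℤ) - 3) * qNum q (N - b)) else 0 := by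
  rw [coord, Matrix.smul_apply, sectorMatrix_apply, Zhat_two_single, single_add_one_apply,
    cast_sub_fin]
  · rw [smul_ite, smul_zero, smul_eq_mul, one_mul]
    congr 5
    ring
  · intro h
    rw [h, qNum_zero, mul_zero, mul_zero]

/-- The diagonal matrix elements of `x_0`, up to the factor `r / ([2]_q √C_N)`. -/
def heightNum (b : ℤ) : ℂ := q ^ ((N : ℤ) + 1 - b) * qInt q b - q ^ (-b - 1) * qInt q (N - b)

theorem coord_one_eq (hq : q ≠ 0) : coord q r N 1 = Matrix.diagonal fun b : Fin (N + 1) =>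
    r / (qNum q 2 * csqrt (casimirC q N)) * heightNum q N (b : ℕ) := by
  refine Matrix.ext fun a b => ?_
  rw [coord, Matrix.smul_apply, sectorMatrix_apply, Zhat_one_single q hq, single_self_apply,
    cast_sub_fin, Matrix.diagonal_apply]
  by_cases h : a = b
  · rw [if_pos h, if_pos h, h, heightNum, qInt_natCast, ← cast_sub_fin b, qInt_natCast,
      smul_eq_mul, one_mul, cast_sub_fin]
    nth_rewrite 3 [← csqrt_mul_self (qNum q 2)]
    have e1 : q ^ ((N : ℤ) + 1 - (b : ℕ)) = q ^ (N + 2) * q ^ (-((b : ℕ) : ℤ) - 1) := by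
      rw [← zpow_natCast, ← zpow_add₀ hq]; congr 1; push_cast; ring
    have e2 : q ^ (-((b : ℕ) : ℤ) - 1) =
        q ^ (N + 2) * q ^ (-2 * ((b : ℕ) : ℤ) - ((N : ℤ) - (b : ℕ)) - 3) := by
      rw [← zpow_natCast, ← zpow_add₀ hq]; congr 1; push_cast; ring
    rw [e1]
    nth_rewrite 3 [e2]
    ring
  · rw [if_neg h, if_neg h, smul_zero]

/-- The difference of two diagonal matrix elements of `x_0`. -/
theorem heightNum_add (hq : q ≠ 0) (a w : ℤ) : heightNum q N (a + w) - heightNum q N a =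
    (q + q⁻¹) * q ^ ((N : ℤ) - 2 * (a + w)) * (q ^ w * qInt q w) := by
  have h1 := qInt_add q hq a w
  have h2 := qInt_add q hq (-w) (N - a)
  have h3 := qInt_mul q hq w
  have h4 := qInt_mul q hq ((N : ℤ) - a)
  rw [heightNum, heightNum, show (N : ℤ) - (a + w) = -w + (N - a) by ring, h1, h2,
    show (N : ℤ) + 1 - (a + w) = ((N : ℤ) - a) + 1 - w by ring,
    show (N : ℤ) + 1 - a = ((N : ℤ) - a) + 1 by ring,
    show (N : ℤ) - 2 * (a + w) = ((N : ℤ) - a) - a - w - w by ring]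
  rw [qInt_neg] at *
  simp only [zpow_sub₀ hq, zpow_add₀ hq ((N : ℤ) - a), zpow_add₀ hq (-w), zpow_neg, neg_add,
    neg_neg, zpow_add₀ hq (-a), zpow_one] at *
  have hu := zpow_ne_zero w hq
  have hv := zpow_ne_zero (N : ℤ) hq
  have hw := zpow_ne_zero a hq
  generalize q ^ a = u at *
  generalize q ^ w = v at *
  generalize q ^ (N : ℤ) = t at *
  generalize qInt q a = A at *
  generalize qInt q w = B at *
  generalize qInt q ((N : ℤ) - a) = C at *
  field_simp at h3 h4 ⊢
  grind

/-- The eigenvalues of `Λ - (q - q⁻¹) x_0` are powers of `q`, up to a common factor. -/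
theorem heightNum_mul (hq : q ≠ 0) (b : ℤ) : (q - q⁻¹) * heightNum q N b =
    q ^ ((N : ℤ) + 1) + q ^ (-((N : ℤ) + 1)) - (q + q⁻¹) * q ^ ((N : ℤ) - 2 * b) := by
  have h1 := qInt_mul q hq b
  have h2 := qInt_mul q hq ((N : ℤ) - b)
  rw [heightNum, show (N : ℤ) - 2 * b = (N - b) - b by ring]
  simp only [zpow_sub₀ hq, zpow_add₀ hq, zpow_neg, neg_add, neg_sub, zpow_one] at *
  have hv := zpow_ne_zero (N : ℤ) hq
  have hw := zpow_ne_zero b hq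
  generalize q ^ b = u at *
  generalize q ^ (N : ℤ) = t at *
  generalize qInt q b = A at *
  generalize qInt q ((N : ℤ) - b) = C at *
  field_simp at h1 h2 ⊢
  grind

end

section

/-! ### The fuzzy sphere satisfies the sphere relations -/

variable {q : ℂ} {r : ℝ} {N : ℕ}

theorem Lam_sq_sub (hq : q ≠ 0) (h2 : qNum q 2 ≠ 0) (hC : casimirC q N ≠ 0) :
    Lam q r N ^ 2 - (q - q⁻¹) ^ 2 * (r : ℂ) ^ 2 = (r / csqrt (casimirC q N)) ^ 2 := by
  have hk : csqrt (casimirC q N) ≠ 0 := csqrt_ne_zero hC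
  have hkk : csqrt (casimirC q N) ^ 2 = casimirC q N := by rw [sq, csqrt_mul_self]
  have hN := qNum_mul q hq N
  have hN2 := qNum_mul q hq (N + 2)
  have key : (q ^ (N + 1) + (q ^ (N + 1))⁻¹) ^ 2 - (q - q⁻¹) ^ 2 * (qNum q N * qNum q (N + 2)) =
      (q + q⁻¹) ^ 2 := by
    have e : (q - q⁻¹) ^ 2 * (qNum q N * qNum q (N + 2)) =
        (qNum q N * (q - q⁻¹)) * (qNum q (N + 2) * (q - q⁻¹)) := by ring
    rw [e, hN, hN2, zpow_neg, zpow_neg, zpow_natCast, zpow_natCast, pow_add, pow_add]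
    have := pow_ne_zero N hq
    field_simp
    ring
  have e : (q - q⁻¹) ^ 2 = (q - q⁻¹) ^ 2 * casimirC q N / csqrt (casimirC q N) ^ 2 := by
    rw [hkk, mul_div_cancel_right₀ _ hC]
  rw [Lam, qNum_two _ (pow_ne_zero _ hq), e, casimirC]
  rw [casimirC] at hk
  rw [← qNum_two q hq] at key
  generalize q ^ (N + 1) + (q ^ (N + 1))⁻¹ = S at *
  generalize q - q⁻¹ = l at *
  generalize csqrt (qNum q N * qNum q (N + 2) / qNum q 2 ^ 2) = k at *
  field_simp
  linear_combination (r : ℂ) ^ 2 * key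

/-- `Λ - (q - q⁻¹) x_0` is a multiple of `q^H`. -/
theorem coordD_eq (hq : q ≠ 0) (h2 : qNum q 2 ≠ 0) :
    Lam q r N • (1 : SectorMat N) - (q - q⁻¹) • coord q r N 1 =
      (r / csqrt (casimirC q N)) • (repQH q N 1 * repQH q N 1) := by
  have hs : csqrt q ≠ 0 := csqrt_ne_zero hq
  rw [coord_one_eq q r N hq, repQH_eq, Matrix.diagonal_mul_diagonal, ← Matrix.diagonal_smul,
    ← Matrix.diagonal_smul, Matrix.smul_one_eq_diagonal, Matrix.diagonal_sub]
  congr 1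
  funext b
  have h := heightNum_mul q N hq (b : ℕ)
  have e : csqrt q ^ (1 * ((N : ℤ) - 2 * ((b : ℕ) : ℤ))) *
      csqrt q ^ (1 * ((N : ℤ) - 2 * ((b : ℕ) : ℤ))) =
      q ^ ((N : ℤ) - 2 * ((b : ℕ) : ℤ)) := by
    rw [← mul_zpow, csqrt_mul_self, one_mul]
  have e' : q ^ ((N : ℤ) + 1) = q ^ (N + 1) := by rw [← zpow_natCast]; rfl
  rw [zpow_neg, e'] at h
  simp only [Pi.smul_apply, smul_eq_mul]
  rw [e, Lam, qNum_two _ (pow_ne_zero _ hq)]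
  rw [← qNum_two q hq] at h
  have h' : (q - q⁻¹) * (r / (qNum q 2 * csqrt (casimirC q N)) * heightNum q N (b : ℕ)) =
    r / (qNum q 2 * csqrt (casimirC q N)) * ((q - q⁻¹) * heightNum q N (b : ℕ)) := by ring
  rw [h', h]
  generalize csqrt (casimirC q N) = k
  field_simp
  ring

theorem repQH_mul (hq : q ≠ 0) (a b : ℤ) : repQH q N a * repQH q N b = repQH q N (a + b) := by
  simp only [repQH_eq, Matrix.diagonal_mul_diagonal, ← zpow_add₀ (csqrt_ne_zero hq), add_mul]

theorem repQH_zero : repQH q N 0 = 1 := by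
  rw [repQH_eq, ← Matrix.diagonal_one]
  congr 1
  funext b
  rw [zero_mul, zpow_zero]

variable (q r N) in
/-- The inverse of `Λ - (q - q⁻¹) x_0`. -/
def dInv : SectorMat N := (r / csqrt (casimirC q N))⁻¹ • (repQH q N (-1) * repQH q N (-1))

theorem coordD_mul_dInv (hq : q ≠ 0) (h2 : qNum q 2 ≠ 0) (hC : casimirC q N ≠ 0) (hr : r ≠ 0) :
    (Lam q r N • (1 : SectorMat N) - (q - q⁻¹) • coord q r N 1) * dInv q r N = 1 := by
  have h0 : (r : ℂ) / csqrt (casimirC q N) ≠ 0 :=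
    div_ne_zero (Complex.ofReal_ne_zero.2 hr) (csqrt_ne_zero hC)
  rw [coordD_eq hq h2, dInv, smul_mul_smul_comm, mul_inv_cancel₀ h0, one_smul, repQH_mul hq,
    repQH_mul hq, repQH_mul hq]
  exact repQH_zero

/-- In a finite dimensional algebra, the inverse of an element of a subalgebra lies in it. -/
theorem mem_of_mul_eq_one {A : Type*} [Ring A] [Algebra ℂ A] [FiniteDimensional ℂ A]
    (S : Subalgebra ℂ A) {a b : A} (ha : a ∈ S) (hba : b * a = 1) : b ∈ S := by
  have hinj : Function.Injective (LinearMap.mulLeft ℂ (⟨a, ha⟩ : S)) := by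
    intro y z hyz
    have : a * (y : A) = a * z := congrArg Subtype.val hyz
    refine Subtype.ext ?_
    rw [← one_mul (y : A), ← hba, mul_assoc, this, ← mul_assoc, hba, one_mul]
  obtain ⟨y, hy⟩ := LinearMap.surjective_of_injective hinj 1
  have : a * (y : A) = 1 := congrArg Subtype.val hy
  have e : b = y := by rw [← mul_one b, ← this, ← mul_assoc, hba, one_mul]
  rw [e]
  exact y.2

theorem isSphere_coord (hq : q ≠ 0) (h2 : qNum q 2 ≠ 0) (hC : casimirC q N ≠ 0) (hr : r ≠ 0) :
    IsSphere q (Lam q r N) ((r : ℂ) ^ 2) (coord q r N)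
      (Lam q r N • (1 : SectorMat N) - (q - q⁻¹) • coord q r N 1) (dInv q r N) where
  q_ne_zero := hq
  eps_mul := coord_eps q r N hq h2 hC
  g_mul := coord_g q r N hq h2 hC
  d_eq := rfl
  mul_inv := coordD_mul_dInv hq h2 hC hr
  inv_mul := mul_eq_one_comm.1 (coordD_mul_dInv hq h2 hC hr)

theorem exists_isSphere (hq : q ≠ 0) (h2 : qNum q 2 ≠ 0) (hC : casimirC q N ≠ 0) (hr : r ≠ 0) :
    ∃ d d' : Sphere q r N, (d : SectorMat N) =
        Lam q r N • (1 : SectorMat N) - (q - q⁻¹) • coord q r N 1 ∧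
      (d' : SectorMat N) = dInv q r N ∧
      IsSphere q (Lam q r N) ((r : ℂ) ^ 2) (sphereCoord q r N) d d' := by
  have h := isSphere_coord hq h2 hC hr
  have hmem : Lam q r N • (1 : SectorMat N) - (q - q⁻¹) • coord q r N 1 ∈ Sphere q r N :=
    (Lam q r N • (1 : Sphere q r N) - (q - q⁻¹) • sphereCoord q r N 1).2
  refine ⟨⟨_, hmem⟩, ⟨dInv q r N, mem_of_mul_eq_one _ hmem h.inv_mul⟩, rfl, rfl, hq, fun k => ?_,
    ?_, rfl, Subtype.ext h.mul_inv, Subtype.ext h.inv_mul⟩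
  · refine Subtype.ext ?_
    have := h.eps_mul k
    simpa [sphereCoord] using this
  · refine Subtype.ext ?_
    have := h.g_mul
    simpa [sphereCoord] using this

/-! ### The adjoint action through commutators with the coordinates -/

theorem zpow_eq_csqrt_zpow (q : ℂ) (m : ℤ) : q ^ m = csqrt q ^ (2 * m) := by
  rw [zpow_mul]
  congr 1
  exact_mod_cast (csqrt_mul_self q).symm.trans (sq _).symm

theorem repQH_mul_coord_zero (hq : q ≠ 0) :
    repQH q N (-1) * coord q r N 0 = q⁻¹ • (coord q r N 0 * repQH q N (-1)) := by
  refine Matrix.ext fun a b => ?_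
  rw [repQH_eq, Matrix.diagonal_mul, Matrix.smul_apply, Matrix.mul_diagonal,
    coord_zero_apply q r N hq]
  by_cases h : (b : ℤ) - a = 1
  · rw [if_pos h, smul_eq_mul]
    have e : csqrt q ^ (-1 * ((N : ℤ) - 2 * (a : ℕ))) =
        q⁻¹ * csqrt q ^ (-1 * ((N : ℤ) - 2 * (b : ℕ))) := by
      rw [← zpow_neg_one, zpow_eq_csqrt_zpow q, ← zpow_add₀ (csqrt_ne_zero hq)]
      congr 1
      linarith
    rw [e]
    ring
  · rw [if_neg h, mul_zero, zero_mul, smul_zero]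

theorem repQH_mul_coord_two (hq : q ≠ 0) :
    repQH q N (-1) * coord q r N 2 = q • (coord q r N 2 * repQH q N (-1)) := by
  refine Matrix.ext fun a b => ?_
  rw [repQH_eq, Matrix.diagonal_mul, Matrix.smul_apply, Matrix.mul_diagonal, coord_two_apply]
  by_cases h : (b : ℤ) - a = -1
  · rw [if_pos h, smul_eq_mul]
    have e : csqrt q ^ (-1 * ((N : ℤ) - 2 * (a : ℕ))) =
        q * csqrt q ^ (-1 * ((N : ℤ) - 2 * (b : ℕ))) := by
      nth_rewrite 2 [← zpow_one q]
      rw [zpow_eq_csqrt_zpow q, ← zpow_add₀ (csqrt_ne_zero hq)]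
      congr 1
      linarith
    rw [e]
    ring
  · rw [if_neg h, mul_zero, zero_mul, smul_zero]

theorem repXp_eq (hq : q ≠ 0) (h2 : qNum q 2 ≠ 0) (hC : casimirC q N ≠ 0) (hr : r ≠ 0) :
    repXp q N = (q⁻¹ * (csqrt (qNum q 2) * csqrt (casimirC q N) / r)) •
      (coord q r N 0 * repQH q N (-1)) := by
  have hs := csqrt_ne_zero hq
  have hc : csqrt (qNum q 2) ≠ 0 := csqrt_ne_zero h2
  have hk : csqrt (casimirC q N) ≠ 0 := csqrt_ne_zero hC
  have hr' : (r : ℂ) ≠ 0 := Complex.ofReal_ne_zero.2 hr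
  refine Matrix.ext fun a b => ?_
  rw [Matrix.smul_apply, repQH_eq, Matrix.mul_diagonal, coord_zero_apply q r N hq, repXp_apply]
  by_cases h : (b : ℤ) - a = 1
  · rw [if_pos h, if_pos h, smul_eq_mul]
    have e : csqrt q ^ ((N : ℤ) - 2 * (b : ℕ) + 1) =
        q ^ N * csqrt q * q ^ (-2 * (b : ℤ)) * csqrt q ^ (-1 * ((N : ℤ) - 2 * (b : ℕ))) := by
      rw [← zpow_natCast q N, zpow_eq_csqrt_zpow q N, zpow_eq_csqrt_zpow q (-2 * _),
        ← zpow_add_one₀ hs, ← zpow_add₀ hs,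
        ← zpow_add₀ hs]
      congr 1
      ring
    rw [e]
    field_simp
    ring
  · rw [if_neg h, if_neg h, zero_mul, smul_zero]

theorem repXm_eq (hq : q ≠ 0) (h2 : qNum q 2 ≠ 0) (hC : casimirC q N ≠ 0) (hr : r ≠ 0) :
    repXm q N = -(q * (csqrt (qNum q 2) * csqrt (casimirC q N) / r)) •
      (coord q r N 2 * repQH q N (-1)) := by
  have hs := csqrt_ne_zero hq
  have hc : csqrt (qNum q 2) ≠ 0 := csqrt_ne_zero h2
  have hk : csqrt (casimirC q N) ≠ 0 := csqrt_ne_zero hC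
  have hr' : (r : ℂ) ≠ 0 := Complex.ofReal_ne_zero.2 hr
  refine Matrix.ext fun a b => ?_
  rw [Matrix.smul_apply, repQH_eq, Matrix.mul_diagonal, coord_two_apply, repXm_apply]
  by_cases h : (b : ℤ) - a = -1
  · rw [if_pos h, if_pos h, smul_eq_mul]
    have e : csqrt q ^ (2 * (b : ℕ) - (N : ℤ) + 1) =
        csqrt q * csqrt q ^ (-1 * ((N : ℤ) - 2 * (b : ℕ))) := by
      rw [← zpow_one_add₀ hs]
      congr 1
      ring
    have e' : q ^ (-(N : ℤ) - 3) = (q ^ (N + 2) * q)⁻¹ := by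
      rw [← pow_succ, ← zpow_natCast, ← zpow_neg]
      congr 1
      push_cast
      ring
    have e2 : csqrt q = q * (csqrt q)⁻¹ := by
      nth_rewrite 2 [← csqrt_mul_self q]
      rw [mul_inv_cancel_right₀ hs]
    rw [e, e']
    nth_rewrite 1 [e2]
    field_simp
  · rw [if_neg h, if_neg h, zero_mul, smul_zero]

theorem adXp_eq (hq : q ≠ 0) (h2 : qNum q 2 ≠ 0) (hC : casimirC q N ≠ 0) (hr : r ≠ 0)
    (f : SectorMat N) : adXp q N f = (csqrt (qNum q 2) * csqrt (casimirC q N) / r) •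
      (repQH q N (-1) * (coord q r N 0 * f - f * coord q r N 0) * repQH q N (-1)) := by
  rw [adXp, repXp_eq hq h2 hC hr]
  have e : coord q r N 0 * repQH q N (-1) = q • (repQH q N (-1) * coord q r N 0) := by
    rw [repQH_mul_coord_zero hq, smul_smul, mul_inv_cancel₀ hq, one_smul]
  simp only [mul_sub, sub_mul, smul_smul, smul_mul_assoc, mul_smul_comm, mul_assoc]
  rw [← mul_assoc (coord q r N 0) (repQH q N (-1)), e]
  simp only [smul_mul_assoc, mul_assoc, smul_smul]
  match_scalars <;> field_simp

theorem adXm_eq (hq : q ≠ 0) (h2 : qNum q 2 ≠ 0) (hC : casimirC q N ≠ 0) (hr : r ≠ 0)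
    (f : SectorMat N) : adXm q N f = -(csqrt (qNum q 2) * csqrt (casimirC q N) / r) •
      (repQH q N (-1) * (coord q r N 2 * f - f * coord q r N 2) * repQH q N (-1)) := by
  rw [adXm, repXm_eq hq h2 hC hr]
  have e : coord q r N 2 * repQH q N (-1) = q⁻¹ • (repQH q N (-1) * coord q r N 2) := by
    rw [repQH_mul_coord_two hq, smul_smul, inv_mul_cancel₀ hq, one_smul]
  simp only [mul_sub, sub_mul, smul_smul, smul_mul_assoc, mul_smul_comm, mul_assoc]
  rw [← mul_assoc (coord q r N 2) (repQH q N (-1)), e]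
  simp only [smul_mul_assoc, mul_assoc, smul_smul]
  match_scalars <;> field_simp

theorem adXm_adXp (hq : q ≠ 0) (h2 : qNum q 2 ≠ 0) (hC : casimirC q N ≠ 0) (hr : r ≠ 0)
    (f : SectorMat N) : adXm q N (adXp q N f) = -(qNum q 2) • (dInv q r N *
      (q⁻¹ • (coord q r N 2 * (coord q r N 0 * f - f * coord q r N 0)) -
        q • ((coord q r N 0 * f - f * coord q r N 0) * coord q r N 2)) * dInv q r N) := by
  rw [adXm_eq hq h2 hC hr, adXp_eq hq h2 hC hr, dInv]
  generalize coord q r N 0 * f - f * coord q r N 0 = y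
  have e : coord q r N 2 * repQH q N (-1) = q⁻¹ • (repQH q N (-1) * coord q r N 2) := by
    rw [repQH_mul_coord_two hq, smul_smul, inv_mul_cancel₀ hq, one_smul]
  have hcc := csqrt_mul_self (qNum q 2)
  have hk : csqrt (casimirC q N) ≠ 0 := csqrt_ne_zero hC
  have hr' : (r : ℂ) ≠ 0 := Complex.ofReal_ne_zero.2 hr
  have e' : ∀ z, coord q r N 2 * (repQH q N (-1) * z) =
      q⁻¹ • (repQH q N (-1) * (coord q r N 2 * z)) := fun z => by
    rw [← mul_assoc, e, smul_mul_assoc, mul_assoc]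
  simp only [mul_sub, sub_mul, smul_smul, smul_mul_assoc, mul_smul_comm, mul_assoc, e',
    repQH_mul_coord_two hq, smul_sub]
  generalize csqrt (qNum q 2) = c at *
  rw [← hcc]
  match_scalars <;> field_simp

theorem adXp_adXm (hq : q ≠ 0) (h2 : qNum q 2 ≠ 0) (hC : casimirC q N ≠ 0) (hr : r ≠ 0)
    (f : SectorMat N) : adXp q N (adXm q N f) = -(qNum q 2) • (dInv q r N *
      (q • (coord q r N 0 * (coord q r N 2 * f - f * coord q r N 2)) -
        q⁻¹ • ((coord q r N 2 * f - f * coord q r N 2) * coord q r N 0)) * dInv q r N) := by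
  rw [adXp_eq hq h2 hC hr, adXm_eq hq h2 hC hr, dInv]
  generalize coord q r N 2 * f - f * coord q r N 2 = y
  have e : coord q r N 0 * repQH q N (-1) = q • (repQH q N (-1) * coord q r N 0) := by
    rw [repQH_mul_coord_zero hq, smul_smul, mul_inv_cancel₀ hq, one_smul]
  have hcc := csqrt_mul_self (qNum q 2)
  have hk : csqrt (casimirC q N) ≠ 0 := csqrt_ne_zero hC
  have hr' : (r : ℂ) ≠ 0 := Complex.ofReal_ne_zero.2 hr
  have e' : ∀ z, coord q r N 0 * (repQH q N (-1) * z) =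
      q • (repQH q N (-1) * (coord q r N 0 * z)) := fun z => by
    rw [← mul_assoc, e, smul_mul_assoc, mul_assoc]
  simp only [mul_sub, sub_mul, smul_smul, smul_mul_assoc, mul_smul_comm, mul_assoc, e',
    repQH_mul_coord_zero hq, smul_sub]
  generalize csqrt (qNum q 2) = c at *
  rw [← hcc]
  match_scalars <;> field_simp

end

section

/-! ### Weight vectors -/

/-- The commutator with `q x_1 x_{-1} - q⁻¹ x_{-1} x_1`, which is a polynomial in `x_0`. -/
theorem IsSphere.commutator_identity {A : Type*} [Ring A] [Algebra ℂ A] {q Λ ρ : ℂ}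
    {x : Fin 3 → A} {d d' : A} (h : IsSphere q Λ ρ x d d') {f : A} {β : ℂ}
    (hf : x 1 * f = f * x 1 - β • (f * d)) :
    (q + q⁻¹) • ((q • (x 0 * x 2) - q⁻¹ • (x 2 * x 0)) * f -
      f * (q • (x 0 * x 2) - q⁻¹ • (x 2 * x 0))) =
      -(β * (2 + (q - q⁻¹) * β)) • (f * d * d) := by
  have hq := h.q_ne_zero
  have hd := h.d_mul_of_weight hf
  have e : (q + q⁻¹) • (q • (x 0 * x 2) - q⁻¹ • (x 2 * x 0)) =
      Λ • x 1 + x 1 * d - ((q - q⁻¹) * ρ) • (1 : A) := by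
    rw [smul_sub, smul_comm _ q, smul_comm _ q⁻¹, h.zero_mul_two, h.two_mul_zero', h.d_eq]
    simp only [mul_sub, mul_smul_comm, mul_one]
    match_scalars <;> field_simp <;> ring
  rw [smul_sub, ← smul_mul_assoc (q + q⁻¹), ← mul_smul_comm (q + q⁻¹), e]
  simp only [mul_sub, mul_add, sub_mul, add_mul, mul_smul_comm, smul_mul_assoc, mul_one, one_mul,
    mul_assoc (x 1), hf, hd]
  simp only [h.d_eq, mul_sub, mul_add, sub_mul, mul_smul_comm, smul_mul_assoc, mul_one, one_mul,
    ← mul_assoc, hf]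
  match_scalars <;> field_simp <;> ring

/-- `f ∈ End(F_N)` has weight `w` if `H ▷ f = 2 w f`, that is, if the nonzero entries of `f` are
those with `column - row = w`. -/
def HasWeight {N : ℕ} (w : ℤ) (f : SectorMat N) : Prop :=
  ∀ a b : Fin (N + 1), (b : ℤ) - (a : ℕ) ≠ w → f a b = 0

section weights

variable {q : ℂ} {r : ℝ} {N : ℕ} {v w : ℤ} {f f' : SectorMat N}

theorem HasWeight.mul (hf : HasWeight v f) (hf' : HasWeight w f') : HasWeight (v + w) (f * f') := by
  intro a b hab
  rw [Matrix.mul_apply]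
  refine Finset.sum_eq_zero fun c _ => ?_
  by_cases h : (c : ℤ) - (a : ℕ) = v
  · rw [hf' c b (by omega), mul_zero]
  · rw [hf a c h, zero_mul]

theorem HasWeight.smul (c : ℂ) (hf : HasWeight w f) : HasWeight w (c • f) := fun a b h => by
  rw [Matrix.smul_apply, hf a b h, smul_zero]

theorem HasWeight.add (hf : HasWeight w f) (hf' : HasWeight w f') : HasWeight w (f + f') :=
  fun a b h => by rw [Matrix.add_apply, hf a b h, hf' a b h, add_zero]

theorem hasWeight_diagonal (u : Fin (N + 1) → ℂ) : HasWeight 0 (Matrix.diagonal u) :=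
  fun a b h => Matrix.diagonal_apply_ne _ fun hab => h (by rw [hab, sub_self])

theorem hasWeight_repXp : HasWeight 1 (repXp q N) := fun a b h => by rw [repXp_apply, if_neg h]

theorem hasWeight_repXm : HasWeight (-1) (repXm q N) := fun a b h => by rw [repXm_apply, if_neg h]

theorem hasWeight_adXp (hf : HasWeight w f) : HasWeight (w + 1) (adXp q N f) := by
  have hK : HasWeight 0 (repQH q N (-1)) := by rw [repQH_eq]; exact hasWeight_diagonal _
  have h1 := (hasWeight_repXp (q := q).mul hf).mul hK
  have h2 := (hK.mul hf).mul ((hasWeight_repXp (q := q) (N := N)).smul (-q))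
  rw [show 1 + w + 0 = w + 1 by ring] at h1
  rw [show 0 + w + 1 = w + 1 by ring] at h2
  exact h1.add h2

theorem hasWeight_adXm (hf : HasWeight w f) : HasWeight (w - 1) (adXm q N f) := by
  have hK : HasWeight 0 (repQH q N (-1)) := by rw [repQH_eq]; exact hasWeight_diagonal _
  have h1 := (hasWeight_repXm (q := q).mul hf).mul hK
  have h2 := (hK.mul hf).mul ((hasWeight_repXm (q := q) (N := N)).smul (-q⁻¹))
  rw [show -1 + w + 0 = w - 1 by ring] at h1
  rw [show 0 + w + -1 = w - 1 by ring] at h2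
  exact h1.add h2

theorem adH_apply (f : SectorMat N) (a b : Fin (N + 1)) :
    adH N f a b = 2 * (((b : ℤ) - (a : ℕ) : ℤ) : ℂ) * f a b := by
  rw [adH, repH_eq, Matrix.sub_apply, Matrix.diagonal_mul, Matrix.mul_diagonal]
  push_cast
  ring

theorem adH_eq_smul (hf : HasWeight w f) : adH N f = (2 * (w : ℂ)) • f := by
  refine Matrix.ext fun a b => ?_
  rw [adH_apply, Matrix.smul_apply, smul_eq_mul]
  by_cases h : (b : ℤ) - (a : ℕ) = w
  · rw [h]
  · rw [hf a b h, mul_zero, mul_zero]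

theorem exists_entry_ne_zero (hf : f ≠ 0) : ∃ a b, f a b ≠ 0 := by
  by_contra! h
  exact hf (Matrix.ext h)

/-- A nonzero eigenvector of `H` is a weight vector. -/
theorem exists_hasWeight {c : ℂ} (hf : f ≠ 0) (h : adH N f = c • f) : ∃ w, HasWeight w f := by
  have key : ∀ a b : Fin (N + 1), f a b ≠ 0 → c = 2 * (((b : ℤ) - (a : ℕ) : ℤ) : ℂ) := by
    intro a b hab
    have := congrFun (congrFun h a) b
    rw [adH_apply, Matrix.smul_apply, smul_eq_mul] at this
    exact (mul_right_cancel₀ hab this).symm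
  obtain ⟨a, b, hab⟩ := exists_entry_ne_zero hf
  refine ⟨(b : ℤ) - (a : ℕ), fun a' b' h' => ?_⟩
  by_contra h0
  have := (key a' b' h0).symm.trans (key a b hab)
  exact h' (by exact_mod_cast mul_left_cancel₀ two_ne_zero this)

theorem HasWeight.le (hf : HasWeight w f) (h0 : f ≠ 0) : -(N : ℤ) ≤ w ∧ w ≤ N := by
  obtain ⟨a, b, hab⟩ := exists_entry_ne_zero h0
  have h : (b : ℤ) - (a : ℕ) = w := by
    by_contra h
    exact hab (hf a b h)
  have := a.2
  have := b.2
  omega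

/-- The commutator of `x_0` with a weight vector. -/
theorem HasWeight.coord_one_mul (hq : q ≠ 0) (h2 : qNum q 2 ≠ 0) (hf : HasWeight w f) :
    coord q r N 1 * f = f * coord q r N 1 - (q ^ w * qInt q w) •
      (f * (Lam q r N • (1 : SectorMat N) - (q - q⁻¹) • coord q r N 1)) := by
  rw [coordD_eq hq h2, coord_one_eq q r N hq, repQH_mul hq, repQH_eq]
  refine Matrix.ext fun a b => ?_
  rw [Matrix.sub_apply, Matrix.smul_apply, mul_smul_comm, Matrix.smul_apply, Matrix.diagonal_mul,
    Matrix.mul_diagonal, Matrix.mul_diagonal]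
  by_cases h : (b : ℤ) - (a : ℕ) = w
  · have key := heightNum_add q N hq (a : ℕ) w
    rw [show ((a : ℕ) : ℤ) + w = (b : ℕ) by omega] at key
    have e : csqrt q ^ ((1 + 1) * ((N : ℤ) - 2 * ((b : ℕ) : ℤ))) =
        q ^ ((N : ℤ) - 2 * ((b : ℕ) : ℤ)) := by rw [zpow_eq_csqrt_zpow q]; rfl
    rw [e, smul_eq_mul, smul_eq_mul]
    rw [← qNum_two q hq] at key
    have e' : (r : ℂ) / (qNum q 2 * csqrt (casimirC q N)) * heightNum q N (a : ℕ) =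
        r / (qNum q 2 * csqrt (casimirC q N)) * heightNum q N (b : ℕ) -
        r / csqrt (casimirC q N) * q ^ ((N : ℤ) - 2 * ((b : ℕ) : ℤ)) * (q ^ w * qInt q w) := by
      rw [eq_sub_of_add_eq' (eq_add_of_sub_eq key).symm]
      generalize csqrt (casimirC q N) = k
      field_simp
    rw [e']
    ring
  · rw [hf a b h]
    simp

/-- The factor by which `d` commutes with elements of weight `w`. -/
theorem one_add_weight (hq : q ≠ 0) (w : ℤ) :
    1 + (q - q⁻¹) * (q ^ w * qInt q w) = q ^ w * q ^ w := by
  have h := qInt_mul q hq w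
  have h' := zpow_ne_zero w hq
  rw [zpow_neg] at h
  have : (q - q⁻¹) * (q ^ w * qInt q w) = q ^ w * (qInt q w * (q - q⁻¹)) := by ring
  rw [this, h]
  field_simp
  ring

end weights

end

section

/-! ### The Casimir operator -/

variable {q : ℂ} {r : ℝ} {N : ℕ} {w : ℤ} {f : SectorMat N}

theorem HasWeight.inv_mul_d (hq : q ≠ 0) (h2 : qNum q 2 ≠ 0) (hC : casimirC q N ≠ 0) (hr : r ≠ 0)
    (hf : HasWeight w f) :
    dInv q r N * (f * (Lam q r N • (1 : SectorMat N) - (q - q⁻¹) • coord q r N 1)) =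
      (q ^ w * q ^ w)⁻¹ • f := by
  have h := isSphere_coord hq h2 hC hr
  have hw := zpow_ne_zero w hq
  have hd := h.d_mul_of_weight (hf.coord_one_mul hq h2)
  rw [one_add_weight hq] at hd
  have e : f * (Lam q r N • (1 : SectorMat N) - (q - q⁻¹) • coord q r N 1) =
      (q ^ w * q ^ w)⁻¹ •
        ((Lam q r N • (1 : SectorMat N) - (q - q⁻¹) • coord q r N 1) * f) := by
    rw [hd, smul_smul, inv_mul_cancel₀ (mul_ne_zero hw hw), one_smul]
  rw [e, mul_smul_comm, h.inv_mul_mul]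

/-- `[X⁺, X⁻] = [H]` on weight vectors, as `[w][w+1] - [w-1][w] = [2w]`. -/
theorem HasWeight.commutator (hq : q ≠ 0) (h2 : qNum q 2 ≠ 0) (hC : casimirC q N ≠ 0) (hr : r ≠ 0)
    (hf : HasWeight w f) : adXp q N (adXm q N f) = adXm q N (adXp q N f) +
      (qInt q w * qInt q (w + 1) - qInt q (w - 1) * qInt q w) • f := by
  have h := isSphere_coord hq h2 hC hr
  have hid := h.commutator_identity (hf.coord_one_mul hq h2)
  have hinv := hf.inv_mul_d hq h2 hC hr
  have hw := zpow_ne_zero w hq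
  have hc : qInt q w * qInt q (w + 1) - qInt q (w - 1) * qInt q w =
      q ^ w * qInt q w * (2 + (q - q⁻¹) * (q ^ w * qInt q w)) * (q ^ w * q ^ w)⁻¹ := by
    have e1 := qInt_add_one q hq w
    have e2 := qInt_add_one q hq (w - 1)
    have e3 := one_add_weight hq w
    rw [sub_add_cancel, neg_sub, show (1 : ℤ) - w = -w + 1 by ring, zpow_add_one₀ hq] at e2
    have e4 : qInt q (w - 1) = q⁻¹ * qInt q w - q ^ (-w) := by
      rw [e2]; field_simp; ring
    rw [e1, e4, show (2 : ℂ) + (q - q⁻¹) * (q ^ w * qInt q w) =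
      1 + (1 + (q - q⁻¹) * (q ^ w * qInt q w)) by ring, e3, zpow_neg]
    field_simp at e3 ⊢
    linear_combination (qInt q w) * e3
  rw [hc, ← sub_eq_iff_eq_add', adXp_adXm hq h2 hC hr, adXm_adXp hq h2 hC hr, qNum_two q hq]
  generalize hD : Lam q r N • (1 : SectorMat N) - (q - q⁻¹) • coord q r N 1 = D at *
  have e : (q • (coord q r N 0 * (coord q r N 2 * f - f * coord q r N 2)) -
        q⁻¹ • ((coord q r N 2 * f - f * coord q r N 2) * coord q r N 0)) -
      (q⁻¹ • (coord q r N 2 * (coord q r N 0 * f - f * coord q r N 0)) -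
        q • ((coord q r N 0 * f - f * coord q r N 0) * coord q r N 2)) =
      (q • (coord q r N 0 * coord q r N 2) - q⁻¹ • (coord q r N 2 * coord q r N 0)) * f -
      f * (q • (coord q r N 0 * coord q r N 2) - q⁻¹ • (coord q r N 2 * coord q r N 0)) := by
    simp only [mul_sub, sub_mul, mul_smul_comm, smul_mul_assoc, smul_sub, mul_assoc]
    abel
  rw [← smul_sub, ← sub_mul, ← mul_sub, e, neg_smul, ← smul_mul_assoc, ← mul_smul_comm, hid,
    mul_smul_comm, smul_mul_assoc, mul_assoc (dInv q r N), mul_assoc (f * D), h.mul_inv, mul_one,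
    hinv, smul_smul, ← neg_smul]
  congr 1
  ring

/-- The eigenvalue identity: on vectors of weight `w`, the operator `r² - sandwich` is
`(r² / ([2] C_N)) (X⁻ X⁺ + [w] [w + 1])`, a multiple of the Casimir operator. -/
theorem IsSphere.sub_sandwich_of_weight {d d' : Sphere q r N} (hq : q ≠ 0) (h2 : qNum q 2 ≠ 0)
    (hC : casimirC q N ≠ 0) (hr : r ≠ 0)
    (hd : (d : SectorMat N) = Lam q r N • (1 : SectorMat N) - (q - q⁻¹) • coord q r N 1)
    (h : IsSphere q (Lam q r N) ((r : ℂ) ^ 2) (sphereCoord q r N) d d') {ψ : Sphere q r N}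
    (hψ : HasWeight w (ψ : SectorMat N)) :
    (((r : ℂ) ^ 2 • ψ - h.sandwich ψ : Sphere q r N) : SectorMat N) =
      ((r : ℂ) ^ 2 / (qNum q 2 * casimirC q N)) • (adXm q N (adXp q N ψ) +
        (qInt q w * qInt q (w + 1)) • (ψ : SectorMat N)) := by
  have hM := isSphere_coord hq h2 hC hr
  have hw := zpow_ne_zero w hq
  have hkk : csqrt (casimirC q N) ^ 2 = casimirC q N := by rw [sq, csqrt_mul_self]
  have hf : sphereCoord q r N 1 * ψ = ψ * sphereCoord q r N 1 -
      (q ^ w * qInt q w) • (ψ * d) := Subtype.ext (by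
    have := hψ.coord_one_mul (r := r) hq h2
    rw [← hd] at this
    exact this)
  have key := congrArg Subtype.val (h.sub_sandwich hf)
  have hinv := hψ.inv_mul_d hq h2 hC hr
  rw [← hd] at hinv hM
  rw [Lam_sq_sub hq h2 hC, div_pow, hkk] at key
  change (q + q⁻¹) • ((d : SectorMat N) *
      (((r : ℂ) ^ 2 • ψ - h.sandwich ψ : Sphere q r N) : SectorMat N) * (d : SectorMat N)) =
    ((r : ℂ) ^ 2 / casimirC q N) • (-((q + q⁻¹) • (q⁻¹ • (coord q r N 2 *
      (coord q r N 0 * (ψ : SectorMat N) - ψ * coord q r N 0)) -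
        q • ((coord q r N 0 * (ψ : SectorMat N) - ψ * coord q r N 0) * coord q r N 2))) +
      (q * (q ^ w * qInt q w) ^ 2 + q ^ w * qInt q w) • ((ψ : SectorMat N) * d * d)) at key
  generalize (((r : ℂ) ^ 2 • ψ - h.sandwich ψ : Sphere q r N) : SectorMat N) = T at *
  have hT : dInv q r N * ((d : SectorMat N) * T * d) * dInv q r N = T := by
    rw [mul_assoc (d : SectorMat N), hM.inv_mul_mul, mul_assoc, hM.mul_inv, mul_one]
  have hc : qInt q w * qInt q (w + 1) =
      (q * (q ^ w * qInt q w) ^ 2 + q ^ w * qInt q w) * (q ^ w * q ^ w)⁻¹ := by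
    rw [qInt_add_one q hq, zpow_neg]
    field_simp
  have hdd : dInv q r N * ((ψ : SectorMat N) * d * d) * dInv q r N =
      (q ^ w * q ^ w)⁻¹ • (ψ : SectorMat N) := by
    rw [← mul_assoc, mul_assoc _ (d : SectorMat N), hM.mul_inv, mul_one, hinv]
  rw [adXm_adXp hq h2 hC hr, hc]
  have h2' : (q + q⁻¹) ≠ 0 := by rwa [← qNum_two q hq]
  have hfin : (q + q⁻¹) • T = (q + q⁻¹) •
      (dInv q r N * ((d : SectorMat N) * T * d) * dInv q r N) := by rw [hT]
  rw [← smul_mul_assoc, ← mul_smul_comm, key, mul_smul_comm, smul_mul_assoc, mul_add, add_mul,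
    mul_smul_comm, smul_mul_assoc _ _ (dInv q r N), hdd, smul_smul _ _ (ψ : SectorMat N),
    mul_neg, neg_mul, mul_smul_comm, smul_mul_assoc] at hfin
  rw [qNum_two q hq, neg_smul]
  rw [← eq_inv_smul_iff₀ h2', smul_smul] at hfin
  refine hfin.trans ?_
  congr 1
  field_simp

end

section

/-! ### Nonvanishing of q-numbers -/

/-- For real `q` the terms of `[n]` all have the same sign. -/
theorem qNum_ofReal_ne_zero {t : ℝ} (ht : t ≠ 0) {n : ℕ} (hn : n ≠ 0) : qNum (t : ℂ) n ≠ 0 := by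
  have ht' : (t : ℂ) ≠ 0 := Complex.ofReal_ne_zero.2 ht
  have e : qNum (t : ℂ) n =
      ((t ^ ((n : ℤ) - 1) * ∑ k ∈ Finset.range n, (t ^ (-(k : ℤ))) ^ 2 : ℝ) : ℂ) := by
    push_cast
    rw [qNum, Finset.mul_sum]
    refine Finset.sum_congr rfl fun k _ => ?_
    rw [← zpow_natCast, ← zpow_mul, ← zpow_add₀ ht']
    congr 1
    push_cast
    ring
  rw [e, Complex.ofReal_ne_zero]
  refine mul_ne_zero (zpow_ne_zero _ ht) (ne_of_gt (Finset.sum_pos (fun k _ => ?_) ?_))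
  · positivity
  · exact Finset.nonempty_range_iff.2 hn

/-- For `q = e^{iπφ}` the q-number `[n]` vanishes only if `q^(2n) = 1 ≠ q²`, that is, if `n φ` is a
nonzero integer. -/
theorem qNum_exp_ne_zero {φ : ℝ} {n M : ℕ} (hφ : |φ| < 1 / M) (hn : n ≠ 0) (hnM : n ≤ M) :
    qNum (Complex.exp (Complex.I * Real.pi * φ)) n ≠ 0 := by
  intro h0
  have hM : (0 : ℝ) < M := by exact_mod_cast (Nat.pos_of_ne_zero hn).trans_le hnM
  obtain ⟨h1, h2⟩ := qNum_rel _ (Complex.exp_ne_zero (Complex.I * Real.pi * φ)) n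
  rw [h0, zero_mul, zero_mul, eq_comm, mul_eq_zero, or_iff_right (Complex.exp_ne_zero _),
    sub_eq_zero, ← Complex.exp_nat_mul, ← Complex.exp_nat_mul, Complex.exp_eq_one_iff] at h1
  obtain ⟨m, hm⟩ := h1
  have hm' : (n : ℝ) * φ = m := by
    have hpi : (Real.pi : ℂ) ≠ 0 := Complex.ofReal_ne_zero.2 Real.pi_ne_zero
    have : ((n : ℂ) * φ) * (2 * Real.pi * Complex.I) = m * (2 * Real.pi * Complex.I) := by
      rw [← hm]; push_cast; ring
    exact_mod_cast mul_right_cancel₀ Complex.two_pi_I_ne_zero this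
  have hlt : |(m : ℝ)| < 1 := by
    rw [← hm', abs_mul, Nat.abs_cast]
    calc (n : ℝ) * |φ| ≤ M * |φ| := by gcongr
      _ < M * (1 / M) := by gcongr
      _ = 1 := by field_simp
  have hm0 : m = 0 := by
    rw [← Int.abs_lt_one_iff]
    exact_mod_cast hlt
  rw [hm0, Int.cast_zero, mul_eq_zero, or_iff_right (Nat.cast_ne_zero.2 hn)] at hm'
  rw [hm'] at h0
  have : (n : ℂ) = 0 := by simpa [qNum] using h0
  exact hn (by exact_mod_cast this)

theorem qNum_ne_zero {q : ℂ} {N : ℕ} (hq : (∃ t : ℝ, t ≠ 0 ∧ q = t) ∨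
      ∃ φ : ℝ, |φ| < 1 / (2 * N) ∧ q = Complex.exp (Complex.I * Real.pi * φ)) {n : ℕ}
    (hn : n ≠ 0) (hnN : n ≤ 2 * N) : qNum q n ≠ 0 := by
  rcases hq with ⟨t, ht, rfl⟩ | ⟨φ, hφ, rfl⟩
  · exact qNum_ofReal_ne_zero ht hn
  · exact qNum_exp_ne_zero (M := 2 * N) (by push_cast; exact hφ) hn hnN

theorem qInt_ne_zero {q : ℂ} {N : ℕ} (hN : ∀ n : ℕ, n ≠ 0 → n ≤ 2 * N → qNum q n ≠ 0) {w : ℤ}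
    (hw : w ≠ 0) (h1 : -(2 * N : ℤ) ≤ w) (h2 : w ≤ 2 * N) : qInt q w ≠ 0 := by
  obtain ⟨n, rfl | rfl⟩ := w.eq_nat_or_neg
  · exact hN n (by omega) (by omega)
  · rw [qInt_neg, neg_ne_zero]
    exact hN n (by omega) (by omega)

/-! ### Irreducible representations -/

variable {q : ℂ} {r : ℝ} {N : ℕ}

variable (q N) in
/-- `X⁺ ▷ ·` as a linear map. -/
def adXpLin : SectorMat N →ₗ[ℂ] SectorMat N where
  toFun := adXp q N
  map_add' f f' := by simp only [adXp, mul_add, add_mul]; abel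
  map_smul' c f := by simp only [adXp, mul_smul_comm, smul_mul_assoc, smul_add, smul_comm c,
    RingHom.id_apply]

variable (q N) in
/-- `X⁻ ▷ ·` as a linear map. -/
def adXmLin : SectorMat N →ₗ[ℂ] SectorMat N where
  toFun := adXm q N
  map_add' f f' := by simp only [adXm, mul_add, add_mul]; abel
  map_smul' c f := by simp only [adXm, mul_smul_comm, smul_mul_assoc, smul_add, smul_comm c,
    RingHom.id_apply]

variable (N) in
/-- `H ▷ ·` as a linear map. -/
def adHLin : SectorMat N →ₗ[ℂ] SectorMat N where
  toFun := adH N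
  map_add' f f' := by simp only [adH, mul_add, add_mul]; abel
  map_smul' c f := by simp only [adH, mul_smul_comm, smul_mul_assoc, smul_sub, RingHom.id_apply]

theorem adXm_smul (c : ℂ) (f : SectorMat N) : adXm q N (c • f) = c • adXm q N f :=
  (adXmLin q N).map_smul c f

theorem adXm_zero : adXm q N 0 = 0 := (adXmLin q N).map_zero

theorem adXp_zero : adXp q N 0 = 0 := (adXpLin q N).map_zero

/-- A nonzero invariant subspace contains a highest weight vector. -/
theorem exists_highestWeight {W : Submodule ℂ (SectorMat N)} (hW : IsInvariant q N W)
    (h0 : W ≠ ⊥) : ∃ j : ℤ, ∃ f ∈ W, f ≠ 0 ∧ HasWeight j f ∧ adXp q N f = 0 := by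
  have hex : ∃ w : ℤ, ∃ f ∈ W, f ≠ 0 ∧ HasWeight w f := by
    have : Nontrivial W := Submodule.nontrivial_iff_ne_bot.2 h0
    obtain ⟨c, hc⟩ := Module.End.exists_eigenvalue ((adHLin N).restrict fun f hf => (hW f hf).1)
    obtain ⟨f, hf⟩ := hc.exists_hasEigenvector
    have hf0 : (f : SectorMat N) ≠ 0 := fun h => hf.2 (Subtype.ext h)
    have hfc : adH N f = c • (f : SectorMat N) := congrArg Subtype.val hf.apply_eq_smul
    obtain ⟨w, hw⟩ := exists_hasWeight hf0 hfc
    exact ⟨w, f, f.2, hf0, hw⟩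
  obtain ⟨j, ⟨f, hfW, hf0, hf⟩, hmax⟩ := Int.exists_greatest_of_bdd
    ⟨N, fun w ⟨f, _, hf0, hf⟩ => (hf.le hf0).2⟩ hex
  refine ⟨j, f, hfW, hf0, hf, ?_⟩
  by_contra h
  have := hmax (j + 1) ⟨_, (hW f hfW).2.1, h, hasWeight_adXp hf⟩
  omega

section ladder

variable {j : ℤ} {f : SectorMat N}

variable (q N) in
/-- The vectors `(X⁻)^i ▷ f`. -/
def ladder (f : SectorMat N) : ℕ → SectorMat N
  | 0 => f
  | i + 1 => adXm q N (ladder f i)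

theorem hasWeight_ladder (hf : HasWeight j f) (i : ℕ) : HasWeight (j - i) (ladder q N f i) := by
  induction i with
  | zero => simpa [ladder] using hf
  | succ i ih =>
    have := hasWeight_adXm (q := q) ih
    rw [show j - (i : ℤ) - 1 = j - ((i + 1 : ℕ) : ℤ) by push_cast; ring] at this
    exact this

/-- `X⁻ X⁺` and `X⁺ X⁻` act on `(X⁻)^i ▷ f`, where `f` is a highest weight vector of weight `j`,
by `[j][j+1] - [w][w+1]` with `w = j - i` and `w = j - i - 1`. -/
theorem adXp_ladder (hq : q ≠ 0) (h2 : qNum q 2 ≠ 0) (hC : casimirC q N ≠ 0)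
    (hf : HasWeight j f) (hp : adXp q N f = 0) (i : ℕ) :
    adXm q N (adXp q N (ladder q N f i)) =
      (qInt q j * qInt q (j + 1) - qInt q (j - i) * qInt q (j - i + 1)) • ladder q N f i ∧
    adXp q N (ladder q N f (i + 1)) =
      (qInt q j * qInt q (j + 1) - qInt q (j - (i + 1 : ℕ)) * qInt q (j - (i + 1 : ℕ) + 1)) •
        ladder q N f i := by
  have step : ∀ i : ℕ, adXm q N (adXp q N (ladder q N f i)) =
      (qInt q j * qInt q (j + 1) - qInt q (j - i) * qInt q (j - i + 1)) • ladder q N f i →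
    adXp q N (ladder q N f (i + 1)) =
      (qInt q j * qInt q (j + 1) - qInt q (j - (i + 1 : ℕ)) * qInt q (j - (i + 1 : ℕ) + 1)) •
        ladder q N f i := fun i h => by
    rw [ladder, (hasWeight_ladder hf i).commutator (r := 1) hq h2 hC one_ne_zero, h, ← add_smul]
    rw [show j - ((i + 1 : ℕ) : ℤ) = j - i - 1 by push_cast; ring, sub_add_cancel]
    congr 1
    ring
  have key : adXm q N (adXp q N (ladder q N f i)) =
      (qInt q j * qInt q (j + 1) - qInt q (j - i) * qInt q (j - i + 1)) • ladder q N f i := by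
    induction i with
    | zero => simp [ladder, hp, adXm_zero]
    | succ i ih =>
      rw [step i ih, adXm_smul]
      rfl
  exact ⟨key, step i key⟩

end ladder

/-- In an irreducible representation of dimension `2 K + 1`, the vectors `(X⁻)^i ▷ f` obtained from
a highest weight vector `f` form a spanning set, and `f` has weight `K`. -/
theorem exists_ladder {K : ℕ} {W : Submodule ℂ (SectorMat N)} (hq : q ≠ 0)
    (hN : ∀ n : ℕ, n ≠ 0 → n ≤ 2 * N → qNum q n ≠ 0) (h2 : qNum q 2 ≠ 0)
    (hC : casimirC q N ≠ 0) (hW : IsSpinRep q r N K W) :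
    ∃ f, HasWeight K f ∧ adXp q N f = 0 ∧ W = Submodule.span ℂ (Set.range (ladder q N f)) := by
  have hW0 : W ≠ ⊥ := fun h => by
    have := hW.finrank_eq
    rw [h, finrank_bot] at this
    omega
  obtain ⟨j, f, hfW, hf0, hf, hp⟩ := exists_highestWeight hW.invariant hW0
  have hlad := adXp_ladder hq h2 hC hf hp
  have hwt := hasWeight_ladder (q := q) hf
  -- the ladder spans `W`
  have hspan : Submodule.span ℂ (Set.range (ladder q N f)) = W := by
    have hle : Submodule.span ℂ (Set.range (ladder q N f)) ≤ W := by
      rw [Submodule.span_le]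
      rintro _ ⟨i, rfl⟩
      induction i with
      | zero => exact hfW
      | succ i ih => exact (hW.invariant _ ih).2.2
    refine (hW.irreducible _ hle fun g hg => ?_).resolve_left fun h => hf0 ?_
    · have stable : ∀ T : SectorMat N →ₗ[ℂ] SectorMat N,
          (∀ i, T (ladder q N f i) ∈ Submodule.span ℂ (Set.range (ladder q N f))) →
          T g ∈ Submodule.span ℂ (Set.range (ladder q N f)) := fun T hT => by
        have : Submodule.span ℂ (Set.range (ladder q N f)) ≤
            (Submodule.span ℂ (Set.range (ladder q N f))).comap T := by
          rw [Submodule.span_le]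
          rintro _ ⟨i, rfl⟩
          exact hT i
        exact this hg
      have mem : ∀ i, ladder q N f i ∈ Submodule.span ℂ (Set.range (ladder q N f)) :=
        fun i => Submodule.subset_span ⟨i, rfl⟩
      refine ⟨stable (adHLin N) fun i => ?_, stable (adXpLin q N) fun i => ?_,
        stable (adXmLin q N) fun i => mem (i + 1)⟩
      · change adH N _ ∈ _
        rw [adH_eq_smul (hwt i)]
        exact Submodule.smul_mem _ _ (mem i)
      · change adXp q N _ ∈ _
        rcases i with _ | i
        · rw [ladder, hp]
          exact zero_mem _
        · rw [(hlad i).2]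
          exact Submodule.smul_mem _ _ (mem i)
    · have : ladder q N f 0 ∈ Submodule.span ℂ (Set.range (ladder q N f)) :=
        Submodule.subset_span ⟨0, rfl⟩
      rw [h, Submodule.mem_bot] at this
      exact this
  -- the ladder ends after finitely many steps, since the weights are bounded
  have hex : ∃ D, ladder q N f D = 0 := by
    refine ⟨2 * N + 1, ?_⟩
    by_contra h
    have h1 := (hwt (2 * N + 1)).le h
    have h3 := hf.le hf0
    push_cast at h1
    omega
  classical
  obtain ⟨D, hD, hlt⟩ : ∃ D, ladder q N f D = 0 ∧ ∀ i < D, ladder q N f i ≠ 0 :=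
    ⟨Nat.find hex, Nat.find_spec hex, fun i hi => Nat.find_min hex hi⟩
  have hge : ∀ i, ladder q N f (D + i) = 0 := fun i => by
    induction i with
    | zero => exact hD
    | succ i ih => rw [← add_assoc, ladder, ih, adXm_zero]
  -- its nonzero members have distinct weights
  have hli : LinearIndependent ℂ fun i : Fin D => ladder q N f i := by
    refine Module.End.eigenvectors_linearIndependent' (adHLin N)
      (fun i : Fin D => 2 * ((j - (i : ℕ) : ℤ) : ℂ)) (fun i i' h => ?_) _ fun i => ?_
    · have := mul_left_cancel₀ two_ne_zero h
      have : j - ((i : ℕ) : ℤ) = j - (i' : ℕ) := by exact_mod_cast this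
      exact Fin.ext (by omega)
    · exact ⟨Module.End.mem_eigenspace_iff.2 (adH_eq_smul (hwt i)), hlt i i.2⟩
  have hspan' : Submodule.span ℂ (Set.range fun i : Fin D => ladder q N f i) = W := by
    refine le_antisymm ?_ ?_
    · rw [← hspan]
      refine Submodule.span_mono ?_
      rintro _ ⟨i, rfl⟩
      exact ⟨i, rfl⟩
    · rw [← hspan, Submodule.span_le]
      rintro _ ⟨i, rfl⟩
      by_cases h : i < D
      · exact Submodule.subset_span ⟨⟨i, h⟩, rfl⟩
      · obtain ⟨m, rfl⟩ := Nat.exists_eq_add_of_le (not_lt.1 h)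
        rw [hge]
        exact zero_mem _
  have hdim : D = 2 * K + 1 := by
    rw [← hW.finrank_eq, ← hspan', finrank_span_eq_card hli, Fintype.card_fin]
  -- so the lowest weight is `j - 2 K`, and `X⁺ (X⁻)^(2K+1) ▷ f = 0` says `[2K+1][2j-2K] = 0`
  have hlow := (hwt (2 * K)).le (hlt _ (by omega))
  have hhigh := hf.le hf0
  push_cast at hlow
  have hjK : j = K := by
    by_cases hK : K = N
    · omega
    · have h1 := (hlad (2 * K)).2
      rw [← hdim, hD, adXp_zero, eq_comm, smul_eq_zero_iff_left (hlt _ (by omega))] at h1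
      have h3 := qInt_mul_sub_mul q hq (j - D) D
      rw [sub_add_cancel, h1, eq_comm, mul_eq_zero, qInt_natCast] at h3
      by_contra hne
      refine h3.elim (hN D (by omega) (by omega)) (qInt_ne_zero hN ?_ ?_ ?_) <;> omega
  refine ⟨f, ?_, hp, hspan.symm⟩
  rw [← hjK]
  exact hf

end

section

/-! ### The spectrum of the Laplacian -/

variable {q : ℂ} {r : ℝ} {N : ℕ} {d d' : Sphere q r N}

namespace IsSphere

variable (h : IsSphere q (Lam q r N) ((r : ℂ) ^ 2) (sphereCoord q r N) d d')

theorem sandwich_add (f f' : Sphere q r N) :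
    h.sandwich (f + f') = h.sandwich f + h.sandwich f' := by
  simp only [sandwich, map_add, Matrix.add_apply, mul_add, add_mul, Finset.sum_add_distrib]

theorem sandwich_smul (c : ℂ) (f : Sphere q r N) : h.sandwich (c • f) = c • h.sandwich f := by
  simp only [sandwich, map_smul, Matrix.smul_apply, mul_smul_comm, smul_mul_assoc,
    Finset.smul_sum]

/-- `r² - sandwich` as a linear map. -/
def subSandwich : Sphere q r N →ₗ[ℂ] Sphere q r N where
  toFun f := ((r : ℂ) ^ 2) • f - h.sandwich f
  map_add' f f' := by rw [h.sandwich_add, smul_add]; abel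
  map_smul' c f := by rw [h.sandwich_smul, smul_sub, smul_comm, RingHom.id_apply]

/-- A spin `K` representation is spanned by the descendants of a vector of weight `K`, on each of
which the Casimir operator takes the value `[K] [K + 1]`. -/
theorem subSandwich_of_isSpinRep (hd : (d : SectorMat N) =
      Lam q r N • (1 : SectorMat N) - (q - q⁻¹) • coord q r N 1)
    (hN : ∀ n : ℕ, n ≠ 0 → n ≤ 2 * N → qNum q n ≠ 0) (h2 : qNum q 2 ≠ 0)
    (hC : casimirC q N ≠ 0) (hr : r ≠ 0) {K : ℕ} {W : Submodule ℂ (SectorMat N)}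
    (hW : IsSpinRep q r N K W) {ψ : Sphere q r N} (hψ : (ψ : SectorMat N) ∈ W) :
    h.subSandwich ψ =
      ((r : ℂ) ^ 2 / (qNum q 2 * casimirC q N) * (qNum q K * qNum q (K + 1))) • ψ := by
  have hq := h.q_ne_zero
  obtain ⟨f, hf, hp, hspan⟩ := exists_ladder hq hN h2 hC hW
  have hle : W ≤ (LinearMap.eqLocus h.subSandwich
      (((r : ℂ) ^ 2 / (qNum q 2 * casimirC q N) * (qNum q K * qNum q (K + 1))) •
        LinearMap.id)).map (Sphere q r N).val.toLinearMap := by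
    rw [hspan, Submodule.span_le]
    rintro _ ⟨i, rfl⟩
    have hmem : ladder q N f i ∈ Sphere q r N :=
      hW.le_sphere (by rw [hspan]; exact Submodule.subset_span ⟨i, rfl⟩)
    refine ⟨⟨_, hmem⟩, ?_, rfl⟩
    refine Subtype.ext ?_
    have hw := hasWeight_ladder (q := q) hf i
    refine (h.sub_sandwich_of_weight hq h2 hC hr hd (ψ := ⟨_, hmem⟩) hw).trans ?_
    rw [(adXp_ladder hq h2 hC hf hp i).1, ← add_smul, sub_add_cancel, smul_smul]
    rfl
  obtain ⟨ψ', hψ', he⟩ := hle hψ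
  have : ψ' = ψ := Subtype.ext he
  rw [← this]
  exact hψ'

end IsSphere

end

end QSphere

end

theorem mainTheorem6 (q : ℂ) (r : ℝ) (N : ℕ) (hN : 1 ≤ N) (hr : r ≠ 0)
    (hq : (∃ t : ℝ, t ≠ 0 ∧ q = t) ∨
      ∃ φ : ℝ, |φ| < 1 / (2 * N) ∧ q = Complex.exp (Complex.I * Real.pi * φ))
    (h3 : QSphere.qNum q 3 ≠ 0) (h4 : QSphere.qNum (q ^ 2) 2 ≠ 0)
    (hΛ : QSphere.qNum (q ^ (N + 1)) 2 ≠ 0) :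
    (∀ α : QSphere.Forms q r N, ∃! c : Finset (Fin 3) → QSphere.Sphere q r N,
      α = ∑ I, QSphere.xiMonomial q r N I * QSphere.fn q r N (c I)) ∧
    ∃ star : QSphere.Forms q r N →ₗ[ℂ] QSphere.Forms q r N,
      QSphere.IsHodgeStar q r N star ∧
      (∀ star', QSphere.IsHodgeStar q r N star' → star' = star) ∧
      ∀ (K : ℕ) (W : Submodule ℂ (QSphere.SectorMat N)),
        QSphere.IsSpinRep q r N K W →
        ∀ ψ : QSphere.Sphere q r N, (ψ : QSphere.SectorMat N) ∈ W →
          QSphere.laplacian q r N star ψ =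
            (2 / (QSphere.qNum q 2 * QSphere.casimirC q N) *
              QSphere.qNum q K * QSphere.qNum q (K + 1)) • QSphere.fn q r N ψ := by
  have hq0 : q ≠ 0 := by
    rcases hq with ⟨t, ht, rfl⟩ | ⟨φ, -, rfl⟩
    · exact Complex.ofReal_ne_zero.2 ht
    · exact Complex.exp_ne_zero _
  have hnum : ∀ n : ℕ, n ≠ 0 → n ≤ 2 * N → QSphere.qNum q n ≠ 0 :=
    fun n => QSphere.qNum_ne_zero hq
  have h2 : QSphere.qNum q 2 ≠ 0 := hnum 2 two_ne_zero (by omega)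
  have hC : QSphere.casimirC q N ≠ 0 := by
    refine div_ne_zero (mul_ne_zero (hnum N (by omega) (by omega)) ?_) (pow_ne_zero 2 h2)
    -- `N + 2 ≤ 2 N` fails for `N = 1`, where `[3] ≠ 0` is assumed
    rcases hN.eq_or_lt with rfl | hN'
    · exact h3
    · exact hnum _ (by omega) (by omega)
  have hL : QSphere.Lam q r N ≠ 0 :=
    div_ne_zero (mul_ne_zero (Complex.ofReal_ne_zero.2 hr) hΛ)
      (mul_ne_zero h2 (QSphere.csqrt_ne_zero hC))
  obtain ⟨d, d', hd, -, h⟩ := QSphere.exists_isSphere hq0 h2 hC hr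
  obtain ⟨star, hs⟩ := h.exists_isHodgeStar h2 h3 h4 hr hL
  refine ⟨QSphere.existsUnique_sum_xiMonomial h h2 h3 h4, star, hs,
    fun star' hs' => h.isHodgeStar_unique h2 h3 h4 hr hL hs hs', fun K W hW ψ hψ => ?_⟩
  have key : ((r : ℂ) ^ 2) • ψ - h.sandwich ψ = _ :=
    h.subSandwich_of_isSpinRep hd hnum h2 hC hr hW hψ
  have hr' : (r : ℂ) ≠ 0 := Complex.ofReal_ne_zero.2 hr
  rw [h.laplacian_eq h2 h3 h4 hr hs, key, map_smul, map_smul, smul_smul]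
  congr 1
  field_simp
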